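/- Let $n,m$ be positive integers, let $e_1,\dots,e_n$ and $f_1,\dots,f_m$ be the standard bases of $E=\mathbb C^n$ and $F=\mathbb C^m$, and let $u=(u_{(i,j),(k,l)})$ be a unitary matrix in $M_n(\mathbb C)\otimes M_m(\mathbb C)$. Identify $E\otimes F$ with $F\otimes E$ by $$e_i\otimes f_j=\sum_{k,l}u_{(i,j),(k,l)}\,f_l\otimes e_k,\qquad\text{equivalently}\qquad f_l\otimes e_k=\sum_{i,j}\overline{u_{(i,j),(k,l)}}\,e_i\otimes f_j .$$ On the Hilbert space direct sum $\mathcal F=\bigoplus_{k,l\ge 0}E^{\otimes k}\otimes F^{\otimes l}$ let $L_{e_i}$ and $L_{f_j}$ be the shift operators $L_{e_i}x=e_i\otimes x$ and $L_{f_j}x=f_j\otimes x$, where for $x\in E^{\otimes k}\otimes F^{\otimes l}$ the vector $f_j\otimes x$ is regarded as an element of $E^{\otimes k}\otimes F^{\otimes(l+1)}$ by repeated use of the identification. Let $\mathcal A_u$ be the norm closure, and $\mathcal L_u$ the closure in the weak* ($\sigma$-weak) topology of $B(\mathcal F)$, of the unital algebra generated by $L_{e_1},\dots,L_{e_n},L_{f_1},\dots,L_{f_m}$.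 For $d\ge 0$ the subspace of degree $d$ of $\mathcal A_u$ is the span of the products $L_{e_{i_1}}\cdots L_{e_{i_k}}L_{f_{j_1}}\cdots L_{f_{j_l}}$ with $k+l=d$. An algebra isomorphism $\mathcal A_u\to\mathcal A_v$ is called graded if for every $d$ it maps the subspace of degree $d$ of $\mathcal A_u$ onto that of $\mathcal A_v$. Two matrices $u,v\in M_n(\mathbb C)\otimes M_m(\mathbb C)$ are called product unitary equivalent if there are unitary matrices $A\in M_n(\mathbb C)$ and $B\in M_m(\mathbb C)$ with $(A\otimes B)v=u(A\otimes B)$, where $(A\otimes B)_{(i,j),(k,l)}=a_{i,k}b_{j,l}$. Theorem. For unitary matrices $u,v$ in $M_n(\mathbb C)\otimes M_m(\mathbb C)$ the following statements are equivalent. (i) There is an isometric (algebra) isomorphism $\Psi:\mathcal A_u\to\mathcal A_v$. (ii) There is a graded isometric isomorphism $\Psi:\mathcal A_u\to\mathcal A_v$. (iii) The matrices $u,v$ are product unitary equivalent, or $n=m$ and the matrices $u,\tilde v$ are product unitary equivalent, where $\tilde v_{(i,j),(k,l)}=\overline{v_{(l,k),(j,i)}}$. (iv) There is an isometric weak*-continuous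 isomorphism $\Gamma:\mathcal L_u\to\mathcal L_v$. -/

import Mathlib

open scoped Kronecker InnerProductSpace

noncomputable section

namespace UnitaryRelation

/-! ### The weak* topology on the bounded operators -/

section Ultraweak

variable {H : Type*} [NormedAddCommGroup H] [InnerProductSpace ℂ H]

/-- The functional `T ↦ ∑ₖ ⟪xₖ, T yₖ⟫` on `B(H)`. If `(xₖ)` and `(yₖ)` are square summable, it is
the pairing of `T` with the trace class operator `∑ₖ yₖ ⊗ xₖ*`, and every trace class operator is
of this form. -/
def normalFunctional (x y : ℕ → H) (T : H →L[ℂ] H) : ℂ :=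
  ∑' k, ⟪x k, T (y k)⟫_ℂ

variable (H) in
/-- The weak* topology of `B(H)`, as the dual of the trace class operators: the coarsest topology
for which all functionals `T ↦ ∑ₖ ⟪xₖ, T yₖ⟫` with `∑ ‖xₖ‖² < ∞` and `∑ ‖yₖ‖² < ∞` are
continuous. -/
@[reducible]
def weakStar : TopologicalSpace (H →L[ℂ] H) :=
  ⨅ (x : ℕ → H) (y : ℕ → H) (_ : Summable fun k => ‖x k‖ ^ 2) (_ : Summable fun k => ‖y k‖ ^ 2),
    TopologicalSpace.induced (normalFunctional x y) inferInstance

theorem summable_normalFunctional {x y : ℕ → H} (hx : Summable fun k => ‖x k‖ ^ 2)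
    (hy : Summable fun k => ‖y k‖ ^ 2) (T : H →L[ℂ] H) :
    Summable fun k => ⟪x k, T (y k)⟫_ℂ := by
  refine Summable.of_norm_bounded ((hx.add hy).mul_left ‖T‖) fun k => ?_
  have h1 : ‖⟪x k, T (y k)⟫_ℂ‖ ≤ ‖x k‖ * (‖T‖ * ‖y k‖) :=
    (norm_inner_le_norm _ _).trans (by gcongr; exact T.le_opNorm _)
  have h2 : ‖x k‖ * ‖y k‖ ≤ ‖x k‖ ^ 2 + ‖y k‖ ^ 2 := by
    nlinarith [sq_nonneg (‖x k‖ - ‖y k‖), sq_nonneg ‖x k‖, sq_nonneg ‖y k‖]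
  nlinarith [mul_le_mul_of_nonneg_left h2 (norm_nonneg T)]

theorem summable_sq_apply {x : ℕ → H} (hx : Summable fun k => ‖x k‖ ^ 2) (S : H →L[ℂ] H) :
    Summable fun k => ‖S (x k)‖ ^ 2 := by
  refine Summable.of_nonneg_of_le (fun k => by positivity) (fun k => ?_) (hx.mul_left (‖S‖ ^ 2))
  rw [← mul_pow]
  gcongr
  exact S.le_opNorm _

theorem continuous_normalFunctional {x y : ℕ → H} (hx : Summable fun k => ‖x k‖ ^ 2)
    (hy : Summable fun k => ‖y k‖ ^ 2) :
    @Continuous _ _ (weakStar H) _ (normalFunctional x y) := by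
  rw [continuous_iff_le_induced]
  exact iInf_le_of_le x (iInf_le_of_le y (iInf_le_of_le hx (iInf_le _ hy)))

theorem continuous_to_weakStar {X : Type*} [t : TopologicalSpace X] {f : X → (H →L[ℂ] H)}
    (hf : ∀ x y : ℕ → H, (Summable fun k => ‖x k‖ ^ 2) → (Summable fun k => ‖y k‖ ^ 2) →
      Continuous fun a => normalFunctional x y (f a)) :
    @Continuous _ _ t (weakStar H) f := by
  rw [continuous_iff_le_induced]
  simp only [weakStar, induced_iInf, le_iInf_iff, induced_compose]
  intro x y hx hy
  exact continuous_iff_le_induced.1 (hf x y hx hy)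

/-- Addition is jointly and multiplication separately continuous for the weak* topology. -/
theorem weakStar_isSemitopologicalSemiring [CompleteSpace H] :
    @IsSemitopologicalSemiring (H →L[ℂ] H) (weakStar H) _ := by
  let _ : TopologicalSpace (H →L[ℂ] H) := weakStar H
  refine
    { continuous_add := ?_, continuous_const_mul := fun {S} => ?_,
      continuous_mul_const := fun {S} => ?_ }
  · refine continuous_to_weakStar fun x y hx hy => ?_
    have h : (fun p : (H →L[ℂ] H) × (H →L[ℂ] H) => normalFunctional x y (p.1 + p.2)) =
        fun p => normalFunctional x y p.1 + normalFunctional x y p.2 := by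
      funext p
      simp only [normalFunctional, add_apply, inner_add_right]
      exact (summable_normalFunctional hx hy _).tsum_add (summable_normalFunctional hx hy _)
    rw [h]
    exact ((continuous_normalFunctional hx hy).comp continuous_fst).add
      ((continuous_normalFunctional hx hy).comp continuous_snd)
  · refine continuous_to_weakStar fun x y hx hy => ?_
    have h : (fun T : H →L[ℂ] H => normalFunctional x y (S * T)) =
        normalFunctional (fun k => ContinuousLinearMap.adjoint S (x k)) y := by
      funext T
      simp [normalFunctional, ContinuousLinearMap.adjoint_inner_left]
    rw [h]
    exact continuous_normalFunctional (summable_sq_apply hx _) hy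
  · refine continuous_to_weakStar fun x y hx hy => ?_
    have h : (fun T : H →L[ℂ] H => normalFunctional x y (T * S)) =
        normalFunctional x (fun k => S (y k)) := by
      funext T
      simp [normalFunctional]
    rw [h]
    exact continuous_normalFunctional hx (summable_sq_apply hy _)

/-- The weak* closure of a subalgebra of `B(H)`. -/
def weakStarClosure [CompleteSpace H] (S : Subalgebra ℂ (H →L[ℂ] H)) :
    Subalgebra ℂ (H →L[ℂ] H) :=
  letI : TopologicalSpace (H →L[ℂ] H) := weakStar H
  haveI := weakStar_isSemitopologicalSemiring (H := H)
  S.topologicalClosure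

/-- The relative weak* topology on a subalgebra of `B(H)`. -/
@[reducible]
def relWeakStar (S : Subalgebra ℂ (H →L[ℂ] H)) : TopologicalSpace S :=
  (weakStar H).induced Subtype.val

end Ultraweak

/-! ### The Fock space and the shift operators -/

/-- The Fock space `⊕_{k,l} (ℂⁿ)^{⊗k} ⊗ (ℂᵐ)^{⊗l}`, written in its orthonormal basis: the pair of
words `(i₁…iₖ, j₁…jₗ)` labels the vector `e_{i₁} ⊗ ⋯ ⊗ e_{iₖ} ⊗ f_{j₁} ⊗ ⋯ ⊗ f_{jₗ}`. -/
abbrev Fock (n m : ℕ) : Type :=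
  lp (fun _ : List (Fin n) × List (Fin m) => ℂ) 2

variable {n m : ℕ}

/-- The basis vector `e_{i₁} ⊗ ⋯ ⊗ e_{iₖ} ⊗ f_{j₁} ⊗ ⋯ ⊗ f_{jₗ}`, `p = i₁…iₖ`, `q = j₁…jₗ`. -/
def basisVec (p : List (Fin n)) (q : List (Fin m)) : Fock n m :=
  lp.single 2 (p, q) (1 : ℂ)

theorem inner_basisVec (p p' : List (Fin n)) (q q' : List (Fin m)) :
    ⟪basisVec p q, basisVec p' q'⟫_ℂ = if p = p' ∧ q = q' then 1 else 0 := by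
  simp [basisVec, lp.inner_single_left, lp.single_apply, Pi.single_apply, Prod.ext_iff]

theorem orthonormal_cons (i : Fin n) :
    Orthonormal ℂ fun w : List (Fin n) × List (Fin m) => basisVec (i :: w.1) w.2 := by
  classical
  rw [orthonormal_iff_ite]
  rintro ⟨p, q⟩ ⟨p', q'⟩
  simp [inner_basisVec]

/-- The shift `L_{e_i}`, which sends the basis vector `e_p ⊗ f_q` to `e_i ⊗ e_p ⊗ f_q`. -/
def shiftE (i : Fin n) : Fock n m →L[ℂ] Fock n m :=
  (orthonormal_cons i).orthogonalFamily.linearIsometry.toContinuousLinearMap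

theorem shiftE_basisVec (i : Fin n) (p : List (Fin n)) (q : List (Fin m)) :
    shiftE i (basisVec p q) = basisVec (i :: p) q := by
  simp [shiftE, basisVec, OrthogonalFamily.linearIsometry_apply_single]

theorem inner_shiftE_self (i : Fin n) (x y : Fock n m) :
    ⟪shiftE i x, shiftE i y⟫_ℂ = ⟪x, y⟫_ℂ :=
  LinearIsometry.inner_map_map (orthonormal_cons i).orthogonalFamily.linearIsometry x y

theorem inner_shiftE_eq_zero (v : Fock n m) (i : Fin n)
    (h : ∀ p q, ⟪v, basisVec (i :: p) q⟫_ℂ = 0) (x : Fock n m) : ⟪v, shiftE i x⟫_ℂ = 0 := by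
  have hs := ((orthonormal_cons (m := m) i).orthogonalFamily.hasSum_linearIsometry x).mapL
    (innerSL ℂ v)
  refine hs.unique ?_
  convert hasSum_zero with w
  simp [h]

theorem inner_shiftE_of_ne {i i' : Fin n} (hi : i ≠ i') (x y : Fock n m) :
    ⟪shiftE i x, shiftE i' y⟫_ℂ = 0 := by
  refine inner_shiftE_eq_zero _ _ (fun p q => ?_) y
  rw [inner_eq_zero_symm]
  refine inner_shiftE_eq_zero _ _ (fun p' q' => ?_) x
  simp [inner_basisVec, hi.symm]

theorem inner_shiftE (i i' : Fin n) (x y : Fock n m) :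
    ⟪shiftE i x, shiftE i' y⟫_ℂ = if i = i' then ⟪x, y⟫_ℂ else 0 := by
  split_ifs with h
  · subst h; exact inner_shiftE_self i x y
  · exact inner_shiftE_of_ne h x y

/-- The vector `f_l ⊗ e_p ⊗ f_q`, expressed in the basis of the Fock space by moving `f_l` to the
right through `e_p` with the rule `f_l ⊗ e_k = ∑_{i,j} conj u_{(i,j),(k,l)} e_i ⊗ f_j`. -/
def moveF (u : Matrix (Fin n × Fin m) (Fin n × Fin m) ℂ) :
    Fin m → List (Fin n) → List (Fin m) → Fock n m
  | l, [], q => basisVec [] (l :: q)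
  | l, k :: p, q => ∑ i, ∑ j, star (u (i, j) (k, l)) • shiftE i (moveF u j p q)

theorem inner_moveF (u : Matrix.unitaryGroup (Fin n × Fin m) ℂ) (l l' : Fin m)
    (p p' : List (Fin n)) (q q' : List (Fin m)) :
    ⟪moveF u.1 l p q, moveF u.1 l' p' q'⟫_ℂ =
      if l = l' ∧ p = p' ∧ q = q' then 1 else 0 := by
  have hnil : ∀ (l l' : Fin m) (k : Fin n) (p : List (Fin n)) (q q' : List (Fin m)),
      ⟪moveF u.1 l [] q, moveF u.1 l' (k :: p) q'⟫_ℂ = 0 := by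
    intro l l' k p q q'
    simp only [moveF, inner_sum, inner_smul_right]
    refine Finset.sum_eq_zero fun i _ => Finset.sum_eq_zero fun j _ => ?_
    rw [inner_shiftE_eq_zero _ _ (fun p q => by simp [inner_basisVec]), mul_zero]
  induction p generalizing l l' p' with
  | nil =>
    cases p' with
    | nil => simp [moveF, inner_basisVec]
    | cons k' p' => simp [hnil]
  | cons k p ih =>
    cases p' with
    | nil => rw [inner_eq_zero_symm.1 (hnil _ _ _ _ _ _)]; simp
    | cons k' p' =>
      have hu := congrFun (congrFun (Matrix.mem_unitaryGroup_iff'.1 u.2) (k', l')) (k, l)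
      simp only [Matrix.mul_apply, Matrix.star_apply, Matrix.one_apply, Fintype.sum_prod_type,
        Prod.mk.injEq] at hu
      simp only [moveF, sum_inner, inner_sum, inner_smul_left, inner_smul_right, inner_shiftE, ih]
      by_cases h : p = p' ∧ q = q'
      · simp [h, eq_comm, mul_comm] at hu ⊢
        simpa [and_comm] using hu
      · have h1 : ∀ a : Prop, ¬ (a ∧ p = p' ∧ q = q') := fun a ha => h ha.2
        simp only [h1, if_false, ite_self, mul_zero, Finset.sum_const_zero]
        rw [if_neg]
        rintro ⟨-, h2, h3⟩
        exact h ⟨(List.cons.inj h2).2, h3⟩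

theorem orthonormal_moveF (u : Matrix.unitaryGroup (Fin n × Fin m) ℂ) (l : Fin m) :
    Orthonormal ℂ fun w : List (Fin n) × List (Fin m) => moveF u.1 l w.1 w.2 := by
  classical
  rw [orthonormal_iff_ite]
  rintro ⟨p, q⟩ ⟨p', q'⟩
  simp [inner_moveF]

/-- The shift `L_{f_j}`, which sends the basis vector `e_p ⊗ f_q` to `f_j ⊗ e_p ⊗ f_q`, rewritten in
the basis of the Fock space by means of `u`. -/
def shiftF (u : Matrix.unitaryGroup (Fin n × Fin m) ℂ) (j : Fin m) : Fock n m →L[ℂ] Fock n m :=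
  (orthonormal_moveF u j).orthogonalFamily.linearIsometry.toContinuousLinearMap

/-! ### The algebras and their isomorphisms -/

/-- The unital algebra generated by all the shifts `L_{e_i}` and `L_{f_j}`. -/
def polyAlg (u : Matrix.unitaryGroup (Fin n × Fin m) ℂ) :
    Subalgebra ℂ (Fock n m →L[ℂ] Fock n m) :=
  Algebra.adjoin ℂ (Set.range shiftE ∪ Set.range (shiftF u))

/-- The algebra `𝒜_u`: the norm closure of the algebra generated by the shifts. -/
def normAlg (u : Matrix.unitaryGroup (Fin n × Fin m) ℂ) :
    Subalgebra ℂ (Fock n m →L[ℂ] Fock n m) :=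
  (polyAlg u).topologicalClosure

/-- The algebra `ℒ_u`: the weak* closure of the algebra generated by the shifts. -/
def weakStarAlg (u : Matrix.unitaryGroup (Fin n × Fin m) ℂ) :
    Subalgebra ℂ (Fock n m →L[ℂ] Fock n m) :=
  weakStarClosure (polyAlg u)

/-- The subspace of `𝒜_u` of total degree `d`: the span of all the products
`L_{e_{i₁}} ⋯ L_{e_{iₖ}} L_{f_{j₁}} ⋯ L_{f_{jₗ}}` with `k + l = d`. -/
def gradedPart (u : Matrix.unitaryGroup (Fin n × Fin m) ℂ) (d : ℕ) :
    Submodule ℂ (Fock n m →L[ℂ] Fock n m) :=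
  Submodule.span ℂ {T | ∃ (p : List (Fin n)) (q : List (Fin m)), p.length + q.length = d ∧
    T = (p.map shiftE).prod * (q.map (shiftF u)).prod}

/-- An isomorphism `𝒜_u → 𝒜_v` is graded if it maps, for every `d`, the subspace of degree `d`
of `𝒜_u` onto that of `𝒜_v`. -/
def IsGraded {u v : Matrix.unitaryGroup (Fin n × Fin m) ℂ} (Ψ : normAlg u ≃ₐ[ℂ] normAlg v) :
    Prop :=
  ∀ (d : ℕ) (T : normAlg u), (T : Fock n m →L[ℂ] Fock n m) ∈ gradedPart u d ↔
    (Ψ T : Fock n m →L[ℂ] Fock n m) ∈ gradedPart v d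

/-- `u` and `v` are product unitary equivalent: `(A ⊗ B) v = u (A ⊗ B)` for some unitary matrices
`A` and `B`. -/
def ProductUnitaryEquivalent (u v : Matrix (Fin n × Fin m) (Fin n × Fin m) ℂ) : Prop :=
  ∃ A ∈ Matrix.unitaryGroup (Fin n) ℂ, ∃ B ∈ Matrix.unitaryGroup (Fin m) ℂ,
    (A ⊗ₖ B) * v = u * (A ⊗ₖ B)

/-- For `n = m`, the matrix `ṽ` with entries `ṽ_{(i,j),(k,l)} = conj v_{(l,k),(j,i)}`. -/
def exchange (h : n = m) (v : Matrix (Fin n × Fin m) (Fin n × Fin m) ℂ) :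
    Matrix (Fin n × Fin m) (Fin n × Fin m) ℂ :=
  Matrix.of fun a b => star (v (Fin.cast h.symm b.2, Fin.cast h b.1)
    (Fin.cast h.symm a.2, Fin.cast h a.1))

end UnitaryRelation

end

noncomputable section

namespace UnitaryRelation

variable {n m : ℕ}

/-! ### Relations between the shifts -/

/-! From (iii) to (ii) and (iv). If `A` and `B` give the product unitary equivalence, the rotated
shifts `X = A L_e`, `Y = B L_f` of the algebra of `v` satisfy the relations of `u`. In the exchanged
case one takes `X = A L_f`, `Y = B L_e`. The vectors `X_p Y_q Ω` form an orthonormal basis, and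
conjugation by the unitary `e_p ⊗ f_q ↦ X_p Y_q Ω` carries generators to generators up to a linear
change. It therefore preserves degrees and both closures. This is the content of `IsShiftPair`.

From (i) or (iv) to (iii). Both closures are treated at once through `IsApprox` and `IsIso`, which
keep only what functionals of the form `T ↦ ℓ (T x)` can see. A point `(z, w)` of the product of the
open balls with `z ⊗ w` fixed by `u` gives a character. The isomorphism sends the vacuum character
of the algebra of `v` to a character of the algebra of `u` over a base point `(z₀, w₀)`, and the
derivations at the vacuum, which form all of `ℂⁿ × ℂᵐ`, to derivations there. This defines a
bijective linear tangent map.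

Three consequences follow. First, applying the derivations to the relations shows that `z₀ ⊗ y` and
`x ⊗ w₀` are fixed by `u` for all `x`, `y` (`linearized_relation`), and that the base point is
interior (`norm_lt_one_of_tangent`). Second, the Schwarz-Pick lemma along curves of characters, used
for the isomorphism and for its inverse, shows that the tangent map, normalized by the derivative of
the ball involution at the base point, preserves the maximum norm on pairs that are fixed tensors
(`tangent_forward`, `tangent_backward`). Since `(x, 0)` and `(0, y)` are such pairs, the strict
convexity of the Euclidean norms makes the tangent map block diagonal or block antidiagonal
(`components_ne_zero`, `blocks_inl`, `blocks_inr`). Third, a functional of second order applied to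
the relations yields the intertwining identity for the blocks (`quad_relation`).

The normalized blocks are unitary, and the normalizing factors commute with `u`
(`kronecker_mobiusDeriv_comm`), so the unitary blocks intertwine as well. In this way no
automorphism moving the base point to the origin has to be built. -/

/-- The vacuum vector. -/
def vac (n m : ℕ) : Fock n m := basisVec [] []

theorem inner_vac_vac : ⟪vac n m, vac n m⟫_ℂ = 1 := by
  rw [vac, inner_basisVec]
  simp

theorem norm_vac : ‖vac n m‖ = 1 := by
  have h' : ‖vac n m‖ ^ 2 = 1 := by
    rw [← inner_self_eq_norm_sq (𝕜 := ℂ), inner_vac_vac]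
    simp
  nlinarith [norm_nonneg (vac n m)]

theorem hasSum_basisVec (x : Fock n m) :
    HasSum (fun w : List (Fin n) × List (Fin m) => x w • basisVec w.1 w.2) x := by
  have h := lp.hasSum_single (E := fun _ : List (Fin n) × List (Fin m) => ℂ) (p := 2)
    (by simp) x
  convert h using 2 with w
  rw [basisVec, ← lp.single_smul, smul_eq_mul, mul_one]

theorem map_eq_of_basisVec {G : Type*} [NormedAddCommGroup G] [NormedSpace ℂ G]
    {S T : Fock n m →L[ℂ] G} (h : ∀ p q, S (basisVec p q) = T (basisVec p q)) : S = T := by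
  ext x
  refine ((hasSum_basisVec x).mapL S).unique ?_
  simpa [h] using (hasSum_basisVec x).mapL T

theorem shiftF_basisVec (u : Matrix.unitaryGroup (Fin n × Fin m) ℂ) (j : Fin m)
    (p : List (Fin n)) (q : List (Fin m)) : shiftF u j (basisVec p q) = moveF u.1 j p q := by
  simp [shiftF, basisVec, OrthogonalFamily.linearIsometry_apply_single]

theorem shiftF_basisVec_nil (u : Matrix.unitaryGroup (Fin n × Fin m) ℂ) (j : Fin m)
    (q : List (Fin m)) :
    shiftF u j (basisVec ([] : List (Fin n)) q) = basisVec [] (j :: q) := by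
  rw [shiftF_basisVec, moveF]

theorem shiftF_mul_shiftE (u : Matrix.unitaryGroup (Fin n × Fin m) ℂ) (l : Fin m) (k : Fin n) :
    shiftF u l * shiftE k = ∑ i, ∑ j, star (u.1 (i, j) (k, l)) • (shiftE i * shiftF u j) := by
  refine map_eq_of_basisVec fun p q => ?_
  simp [shiftE_basisVec, shiftF_basisVec, moveF]

/-- A family inverse to the one of `shiftF_mul_shiftE`. -/
theorem mul_eq_sum_of_mul_eq_sum {R : Type*} [Ring R] [Algebra ℂ R]
    (u : Matrix.unitaryGroup (Fin n × Fin m) ℂ) {X : Fin n → R} {Y : Fin m → R}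
    (h : ∀ l k, Y l * X k = ∑ i, ∑ j, star (u.1 (i, j) (k, l)) • (X i * Y j)) (i : Fin n)
    (j : Fin m) : X i * Y j = ∑ k, ∑ l, u.1 (i, j) (k, l) • (Y l * X k) := by
  simp only [h, Finset.smul_sum, smul_smul]
  have hu := Matrix.mem_unitaryGroup_iff.1 u.2
  have key : ∀ a : Fin n × Fin m, ∑ k, ∑ l, u.1 (i, j) (k, l) * star (u.1 a (k, l)) =
      if (i, j) = a then 1 else 0 := by
    intro a
    have := congrFun (congrFun hu (i, j)) a
    simpa [Matrix.mul_apply, Matrix.one_apply, Fintype.sum_prod_type] using this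
  calc X i * Y j = ∑ a : Fin n × Fin m, (if (i, j) = a then (1 : ℂ) else 0) • (X a.1 * Y a.2) := by
        simp
    _ = ∑ a : Fin n × Fin m, ∑ b : Fin n × Fin m,
          (u.1 (i, j) b * star (u.1 a b)) • (X a.1 * Y a.2) := by
        refine Finset.sum_congr rfl fun a _ => ?_
        rw [← key a, Finset.sum_smul, Fintype.sum_prod_type]
        simp only [Finset.sum_smul]
    _ = ∑ b : Fin n × Fin m, ∑ a : Fin n × Fin m,
          (u.1 (i, j) b * star (u.1 a b)) • (X a.1 * Y a.2) := Finset.sum_comm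
    _ = _ := by simp only [Fintype.sum_prod_type]

theorem sum_eq_mul_of_mul_eq_sum {R : Type*} [Ring R] [Algebra ℂ R]
    (u : Matrix.unitaryGroup (Fin n × Fin m) ℂ) {X : Fin n → R} {Y : Fin m → R}
    (h : ∀ i j, X i * Y j = ∑ k, ∑ l, u.1 (i, j) (k, l) • (Y l * X k)) (l : Fin m)
    (k : Fin n) : Y l * X k = ∑ i, ∑ j, star (u.1 (i, j) (k, l)) • (X i * Y j) := by
  simp only [h, Finset.smul_sum, smul_smul]
  have hu := Matrix.mem_unitaryGroup_iff'.1 u.2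
  have key : ∀ a : Fin n × Fin m, ∑ i, ∑ j, star (u.1 (i, j) (k, l)) * u.1 (i, j) a =
      if (k, l) = a then 1 else 0 := by
    intro a
    have := congrFun (congrFun hu (k, l)) a
    simpa [Matrix.mul_apply, Matrix.one_apply, Fintype.sum_prod_type] using this
  calc Y l * X k = ∑ a : Fin n × Fin m, (if (k, l) = a then (1 : ℂ) else 0) • (Y a.2 * X a.1) := by
        simp
    _ = ∑ a : Fin n × Fin m, ∑ b : Fin n × Fin m,
          (star (u.1 b (k, l)) * u.1 b a) • (Y a.2 * X a.1) := by
        refine Finset.sum_congr rfl fun a _ => ?_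
        rw [← key a, Finset.sum_smul, Fintype.sum_prod_type]
        simp only [Finset.sum_smul]
    _ = ∑ b : Fin n × Fin m, ∑ a : Fin n × Fin m,
          (star (u.1 b (k, l)) * u.1 b a) • (Y a.2 * X a.1) := Finset.sum_comm
    _ = _ := by simp only [Fintype.sum_prod_type]

theorem shiftE_mul_shiftF (u : Matrix.unitaryGroup (Fin n × Fin m) ℂ) (i : Fin n) (j : Fin m) :
    shiftE i * shiftF u j = ∑ k, ∑ l, u.1 (i, j) (k, l) • (shiftF u l * shiftE k) :=
  mul_eq_sum_of_mul_eq_sum u (shiftF_mul_shiftE u) i j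

/-- Operators are equal as sesquilinear forms if they agree on basis vectors. -/
theorem inner_eq_of_basisVec {S T S' T' : Fock n m →L[ℂ] Fock n m}
    (h : ∀ p q p' q', ⟪S (basisVec p q), T (basisVec p' q')⟫_ℂ =
      ⟪S' (basisVec p q), T' (basisVec p' q')⟫_ℂ) (x y : Fock n m) :
    ⟪S x, T y⟫_ℂ = ⟪S' x, T' y⟫_ℂ := by
  have h1 : (ContinuousLinearMap.adjoint S) * T = (ContinuousLinearMap.adjoint S') * T' := by
    refine map_eq_of_basisVec fun p' q' => ext_inner_left ℂ fun x => ?_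
    simp only [mul_apply_eq_comp, ContinuousLinearMap.adjoint_inner_right]
    rw [← inner_conj_symm, ← inner_conj_symm (S' x)]
    congr 1
    have h2 : (innerSL ℂ (T (basisVec p' q'))) ∘L S = (innerSL ℂ (T' (basisVec p' q'))) ∘L S' := by
      refine map_eq_of_basisVec fun p q => ?_
      simp only [ContinuousLinearMap.comp_apply, innerSL_apply_apply]
      rw [← inner_conj_symm, h, inner_conj_symm]
    exact congrArg (fun f : Fock n m →L[ℂ] ℂ => f x) h2
  rw [← ContinuousLinearMap.adjoint_inner_right, ← ContinuousLinearMap.adjoint_inner_right]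
  exact congrArg (fun f : Fock n m →L[ℂ] Fock n m => ⟪x, f y⟫_ℂ) h1

theorem inner_shiftF (u : Matrix.unitaryGroup (Fin n × Fin m) ℂ) (j j' : Fin m) (x y : Fock n m) :
    ⟪shiftF u j x, shiftF u j' y⟫_ℂ = if j = j' then ⟪x, y⟫_ℂ else 0 := by
  have := inner_eq_of_basisVec (S := shiftF u j) (T := shiftF u j')
    (S' := (if j = j' then (1 : ℂ) else 0) • ContinuousLinearMap.id ℂ _)
    (T' := ContinuousLinearMap.id ℂ _) (fun p q p' q' => by
      by_cases h : j = j' <;> simp [shiftF_basisVec, inner_moveF, h, inner_basisVec]) x y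
  rw [this]
  by_cases h : j = j' <;> simp [h]

theorem inner_basisVec_nil_shiftE (i : Fin n) (q : List (Fin m)) (x : Fock n m) :
    ⟪basisVec [] q, shiftE i x⟫_ℂ = 0 :=
  inner_shiftE_eq_zero _ _ (fun p q' => by simp [inner_basisVec]) x

/-- Each use of the relation trades one `f` on the left of an `e` for one `f` on its right, so a
letter `f` always survives at the end and no pure `e`-word can occur. -/
theorem inner_basisVec_nil_shiftF (u : Matrix.unitaryGroup (Fin n × Fin m) ℂ) (j : Fin m)
    (p : List (Fin n)) (x : Fock n m) : ⟪basisVec p [], shiftF u j x⟫_ℂ = 0 := by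
  have key : ∀ (p p' : List (Fin n)) (j : Fin m) (q : List (Fin m)),
      ⟪basisVec p [], moveF u.1 j p' q⟫_ℂ = 0 := by
    intro p
    induction p with
    | nil =>
      intro p' j q
      cases p' with
      | nil => simp [moveF, inner_basisVec]
      | cons k p' => simp [moveF, inner_basisVec_nil_shiftE]
    | cons i p ih =>
      intro p' j q
      cases p' with
      | nil => simp [moveF, inner_basisVec]
      | cons k p' =>
        simp [moveF, ← shiftE_basisVec, inner_shiftE, ih]
  have h : (innerSL ℂ (basisVec p [])) ∘L shiftF u j = 0 :=
    map_eq_of_basisVec fun p' q => by simp [shiftF_basisVec, key]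
  simpa using congrArg (fun f : Fock n m →L[ℂ] ℂ => f x) h

theorem inner_vac_shiftE (i : Fin n) (x : Fock n m) : ⟪vac n m, shiftE i x⟫_ℂ = 0 :=
  inner_basisVec_nil_shiftE i [] x

theorem inner_vac_shiftF (u : Matrix.unitaryGroup (Fin n × Fin m) ℂ) (j : Fin m) (x : Fock n m) :
    ⟪vac n m, shiftF u j x⟫_ℂ = 0 :=
  inner_basisVec_nil_shiftF u j [] x

/-! ### Norms of combinations of isometries with orthogonal ranges -/

theorem norm_sum_smul_apply {H : Type*} [NormedAddCommGroup H] [InnerProductSpace ℂ H] {k : ℕ}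
    {S : Fin k → H →L[ℂ] H} (hS : ∀ i j x y, ⟪S i x, S j y⟫_ℂ = if i = j then ⟪x, y⟫_ℂ else 0)
    (c : EuclideanSpace ℂ (Fin k)) (x : H) : ‖(∑ i, c i • S i) x‖ = ‖c‖ * ‖x‖ := by
  have h' : ‖(∑ i, c i • S i) x‖ ^ 2 = (‖c‖ * ‖x‖) ^ 2 := by
    rw [← inner_self_eq_norm_sq (𝕜 := ℂ), mul_pow, EuclideanSpace.norm_sq_eq, sum_apply]
    simp only [smul_apply, sum_inner, inner_sum, inner_smul_left, inner_smul_right, hS, mul_ite,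
      mul_zero, Finset.sum_ite_eq', Finset.mem_univ, if_true]
    rw [map_sum, Finset.sum_mul]
    refine Finset.sum_congr rfl fun i _ => ?_
    rw [← mul_assoc, Complex.mul_conj', ← inner_self_eq_norm_sq (𝕜 := ℂ) x]
    norm_cast
    exact RCLike.re_ofReal_mul _ _
  exact (pow_left_inj₀ (norm_nonneg _) (by positivity) two_ne_zero).1 h'

theorem norm_sum_smul_le {H : Type*} [NormedAddCommGroup H] [InnerProductSpace ℂ H] {k : ℕ}
    {S : Fin k → H →L[ℂ] H} (hS : ∀ i j x y, ⟪S i x, S j y⟫_ℂ = if i = j then ⟪x, y⟫_ℂ else 0)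
    (c : EuclideanSpace ℂ (Fin k)) : ‖∑ i, c i • S i‖ ≤ ‖c‖ :=
  ContinuousLinearMap.opNorm_le_bound _ (norm_nonneg _) fun x => (norm_sum_smul_apply hS c x).le

/-! ### Point evaluations -/

/-- `x ⊗ y` is a fixed vector of `u`, that is, `(x, y)` satisfies the commutation relations. -/
def FixedTensor (u : Matrix (Fin n × Fin m) (Fin n × Fin m) ℂ) (x : EuclideanSpace ℂ (Fin n))
    (y : EuclideanSpace ℂ (Fin m)) : Prop :=
  ∀ i j, ∑ k, ∑ l, u (i, j) (k, l) * (x k * y l) = x i * y j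

theorem FixedTensor.smul {u : Matrix (Fin n × Fin m) (Fin n × Fin m) ℂ}
    {x : EuclideanSpace ℂ (Fin n)} {y : EuclideanSpace ℂ (Fin m)} (h : FixedTensor u x y)
    (s t : ℂ) : FixedTensor u (s • x) (t • y) := by
  intro i j
  have := congrArg (fun a => s * t * a) (h i j)
  simp only [Finset.mul_sum] at this
  simp only [PiLp.smul_apply, smul_eq_mul]
  rw [show s * x i * (t * y j) = s * t * (x i * y j) by ring, ← this]
  refine Finset.sum_congr rfl fun k _ => Finset.sum_congr rfl fun l _ => by ring

theorem FixedTensor.add_left {u : Matrix (Fin n × Fin m) (Fin n × Fin m) ℂ}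
    {x x' : EuclideanSpace ℂ (Fin n)} {y : EuclideanSpace ℂ (Fin m)} (h : FixedTensor u x y)
    (h' : FixedTensor u x' y) : FixedTensor u (x + x') y := by
  intro i j
  simp only [PiLp.add_apply, add_mul, mul_add, Finset.sum_add_distrib, h i j, h' i j]

theorem FixedTensor.add_right {u : Matrix (Fin n × Fin m) (Fin n × Fin m) ℂ}
    {x : EuclideanSpace ℂ (Fin n)} {y y' : EuclideanSpace ℂ (Fin m)} (h : FixedTensor u x y)
    (h' : FixedTensor u x y') : FixedTensor u x (y + y') := by
  intro i j
  simp only [PiLp.add_apply, mul_add, Finset.sum_add_distrib, h i j, h' i j]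

theorem fixedTensor_zero_left (u : Matrix (Fin n × Fin m) (Fin n × Fin m) ℂ)
    (y : EuclideanSpace ℂ (Fin m)) : FixedTensor u 0 y := fun i j => by simp

theorem fixedTensor_zero_right (u : Matrix (Fin n × Fin m) (Fin n × Fin m) ℂ)
    (x : EuclideanSpace ℂ (Fin n)) : FixedTensor u x 0 := fun i j => by simp

/-- The annihilation operator `∑ zᵢ L_{e_i}*`. -/
def annE (z : EuclideanSpace ℂ (Fin n)) : Fock n m →L[ℂ] Fock n m := ∑ i, z i • star (shiftE i)

/-- The annihilation operator `∑ wⱼ L_{f_j}*`. -/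
def annF (u : Matrix.unitaryGroup (Fin n × Fin m) ℂ) (w : EuclideanSpace ℂ (Fin m)) :
    Fock n m →L[ℂ] Fock n m := ∑ j, w j • star (shiftF u j)

theorem star_mul_of_inner {H : Type*} [NormedAddCommGroup H] [InnerProductSpace ℂ H]
    [CompleteSpace H] {k : ℕ} {S : Fin k → H →L[ℂ] H}
    (hS : ∀ i j x y, ⟪S i x, S j y⟫_ℂ = if i = j then ⟪x, y⟫_ℂ else 0) (i j : Fin k) :
    star (S i) * S j = if i = j then 1 else 0 := by
  ext x
  refine ext_inner_left ℂ fun y => ?_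
  rw [mul_apply_eq_comp, ContinuousLinearMap.star_eq_adjoint,
    ContinuousLinearMap.adjoint_inner_right, hS]
  split_ifs <;> simp

theorem norm_sum_smul_star_le {H : Type*} [NormedAddCommGroup H] [InnerProductSpace ℂ H]
    [CompleteSpace H] {k : ℕ} {S : Fin k → H →L[ℂ] H}
    (hS : ∀ i j x y, ⟪S i x, S j y⟫_ℂ = if i = j then ⟪x, y⟫_ℂ else 0)
    (c : EuclideanSpace ℂ (Fin k)) : ‖∑ i, c i • star (S i)‖ ≤ ‖c‖ := by
  have h : ∑ i, c i • star (S i) =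
      star (∑ i, (WithLp.toLp 2 (fun i => star (c i)) : EuclideanSpace ℂ (Fin k)) i • S i) := by
    simp [star_sum]
  rw [h, norm_star]
  refine (norm_sum_smul_le hS _).trans (le_of_eq ?_)
  simp [EuclideanSpace.norm_eq]

theorem norm_annE_le (z : EuclideanSpace ℂ (Fin n)) : ‖annE (m := m) z‖ ≤ ‖z‖ :=
  norm_sum_smul_star_le inner_shiftE z

theorem norm_annF_le (u : Matrix.unitaryGroup (Fin n × Fin m) ℂ) (w : EuclideanSpace ℂ (Fin m)) :
    ‖annF u w‖ ≤ ‖w‖ :=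
  norm_sum_smul_star_le (inner_shiftF u) w

theorem annE_mul_shiftE (z : EuclideanSpace ℂ (Fin n)) (i : Fin n) :
    annE z * shiftE (m := m) i = z i • 1 := by
  simp [annE, Finset.sum_mul, star_mul_of_inner inner_shiftE]

theorem annF_mul_shiftF (u : Matrix.unitaryGroup (Fin n × Fin m) ℂ) (w : EuclideanSpace ℂ (Fin m))
    (j : Fin m) : annF u w * shiftF u j = w j • 1 := by
  simp [annF, Finset.sum_mul, star_mul_of_inner (inner_shiftF u)]

/-- Adjoints reverse the relation, so both products expand in the operators `star (shiftE i * shiftF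
u j)`. Equality of the coefficients is exactly the condition that `z ⊗ w` is fixed by `u`. -/
theorem annE_mul_annF (u : Matrix.unitaryGroup (Fin n × Fin m) ℂ) {z : EuclideanSpace ℂ (Fin n)}
    {w : EuclideanSpace ℂ (Fin m)} (h : FixedTensor u.1 z w) :
    annE z * annF u w = annF u w * annE z := by
  have h1 : annE z * annF u w =
      ∑ k, ∑ l, ∑ i, ∑ j, (u.1 (i, j) (k, l) * (z k * w l)) • (star (shiftE i * shiftF u j)) := by
    rw [annE, annF, Finset.sum_mul_sum]
    refine Finset.sum_congr rfl fun k _ => Finset.sum_congr rfl fun l _ => ?_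
    rw [smul_mul_smul_comm, ← star_mul, shiftF_mul_shiftE]
    simp only [star_sum, star_smul, star_star, Finset.smul_sum, smul_smul, mul_comm]
  have h2 : annF u w * annE z = ∑ i, ∑ j, (z i * w j) • star (shiftE i * shiftF u j) := by
    rw [annE, annF, Finset.sum_mul_sum, Finset.sum_comm]
    refine Finset.sum_congr rfl fun k _ => Finset.sum_congr rfl fun l _ => ?_
    rw [smul_mul_smul_comm, ← star_mul, mul_comm (w l)]
  rw [h1, h2]
  have h3 : ∀ i j, (z i * w j) • star (shiftE i * shiftF u j) =
      ∑ k, ∑ l, (u.1 (i, j) (k, l) * (z k * w l)) • star (shiftE i * shiftF u j) := fun i j => by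
    rw [← h i j]
    simp only [Finset.sum_smul]
  simp only [h3]
  have h4 := Finset.sum_comm (s := (Finset.univ : Finset (Fin n × Fin m)))
    (t := (Finset.univ : Finset (Fin n × Fin m)))
    (f := fun a b => (u.1 b a * (z a.1 * w a.2)) • star (shiftE b.1 * shiftF u b.2))
  simpa only [Fintype.sum_prod_type] using h4

/-- The inverse of `1 - T` leaves the closed subspaces invariant that `T` leaves invariant. -/
theorem inverse_one_sub_mem {H : Type*} [NormedAddCommGroup H] [NormedSpace ℂ H]
    [CompleteSpace H] {T : H →L[ℂ] H} (hT : ‖T‖ < 1) {K : Submodule ℂ H}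
    (hK : IsClosed (K : Set H)) (hTK : ∀ x ∈ K, T x ∈ K) {x : H} (hx : x ∈ K) :
    Ring.inverse (1 - T) x ∈ K := by
  rw [NormedRing.inverse_one_sub T hT]
  have hs : HasSum (fun k : ℕ => (T ^ k) x) ((Units.oneSub T hT)⁻¹.1 x) :=
    (summable_geometric_of_norm_lt_one hT).hasSum.mapL
      (ContinuousLinearMap.apply ℂ H x)
  refine hK.mem_of_tendsto hs (Filter.Eventually.of_forall fun s => K.sum_mem fun k hk => ?_)
  clear hk
  induction k with
  | zero => simpa using hx
  | succ k ih => rw [pow_succ', mul_apply_eq_comp]; exact hTK _ ih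

theorem isUnit_one_sub {R : Type*} [NormedRing R] [HasSummableGeomSeries R] {T : R} (hT : ‖T‖ < 1) :
    IsUnit (1 - T) := ⟨Units.oneSub T hT, rfl⟩

/-- Evaluation at the point `(z, w)`, as a functional on the Fock space. -/
def pointFunctional (u : Matrix.unitaryGroup (Fin n × Fin m) ℂ) (z : EuclideanSpace ℂ (Fin n))
    (w : EuclideanSpace ℂ (Fin m)) : Fock n m →L[ℂ] ℂ :=
  innerSL ℂ (vac n m) ∘L (Ring.inverse (1 - annF u w) * Ring.inverse (1 - annE z))

section

variable (u : Matrix.unitaryGroup (Fin n × Fin m) ℂ) {z : EuclideanSpace ℂ (Fin n)}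
  {w : EuclideanSpace ℂ (Fin m)}

theorem star_shiftE_vac (i : Fin n) : star (shiftE i) (vac n m) = 0 := by
  refine ext_inner_right ℂ fun y => ?_
  rw [ContinuousLinearMap.star_eq_adjoint, ContinuousLinearMap.adjoint_inner_left,
    inner_vac_shiftE, inner_zero_left]

theorem star_shiftF_vac (j : Fin m) : star (shiftF u j) (vac n m) = 0 := by
  refine ext_inner_right ℂ fun y => ?_
  rw [ContinuousLinearMap.star_eq_adjoint, ContinuousLinearMap.adjoint_inner_left,
    inner_vac_shiftF, inner_zero_left]

theorem inverse_apply_of_apply {H : Type*} [NormedAddCommGroup H] [NormedSpace ℂ H]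
    {T : H →L[ℂ] H} (hT : IsUnit T) {x y : H} (h : T x = y) : Ring.inverse T y = x := by
  rw [← h, ← mul_apply_eq_comp, Ring.inverse_mul_cancel _ hT, one_apply_eq_self]

theorem pointFunctional_vac (hz : ‖z‖ < 1) (hw : ‖w‖ < 1) :
    pointFunctional u z w (vac n m) = 1 := by
  have h1 : Ring.inverse (1 - annE z) (vac n m) = vac n m :=
    inverse_apply_of_apply (isUnit_one_sub ((norm_annE_le z).trans_lt hz))
      (by simp [annE, star_shiftE_vac])
  have h2 : Ring.inverse (1 - annF u w) (vac n m) = vac n m :=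
    inverse_apply_of_apply (isUnit_one_sub ((norm_annF_le u w).trans_lt hw))
      (by simp [annF, star_shiftF_vac])
  simp only [pointFunctional, ContinuousLinearMap.comp_apply, mul_apply_eq_comp, h1, h2,
    innerSL_apply_apply, inner_vac_vac]

theorem isClosed_orthogonal_family {ι : Type*} (b : ι → Fock n m) :
    ∃ K : Submodule ℂ (Fock n m), IsClosed (K : Set (Fock n m)) ∧
      ∀ x, x ∈ K ↔ ∀ i, ⟪b i, x⟫_ℂ = 0 := by
  refine ⟨(Submodule.span ℂ (Set.range b))ᗮ, Submodule.isClosed_orthogonal _, fun x => ?_⟩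
  rw [Submodule.mem_orthogonal]
  refine ⟨fun h i => h _ (Submodule.subset_span ⟨i, rfl⟩), fun h y hy => ?_⟩
  induction hy using Submodule.span_induction with
  | mem y hy => obtain ⟨i, rfl⟩ := hy; exact h i
  | zero => simp
  | add _ _ _ _ h1 h2 => rw [inner_add_left, h1, h2, add_zero]
  | smul a _ _ h1 => rw [inner_smul_left, h1, mul_zero]

/-- From `A * S = c • 1` one gets `(1 - A) * S = S - c • 1`; multiply by the inverse. This is how
the resolvent of an annihilation operator turns a shift into a scalar, up to the stray term `S`. -/
theorem inverse_one_sub_mul {R : Type*} [Ring R] [Algebra ℂ R] {A S : R} {c : ℂ}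
    (hA : IsUnit (1 - A)) (h : A * S = c • 1) :
    Ring.inverse (1 - A) * S = S + c • Ring.inverse (1 - A) := by
  have h1 : (1 - A) * S = S - c • 1 := by rw [sub_mul, h, one_mul]
  have h2 := Ring.inverse_mul_cancel_left (1 - A) S hA
  rw [h1, mul_sub] at h2
  rw [← sub_eq_iff_eq_add]
  simpa using h2

/-- The stray term of `inverse_one_sub_mul` dies: the range of `shiftE i` is orthogonal to all pure
`f`-words, and the resolvent of `annF u w` preserves this orthogonal complement. No condition on `z
⊗ w` enters, because the resolvent of `annE z` acts first. -/
theorem pointFunctional_shiftE (hz : ‖z‖ < 1) (hw : ‖w‖ < 1) (i : Fin n) (x : Fock n m) :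
    pointFunctional u z w (shiftE i x) = z i * pointFunctional u z w x := by
  have hA := isUnit_one_sub ((norm_annE_le (m := m) z).trans_lt hz)
  obtain ⟨K, hK, hmem⟩ := isClosed_orthogonal_family
    (fun q : List (Fin m) => basisVec ([] : List (Fin n)) q)
  have hin : Ring.inverse (1 - annF u w) (shiftE i x) ∈ K := by
    refine inverse_one_sub_mem ((norm_annF_le u w).trans_lt hw) hK (fun y hy => ?_)
      ((hmem _).2 fun q => inner_basisVec_nil_shiftE i q x)
    rw [hmem] at hy ⊢
    intro q
    simp [annF, ContinuousLinearMap.star_eq_adjoint,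
      ContinuousLinearMap.adjoint_inner_right, shiftF_basisVec_nil, hy]
  have h0 : ⟪vac n m, Ring.inverse (1 - annF u w) (shiftE i x)⟫_ℂ = 0 := (hmem _).1 hin []
  have h1 := congrArg (fun T : Fock n m →L[ℂ] Fock n m => T x)
    (inverse_one_sub_mul hA (annE_mul_shiftE z i))
  simp only [mul_apply_eq_comp, add_apply, smul_apply] at h1
  simp [pointFunctional, h1, inner_add_right, inner_smul_right, h0]

/-- The mirror image of the argument for `shiftE`, with pure `e`-words. The two resolvents must
first be interchanged, and this is where the fixed tensor condition is used. -/
theorem pointFunctional_shiftF (hz : ‖z‖ < 1) (hw : ‖w‖ < 1) (h : FixedTensor u.1 z w) (j : Fin m)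
    (x : Fock n m) : pointFunctional u z w (shiftF u j x) = w j * pointFunctional u z w x := by
  have hA := isUnit_one_sub ((norm_annE_le (m := m) z).trans_lt hz)
  have hB := isUnit_one_sub ((norm_annF_le u w).trans_lt hw)
  have hcomm : Ring.inverse (1 - annF u w) * Ring.inverse (1 - annE z) =
      Ring.inverse (1 - annE z) * Ring.inverse (1 - annF u w) := by
    have hc : Commute (1 - annF u w) (1 - annE z) :=
      ((Commute.one_left _).sub_left ((Commute.one_right _).sub_right (annE_mul_annF u h).symm))
    exact hc.ringInverse_ringInverse.eq
  obtain ⟨K, hK, hmem⟩ := isClosed_orthogonal_family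
    (fun p : List (Fin n) => basisVec p ([] : List (Fin m)))
  have hin : Ring.inverse (1 - annE z) (shiftF u j x) ∈ K := by
    refine inverse_one_sub_mem ((norm_annE_le z).trans_lt hz) hK (fun y hy => ?_)
      ((hmem _).2 fun p => inner_basisVec_nil_shiftF u j p x)
    rw [hmem] at hy ⊢
    intro q
    simp [annE, ContinuousLinearMap.star_eq_adjoint,
      ContinuousLinearMap.adjoint_inner_right, shiftE_basisVec, hy]
  have h0 : ⟪vac n m, Ring.inverse (1 - annE z) (shiftF u j x)⟫_ℂ = 0 := (hmem _).1 hin []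
  have h1 := congrArg (fun T : Fock n m →L[ℂ] Fock n m => T x)
    (inverse_one_sub_mul hB (annF_mul_shiftF u w j))
  simp only [mul_apply_eq_comp, add_apply, smul_apply] at h1
  simp [pointFunctional, hcomm, h1, inner_add_right, inner_smul_right, h0]

theorem pointFunctional_mul (hz : ‖z‖ < 1) (hw : ‖w‖ < 1) (h : FixedTensor u.1 z w)
    {T : Fock n m →L[ℂ] Fock n m} (hT : T ∈ polyAlg u) (x : Fock n m) :
    pointFunctional u z w (T x) = pointFunctional u z w (T (vac n m)) * pointFunctional u z w x := by
  have hv := pointFunctional_vac u hz hw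
  induction hT using Algebra.adjoin_induction generalizing x with
  | mem T hT =>
    rcases hT with ⟨i, rfl⟩ | ⟨j, rfl⟩
    · simp only [pointFunctional_shiftE u hz hw, hv, mul_one]
    · simp only [pointFunctional_shiftF u hz hw h, hv, mul_one]
  | algebraMap c => simp [Algebra.algebraMap_eq_smul_one, hv]
  | add S T _ _ h1 h2 => simp only [add_apply, map_add, h1 x, h2 x, add_mul]
  | mul S T _ _ h1 h2 =>
    simp only [mul_apply_eq_comp]
    rw [h1 (T x), h2 x, h1 (T (vac n m)), mul_assoc]

/-- Inversion is holomorphic on the units and the annihilation operators are linear in the point, so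
the evaluations are holomorphic in the norm of the dual and not only pointwise. -/
theorem differentiableAt_pointFunctional {γ : ℂ → EuclideanSpace ℂ (Fin n)}
    {δ : ℂ → EuclideanSpace ℂ (Fin m)} {t : ℂ} (hγ : DifferentiableAt ℂ γ t)
    (hδ : DifferentiableAt ℂ δ t) (hz : ‖γ t‖ < 1) (hw : ‖δ t‖ < 1) :
    DifferentiableAt ℂ (fun s => pointFunctional u (γ s) (δ s)) t := by
  have h1 : DifferentiableAt ℂ (fun s => 1 - annE (m := m) (γ s)) t := by
    unfold annE
    have : ∀ i, DifferentiableAt ℂ (fun s => γ s i) t := fun i =>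
      (EuclideanSpace.proj (𝕜 := ℂ) i).differentiableAt.comp t hγ
    fun_prop
  have h2 : DifferentiableAt ℂ (fun s => 1 - annF u (δ s)) t := by
    unfold annF
    have : ∀ i, DifferentiableAt ℂ (fun s => δ s i) t := fun i =>
      (EuclideanSpace.proj (𝕜 := ℂ) i).differentiableAt.comp t hδ
    fun_prop
  have h3 := (differentiableAt_inverse (𝕜 := ℂ)
    (isUnit_one_sub ((norm_annE_le (m := m) (γ t)).trans_lt hz))).comp t h1
  have h4 := (differentiableAt_inverse (𝕜 := ℂ)
    (isUnit_one_sub ((norm_annF_le u (δ t)).trans_lt hw))).comp t h2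
  exact (differentiableAt_const (innerSL ℂ (vac n m))).clm_comp (h4.mul h3)

end

/-! ### Automorphisms of the ball and the Schwarz-Pick lemma at a point -/

section Mobius

variable {E : Type*} [NormedAddCommGroup E]

/-- The number `√(1 - ‖z‖²)`. -/
def defect (z : E) : ℝ := √(1 - ‖z‖ ^ 2)

theorem defect_pos {z : E} (hz : ‖z‖ < 1) : 0 < defect z :=
  Real.sqrt_pos.2 (by nlinarith [norm_nonneg z])

theorem norm_sq_eq_defect {z : E} (hz : ‖z‖ < 1) : ‖z‖ ^ 2 = 1 - defect z ^ 2 := by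
  rw [defect, Real.sq_sqrt (by nlinarith [norm_nonneg z])]
  ring

theorem defect_ne_zero {z : E} (hz : ‖z‖ < 1) : (defect z : ℂ) ≠ 0 :=
  Complex.ofReal_ne_zero.2 (defect_pos hz).ne'

theorem one_add_defect_ne_zero {z : E} (hz : ‖z‖ < 1) : (1 + defect z : ℂ) ≠ 0 := by
  have : (1 + defect z : ℝ) ≠ 0 := by have := defect_pos hz; positivity
  exact_mod_cast this

variable [InnerProductSpace ℂ E]

/-- The involution of the unit ball that exchanges `0` and `z`. -/
def mobius (z x : E) : E :=
  (1 - ⟪z, x⟫_ℂ)⁻¹ • (z - (defect z : ℂ) • x - (⟪z, x⟫_ℂ / (1 + defect z)) • z)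

/-- The derivative of `mobius z` at `z`, up to sign. -/
def mobiusDeriv (z : E) : E →ₗ[ℂ] E :=
  (defect z : ℂ)⁻¹ • (LinearMap.id +
    ((defect z : ℂ) * (1 + defect z))⁻¹ • (innerSL ℂ z).toLinearMap.smulRight z)

theorem mobiusDeriv_apply (z x : E) : mobiusDeriv z x =
    (defect z : ℂ)⁻¹ • (x + (((defect z : ℂ) * (1 + defect z))⁻¹ * ⟪z, x⟫_ℂ) • z) := by
  simp [mobiusDeriv, smul_smul, mul_assoc]

theorem one_sub_inner_ne_zero {z x : E} (hz : ‖z‖ < 1) (hx : ‖x‖ ≤ 1) : 1 - ⟪z, x⟫_ℂ ≠ 0 := by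
  intro h
  have h1 : ⟪z, x⟫_ℂ = 1 := (sub_eq_zero.1 h).symm
  have h2 := norm_inner_le_norm (𝕜 := ℂ) z x
  rw [h1, norm_one] at h2
  nlinarith [norm_nonneg z, norm_nonneg x]

/-- The classical identity `1 - ‖φ_z(x)‖² = (1 - ‖z‖²)(1 - ‖x‖²) / |1 - ⟨z, x⟩|²` with the
denominator cleared. It shows that the open and the closed ball are mapped into themselves. -/
theorem norm_sq_mobius_numerator {z : E} (hz : ‖z‖ < 1) (x : E) :
    ‖z - (defect z : ℂ) • x - (⟪z, x⟫_ℂ / (1 + defect z)) • z‖ ^ 2 =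
      ‖1 - ⟪z, x⟫_ℂ‖ ^ 2 - defect z ^ 2 * (1 - ‖x‖ ^ 2) := by
  have hs := defect_pos hz
  have hzz := norm_sq_eq_defect hz
  set s := defect z
  set c := ⟪z, x⟫_ℂ with hc
  have hs1 : (1 + s) ≠ 0 := by positivity
  have h1 : z - (s : ℂ) • x - (c / (1 + s)) • z = (1 - c / (1 + s)) • z - (s : ℂ) • x := by
    rw [sub_smul, one_smul]; abel
  rw [h1, @norm_sub_sq ℂ, norm_smul, norm_smul, inner_smul_left, inner_smul_right, ← hc, mul_pow,
    mul_pow, hzz, Complex.sq_norm, Complex.sq_norm, Complex.sq_norm, Complex.normSq_apply,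
    Complex.normSq_apply, Complex.normSq_apply]
  have hdr : (c / (1 + s)).re = c.re / (1 + s) := by
    rw [show (1 + s : ℂ) = ((1 + s : ℝ) : ℂ) by push_cast; rfl, Complex.div_ofReal_re]
  have hdi : (c / (1 + s)).im = c.im / (1 + s) := by
    rw [show (1 + s : ℂ) = ((1 + s : ℝ) : ℂ) by push_cast; rfl, Complex.div_ofReal_im]
  simp only [RCLike.re_to_complex, Complex.mul_re, Complex.mul_im, Complex.conj_re,
    Complex.conj_im, Complex.sub_re, Complex.sub_im, Complex.one_re, Complex.one_im,
    Complex.ofReal_re, Complex.ofReal_im, hdr, hdi]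
  field_simp
  ring

theorem norm_mobius_le {z x : E} (hz : ‖z‖ < 1) (hx : ‖x‖ ≤ 1) : ‖mobius z x‖ ≤ 1 := by
  have h0 : 0 < ‖1 - ⟪z, x⟫_ℂ‖ := norm_pos_iff.2 (one_sub_inner_ne_zero hz hx)
  rw [mobius, norm_smul, norm_inv, inv_mul_le_iff₀ h0, mul_one,
    ← pow_le_pow_iff_left₀ (norm_nonneg _) h0.le two_ne_zero, norm_sq_mobius_numerator hz]
  have : 0 ≤ 1 - ‖x‖ ^ 2 := by nlinarith [norm_nonneg x]
  nlinarith [mul_nonneg (sq_nonneg (defect z)) this]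

theorem norm_mobius_lt {z x : E} (hz : ‖z‖ < 1) (hx : ‖x‖ < 1) : ‖mobius z x‖ < 1 := by
  have h0 : 0 < ‖1 - ⟪z, x⟫_ℂ‖ := norm_pos_iff.2 (one_sub_inner_ne_zero hz hx.le)
  rw [mobius, norm_smul, norm_inv, inv_mul_lt_iff₀ h0, mul_one,
    ← pow_lt_pow_iff_left₀ (norm_nonneg _) h0.le two_ne_zero, norm_sq_mobius_numerator hz]
  have : 0 < 1 - ‖x‖ ^ 2 := by nlinarith [norm_nonneg x]
  nlinarith [mul_pos (pow_pos (defect_pos hz) 2) this]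

theorem mobius_zero (z : E) : mobius z 0 = z := by simp [mobius]

theorem inner_self_eq_defect {z : E} (hz : ‖z‖ < 1) : ⟪z, z⟫_ℂ = 1 - (defect z : ℂ) ^ 2 := by
  rw [inner_self_eq_norm_sq_to_K]
  have := congrArg (fun r : ℝ => (r : ℂ)) (norm_sq_eq_defect hz)
  simpa using this

theorem inner_mobiusDeriv {z : E} (hz : ‖z‖ < 1) (x : E) :
    ⟪z, mobiusDeriv z x⟫_ℂ = ⟪z, x⟫_ℂ / (defect z : ℂ) ^ 2 := by
  have h1 := defect_ne_zero hz
  have h2 := one_add_defect_ne_zero hz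
  rw [mobiusDeriv_apply, inner_smul_right, inner_add_right, inner_smul_right,
    inner_self_eq_defect hz]
  field_simp
  ring

/-- A one sided inverse of the derivative. -/
theorem mobiusDeriv_leftInverse {z : E} (hz : ‖z‖ < 1) (x : E) :
    (defect z : ℂ) • (mobiusDeriv z x - (⟪z, mobiusDeriv z x⟫_ℂ / (1 + defect z)) • z) = x := by
  have h1 := defect_ne_zero hz
  have h2 := one_add_defect_ne_zero hz
  rw [inner_mobiusDeriv hz, mobiusDeriv_apply, smul_sub, smul_inv_smul₀ h1, smul_smul,
    add_sub_assoc, ← sub_smul]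
  rw [show ((defect z : ℂ) * (1 + defect z))⁻¹ * ⟪z, x⟫_ℂ -
    defect z * (⟪z, x⟫_ℂ / (defect z : ℂ) ^ 2 / (1 + defect z)) = 0 by field_simp; ring]
  simp

theorem mobiusDeriv_injective {z : E} (hz : ‖z‖ < 1) : Function.Injective (mobiusDeriv z) := by
  intro x y h
  rw [← mobiusDeriv_leftInverse hz x, h, mobiusDeriv_leftInverse hz y]

theorem differentiableAt_mobius {z : E} (hz : ‖z‖ < 1) {γ : ℂ → E} {t : ℂ} (hγ : ‖γ t‖ ≤ 1)
    (h : DifferentiableAt ℂ γ t) : DifferentiableAt ℂ (fun s => mobius z (γ s)) t := by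
  have hi : DifferentiableAt ℂ (fun s => ⟪z, γ s⟫_ℂ) t := (innerSL ℂ z).differentiableAt.comp t h
  have h1 := one_sub_inner_ne_zero hz hγ
  unfold mobius
  fun_prop (disch := assumption)

theorem hasDerivAt_mobius_comp {z : E} (hz : ‖z‖ < 1) {γ : ℂ → E} {γ' : E} {t : ℂ} (hγ : γ t = z)
    (h : HasDerivAt γ γ' t) : HasDerivAt (fun s => mobius z (γ s)) (-mobiusDeriv z γ') t := by
  have hi : HasDerivAt (fun s => ⟪z, γ s⟫_ℂ) ⟪z, γ'⟫_ℂ t := (innerSL ℂ z).hasFDerivAt.comp_hasDerivAt t h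
  have h1 : 1 - ⟪z, γ t⟫_ℂ ≠ 0 := by rw [hγ]; exact one_sub_inner_ne_zero hz hz.le
  have hs := defect_ne_zero hz
  have hs1 := one_add_defect_ne_zero hz
  have hnum := (((h.const_smul (defect z : ℂ)).const_sub z).sub
    ((hi.div_const (1 + (defect z : ℂ))).smul_const z))
  have key := ((hi.const_sub 1).inv h1).smul hnum
  refine key.congr_deriv ?_
  -- The numerator of the involution vanishes at `z`, so the derivative of the denominator drops
  -- out.
  have h0 : z - (defect z : ℂ) • z - (⟪z, z⟫_ℂ / (1 + defect z)) • z = 0 := by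
    rw [inner_self_eq_defect hz, show z - (defect z : ℂ) • z = (1 - (defect z : ℂ)) • z by
      rw [sub_smul, one_smul], ← sub_smul]
    rw [show 1 - (defect z : ℂ) - (1 - (defect z : ℂ) ^ 2) / (1 + defect z) = 0 by
      field_simp; ring, zero_smul]
  simp only [Pi.sub_apply, Pi.smul_apply, Pi.inv_apply, hγ]
  rw [h0, smul_zero, add_zero, inner_self_eq_defect hz, mobiusDeriv_apply]
  match_scalars
  · field_simp
    ring
  · field_simp
    ring

/-- This is the extremal curve for Schwarz-Pick: the image of a ray through the origin, chosen so
that the curve leaves `z` with velocity `x`. The derivative of the involution at the origin inverts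
`mobiusDeriv z` up to sign (`mobiusDeriv_leftInverse`), whence the minus sign in the ray. -/
theorem hasDerivAt_mobius_ray {z : E} (hz : ‖z‖ < 1) (x : E) :
    HasDerivAt (fun t : ℂ => mobius z (-(t • mobiusDeriv z x))) x 0 := by
  set y := mobiusDeriv z x with hy
  have h : HasDerivAt (fun t : ℂ => -(t • y)) (-y) 0 := by
    simpa using ((hasDerivAt_id (0 : ℂ)).smul_const y).fun_neg
  have hi : HasDerivAt (fun s : ℂ => ⟪z, -(s • y)⟫_ℂ) ⟪z, -y⟫_ℂ 0 :=
    (innerSL ℂ z).hasFDerivAt.comp_hasDerivAt 0 h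
  have h1 : 1 - ⟪z, -((0 : ℂ) • y)⟫_ℂ ≠ 0 := by simp
  have hs1 := one_add_defect_ne_zero hz
  have hnum := (((h.const_smul (defect z : ℂ)).const_sub z).sub
    ((hi.div_const (1 + (defect z : ℂ))).smul_const z))
  have key := ((hi.const_sub 1).inv h1).smul hnum
  refine key.congr_deriv ?_
  have hl := mobiusDeriv_leftInverse hz x
  rw [← hy] at hl
  conv_rhs => rw [← hl]
  simp only [Pi.sub_apply, Pi.smul_apply, Pi.inv_apply, zero_smul, neg_zero, inner_zero_right,
    inner_neg_right, sub_zero, smul_zero, zero_div, inv_one, one_smul, smul_neg, one_pow, div_one]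
  match_scalars
  · ring
  · field_simp
    ring

/-- The Möbius image of a linear combination of `x` and `z` is one. -/
theorem exists_mobius_eq (z x : E) (t : ℂ) :
    ∃ a b : ℂ, mobius z (-(t • mobiusDeriv z x)) = a • x + b • z := by
  rw [mobiusDeriv_apply, mobius]
  set c := ⟪z, -(t • (defect z : ℂ)⁻¹ • (x + (((defect z : ℂ) * (1 + defect z))⁻¹ *
    ⟪z, x⟫_ℂ) • z))⟫_ℂ
  refine ⟨(1 - c)⁻¹ * (defect z * t * (defect z : ℂ)⁻¹), (1 - c)⁻¹ * (1 - c / (1 + defect z) +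
    defect z * t * (defect z : ℂ)⁻¹ * (((defect z : ℂ) * (1 + defect z))⁻¹ * ⟪z, x⟫_ℂ)), ?_⟩
  module

/-- Schwarz-Pick at a point: the involution maps the curve into the closed ball, and the Cauchy
estimate on circles of radius `r` bounds its derivative by `1 / r`; let `r` tend to `1`. The weak
inequality `‖γ t‖ ≤ 1` is what characters provide. -/
theorem norm_mobiusDeriv_le {z : E} (hz : ‖z‖ < 1) {γ : ℂ → E} {γ' : E} (hγ : γ 0 = z)
    (hd : DifferentiableOn ℂ γ (Metric.ball 0 1)) (hb : ∀ t ∈ Metric.ball (0 : ℂ) 1, ‖γ t‖ ≤ 1)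
    (h : HasDerivAt γ γ' 0) : ‖mobiusDeriv z γ'‖ ≤ 1 := by
  have hg := hasDerivAt_mobius_comp hz hγ h
  have hdg : DifferentiableOn ℂ (fun s => mobius z (γ s)) (Metric.ball 0 1) := fun t ht =>
    (differentiableAt_mobius hz (hb t ht)
      (hd.differentiableAt (Metric.isOpen_ball.mem_nhds ht))).differentiableWithinAt
  have hbound : ∀ r : ℝ, 0 < r → r < 1 → ‖mobiusDeriv z γ'‖ ≤ 1 / r := by
    intro r hr0 hr1
    have hsub : Metric.closedBall (0 : ℂ) r ⊆ Metric.ball 0 1 := Metric.closedBall_subset_ball hr1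
    have := Complex.norm_deriv_le_of_forall_mem_sphere_norm_le (c := 0) (C := 1) hr0
      (hdg.diffContOnCl_ball hsub)
      (fun t ht => norm_mobius_le hz (hb t (hsub (Metric.sphere_subset_closedBall ht))))
    rwa [hg.deriv, norm_neg] at this
  refine le_of_forall_gt_imp_ge_of_dense fun a ha => ?_
  have := hbound a⁻¹ (by positivity) (inv_lt_one_of_one_lt₀ ha)
  simpa using this

end Mobius

/-! ### Unitaries that implement isomorphisms -/

/-- The span of the shifts of degree one. -/
def genSpan (u : Matrix.unitaryGroup (Fin n × Fin m) ℂ) : Submodule ℂ (Fock n m →L[ℂ] Fock n m) :=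
  Submodule.span ℂ (Set.range shiftE ∪ Set.range (shiftF u))

theorem shiftE_mul_mem_gradedPart (u : Matrix.unitaryGroup (Fin n × Fin m) ℂ) (i : Fin n) {d : ℕ}
    {T : Fock n m →L[ℂ] Fock n m} (hT : T ∈ gradedPart u d) :
    shiftE i * T ∈ gradedPart u (d + 1) := by
  induction hT using Submodule.span_induction with
  | mem T hT =>
    obtain ⟨p, q, rfl, rfl⟩ := hT
    refine Submodule.subset_span ⟨i :: p, q, by simp; ring, ?_⟩
    simp [mul_assoc]
  | zero => simp
  | add S T _ _ h1 h2 => rw [mul_add]; exact add_mem h1 h2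
  | smul c T _ h1 => rw [mul_smul_comm]; exact Submodule.smul_mem _ _ h1

theorem shiftF_mul_mem_gradedPart (u : Matrix.unitaryGroup (Fin n × Fin m) ℂ) (j : Fin m) {d : ℕ}
    {T : Fock n m →L[ℂ] Fock n m} (hT : T ∈ gradedPart u d) :
    shiftF u j * T ∈ gradedPart u (d + 1) := by
  induction hT using Submodule.span_induction with
  | mem T hT =>
    obtain ⟨p, q, rfl, rfl⟩ := hT
    induction p generalizing j with
    | nil => exact Submodule.subset_span ⟨[], j :: q, by simp, by simp⟩
    | cons k p ih =>
      rw [List.map_cons, List.prod_cons, mul_assoc, ← mul_assoc, shiftF_mul_shiftE]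
      simp only [Finset.sum_mul, smul_mul_assoc]
      refine Submodule.sum_mem _ fun i _ => Submodule.sum_mem _ fun j _ =>
        Submodule.smul_mem _ _ ?_
      rw [mul_assoc]
      have := shiftE_mul_mem_gradedPart u i (ih j)
      rwa [show (k :: p).length + q.length + 1 = p.length + q.length + 1 + 1 by simp; ring]
  | zero => simp
  | add S T _ _ h1 h2 => rw [mul_add]; exact add_mem h1 h2
  | smul c T _ h1 => rw [mul_smul_comm]; exact Submodule.smul_mem _ _ h1

theorem list_prod_mem_pow {R : Type*} [Ring R] [Algebra ℂ R] {ι : Type*} {M : Submodule ℂ R}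
    {S : ι → R} (hS : ∀ i, S i ∈ M) (p : List ι) : (p.map S).prod ∈ M ^ p.length := by
  induction p with
  | nil => exact Submodule.one_le.1 (pow_zero M).ge
  | cons i p ih =>
    rw [List.map_cons, List.prod_cons, List.length_cons, pow_succ']
    exact Submodule.mul_mem_mul (hS i) ih

theorem shiftE_mem_genSpan (u : Matrix.unitaryGroup (Fin n × Fin m) ℂ) (i : Fin n) :
    shiftE i ∈ genSpan u := Submodule.subset_span (Or.inl ⟨i, rfl⟩)

theorem shiftF_mem_genSpan (u : Matrix.unitaryGroup (Fin n × Fin m) ℂ) (j : Fin m) :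
    shiftF u j ∈ genSpan u := Submodule.subset_span (Or.inr ⟨j, rfl⟩)

/-- The relations are homogeneous, so any product of `d` generators can be sorted into `e`-letters
followed by `f`-letters without leaving degree `d`. As a power of the generator span, the graded
part is visibly carried along by an algebra map that matches generator spans. -/
theorem gradedPart_eq_pow (u : Matrix.unitaryGroup (Fin n × Fin m) ℂ) (d : ℕ) :
    gradedPart u d = genSpan u ^ d := by
  apply le_antisymm
  · refine Submodule.span_le.2 ?_
    rintro T ⟨p, q, rfl, rfl⟩
    have hadd : genSpan u ^ (p.length + q.length) = genSpan u ^ p.length * genSpan u ^ q.length :=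
      pow_add (genSpan u) p.length q.length
    rw [SetLike.mem_coe, hadd]
    exact Submodule.mul_mem_mul (list_prod_mem_pow (shiftE_mem_genSpan u) p)
      (list_prod_mem_pow (shiftF_mem_genSpan u) q)
  · induction d with
    | zero =>
      refine (pow_zero (genSpan u)).le.trans (Submodule.one_le.2 ?_)
      exact Submodule.subset_span ⟨[], [], by simp, by simp⟩
    | succ d ih =>
      refine (pow_succ' (genSpan u) d).le.trans (Submodule.mul_le.2 ?_)
      intro S hS T hT
      induction hS using Submodule.span_induction with
      | mem S hS =>
        rcases hS with ⟨i, rfl⟩ | ⟨j, rfl⟩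
        · exact shiftE_mul_mem_gradedPart u i (ih hT)
        · exact shiftF_mul_mem_gradedPart u j (ih hT)
      | zero => simp
      | add S T _ _ h1 h2 => rw [add_mul]; exact add_mem h1 h2
      | smul c T _ h1 => rw [smul_mul_assoc]; exact Submodule.smul_mem _ _ h1

theorem polyAlg_eq_adjoin_genSpan (u : Matrix.unitaryGroup (Fin n × Fin m) ℂ) :
    polyAlg u = Algebra.adjoin ℂ (genSpan u : Set (Fock n m →L[ℂ] Fock n m)) :=
  (Algebra.adjoin_span (R := ℂ)).symm

/-- A pair of row isometries in the span of the shifts of degree one of `𝒜_v` which satisfies the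
commutation relations of `u` and generates `𝒜_v`. -/
structure IsShiftPair (u v : Matrix.unitaryGroup (Fin n × Fin m) ℂ)
    (X : Fin n → Fock n m →L[ℂ] Fock n m) (Y : Fin m → Fock n m →L[ℂ] Fock n m) : Prop where
  inner_left : ∀ i k x y, ⟪X i x, X k y⟫_ℂ = if i = k then ⟪x, y⟫_ℂ else 0
  inner_right : ∀ j l x y, ⟪Y j x, Y l y⟫_ℂ = if j = l then ⟪x, y⟫_ℂ else 0
  mul_eq : ∀ i j, X i * Y j = ∑ k, ∑ l, u.1 (i, j) (k, l) • (Y l * X k)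
  span_eq : Submodule.span ℂ (Set.range X ∪ Set.range Y) = genSpan v
  inner_vac : ∀ j x, ⟪vac n m, Y j x⟫_ℂ = 0
  exists_invariant : ∃ K : Submodule ℂ (Fock n m), vac n m ∈ K ∧ (∀ j, ∀ x ∈ K, Y j x ∈ K) ∧
    ∀ x ∈ K, ∀ i y, ⟪x, X i y⟫_ℂ = 0

namespace IsShiftPair

variable {u v : Matrix.unitaryGroup (Fin n × Fin m) ℂ} {X : Fin n → Fock n m →L[ℂ] Fock n m}
  {Y : Fin m → Fock n m →L[ℂ] Fock n m}

/-- The image of a basis vector under the unitary that implements the isomorphism. -/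
def vec (X : Fin n → Fock n m →L[ℂ] Fock n m) (Y : Fin m → Fock n m →L[ℂ] Fock n m)
    (w : List (Fin n) × List (Fin m)) : Fock n m :=
  (w.1.map X).prod ((w.2.map Y).prod (vac n m))

theorem vec_cons (i : Fin n) (p : List (Fin n)) (q : List (Fin m)) :
    vec X Y (i :: p, q) = X i (vec X Y (p, q)) := by
  simp [vec]

theorem vec_nil_cons (j : Fin m) (q : List (Fin m)) :
    vec X Y ([], j :: q) = Y j (vec X Y ([], q)) := by
  simp [vec]

/-- Common first letters are stripped by the row isometry property. When one `X`-word runs out, the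
remaining vector lies in the invariant space `K`, which is orthogonal to the ranges of all `X i`;
when one `Y`-word runs out, the vacuum is orthogonal to the ranges of all `Y j`. -/
theorem inner_vec (h : IsShiftPair u v X Y) (w w' : List (Fin n) × List (Fin m)) :
    ⟪vec X Y w, vec X Y w'⟫_ℂ = if w = w' then 1 else 0 := by
  obtain ⟨p, q⟩ := w
  obtain ⟨p', q'⟩ := w'
  obtain ⟨K, hvac, hY, hX⟩ := h.exists_invariant
  have hK : ∀ q, vec X Y ([], q) ∈ K := by
    intro q
    induction q with
    | nil => simpa [vec] using hvac
    | cons j q ih => rw [vec_nil_cons]; exact hY j _ ih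
  induction p generalizing p' with
  | nil =>
    cases p' with
    | nil =>
      induction q generalizing q' with
      | nil =>
        cases q' with
        | nil =>
          have : vec X Y ([], []) = vac n m := by simp [vec]
          rw [this, inner_vac_vac]; simp
        | cons j q' =>
          have : vec X Y ([], []) = vac n m := by simp [vec]
          rw [vec_nil_cons, this, h.inner_vac]; simp
      | cons j q ih =>
        cases q' with
        | nil =>
          have : vec X Y ([], []) = vac n m := by simp [vec]
          rw [vec_nil_cons, this, inner_eq_zero_symm.1 (h.inner_vac _ _)]; simp
        | cons j' q' =>
          rw [vec_nil_cons, vec_nil_cons, h.inner_right, ih]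
          by_cases hj : j = j' <;> simp [hj]
    | cons i p' => rw [vec_cons, hX _ (hK q)]; simp
  | cons i p ih =>
    cases p' with
    | nil => rw [vec_cons, inner_eq_zero_symm.1 (hX _ (hK q') _ _)]; simp
    | cons i' p' =>
      rw [vec_cons, vec_cons, h.inner_left, ih]
      by_cases hi : i = i' <;> simp [hi]

theorem orthonormal_vec (h : IsShiftPair u v X Y) : Orthonormal ℂ (vec X Y) := by
  classical
  rw [orthonormal_iff_ite]
  exact h.inner_vec

/-- The isometry with `e_p ⊗ f_q ↦ X_p Y_q Ω`. -/
def isom (h : IsShiftPair u v X Y) : Fock n m →ₗᵢ[ℂ] Fock n m :=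
  h.orthonormal_vec.orthogonalFamily.linearIsometry

theorem isom_basisVec (h : IsShiftPair u v X Y) (p : List (Fin n)) (q : List (Fin m)) :
    h.isom (basisVec p q) = vec X Y (p, q) := by
  simp [isom, basisVec, OrthogonalFamily.linearIsometry_apply_single]

theorem isom_shiftE (h : IsShiftPair u v X Y) (i : Fin n) (x : Fock n m) :
    h.isom (shiftE i x) = X i (h.isom x) := by
  have : h.isom.toContinuousLinearMap ∘L shiftE i = X i ∘L h.isom.toContinuousLinearMap :=
    map_eq_of_basisVec fun p q => by simp [shiftE_basisVec, isom_basisVec, vec_cons]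
  exact congrArg (fun T : Fock n m →L[ℂ] Fock n m => T x) this

/-- Induction on the `e`-word: `moveF` and the pair `(X, Y)` move the `f`-letter one step to the
right by the same rule, that of `u`. -/
theorem isom_shiftF (h : IsShiftPair u v X Y) (j : Fin m) (x : Fock n m) :
    h.isom (shiftF u j x) = Y j (h.isom x) := by
  have key : ∀ p j q, h.isom (moveF u.1 j p q) = Y j (vec X Y (p, q)) := by
    intro p
    induction p with
    | nil => intro j q; rw [moveF, isom_basisVec, vec_nil_cons]
    | cons k p ih =>
      intro j q
      have h1 := congrArg (fun T : Fock n m →L[ℂ] Fock n m => T (vec X Y (p, q)))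
        (sum_eq_mul_of_mul_eq_sum u h.mul_eq j k)
      simp only [mul_apply_eq_comp] at h1
      rw [vec_cons, h1]
      simp [moveF, isom_shiftE, ih]
  have : h.isom.toContinuousLinearMap ∘L shiftF u j = Y j ∘L h.isom.toContinuousLinearMap :=
    map_eq_of_basisVec fun p q => by simp [shiftF_basisVec, isom_basisVec, key]
  exact congrArg (fun T : Fock n m →L[ℂ] Fock n m => T x) this

theorem adjoin_eq (h : IsShiftPair u v X Y) :
    Algebra.adjoin ℂ (Set.range X ∪ Set.range Y) = polyAlg v := by
  rw [polyAlg_eq_adjoin_genSpan, ← h.span_eq, Algebra.adjoin_span]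

theorem range_invariant (h : IsShiftPair u v X Y) {T : Fock n m →L[ℂ] Fock n m}
    (hT : T ∈ polyAlg v) {x : Fock n m} (hx : x ∈ LinearMap.range h.isom.toLinearMap) :
    T x ∈ LinearMap.range h.isom.toLinearMap := by
  rw [← h.adjoin_eq] at hT
  induction hT using Algebra.adjoin_induction generalizing x with
  | mem T hT =>
    obtain ⟨y, rfl⟩ := hx
    rcases hT with ⟨i, rfl⟩ | ⟨j, rfl⟩
    · exact ⟨shiftE i y, h.isom_shiftE i y⟩
    · exact ⟨shiftF u j y, h.isom_shiftF j y⟩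
  | algebraMap c =>
    rw [Algebra.algebraMap_eq_smul_one]
    exact Submodule.smul_mem _ _ hx
  | add S T _ _ h1 h2 => exact add_mem (h1 hx) (h2 hx)
  | mul S T _ _ h1 h2 => exact h1 (h2 hx)

theorem shiftE_mem_polyAlg (u : Matrix.unitaryGroup (Fin n × Fin m) ℂ) (i : Fin n) :
    shiftE i ∈ polyAlg u := Algebra.subset_adjoin (Or.inl ⟨i, rfl⟩)

theorem shiftF_mem_polyAlg (u : Matrix.unitaryGroup (Fin n × Fin m) ℂ) (j : Fin m) :
    shiftF u j ∈ polyAlg u := Algebra.subset_adjoin (Or.inr ⟨j, rfl⟩)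

/-- The range is closed, contains the vacuum and is invariant under the algebra generated by `X` and
`Y`, which is `polyAlg v`; the vacuum is cyclic for the latter. -/
theorem isom_surjective (h : IsShiftPair u v X Y) : Function.Surjective h.isom := by
  have hvac : vac n m ∈ LinearMap.range h.isom.toLinearMap :=
    ⟨vac n m, by simp [vac, isom_basisVec, vec]⟩
  have hb : ∀ p q, basisVec p q ∈ LinearMap.range h.isom.toLinearMap := by
    intro p q
    induction p with
    | nil =>
      induction q with
      | nil => exact hvac
      | cons j q ih =>
        rw [← shiftF_basisVec_nil v]
        exact h.range_invariant (shiftF_mem_polyAlg v j) ih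
    | cons i p ih =>
      rw [← shiftE_basisVec]
      exact h.range_invariant (shiftE_mem_polyAlg v i) ih
  have hcl : IsClosed (LinearMap.range h.isom.toLinearMap : Set (Fock n m)) := by
    have := h.isom.isometry.isClosedEmbedding.isClosed_range
    rwa [LinearMap.coe_range]
  intro x
  exact hcl.mem_of_tendsto (hasSum_basisVec x) (Filter.Eventually.of_forall fun s =>
    Submodule.sum_mem _ fun w _ => Submodule.smul_mem _ _ (hb w.1 w.2))

/-- The unitary with `e_p ⊗ f_q ↦ X_p Y_q Ω`. -/
def unitary (h : IsShiftPair u v X Y) : Fock n m ≃ₗᵢ[ℂ] Fock n m :=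
  LinearIsometryEquiv.ofSurjective h.isom h.isom_surjective

/-- Conjugation by this unitary. -/
def conj (h : IsShiftPair u v X Y) :
    (Fock n m →L[ℂ] Fock n m) ≃ₐ[ℂ] (Fock n m →L[ℂ] Fock n m) :=
  h.unitary.conjStarAlgEquiv.toAlgEquiv

theorem conj_apply (h : IsShiftPair u v X Y) (T : Fock n m →L[ℂ] Fock n m) (x : Fock n m) :
    h.conj T x = h.unitary (T (h.unitary.symm x)) := rfl

theorem conj_symm_apply (h : IsShiftPair u v X Y) (T : Fock n m →L[ℂ] Fock n m) (x : Fock n m) :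
    h.conj.symm T x = h.unitary.symm (T (h.unitary x)) := rfl

theorem isometry_conj (h : IsShiftPair u v X Y) : Isometry h.conj :=
  AddMonoidHomClass.isometry_of_norm h.conj fun T => by
    apply le_antisymm
    · refine ContinuousLinearMap.opNorm_le_bound _ (norm_nonneg _) fun x => ?_
      rw [conj_apply, LinearIsometryEquiv.norm_map]
      refine (T.le_opNorm _).trans (by rw [LinearIsometryEquiv.norm_map])
    · refine ContinuousLinearMap.opNorm_le_bound _ (norm_nonneg _) fun x => ?_
      have := (h.conj T).le_opNorm (h.unitary x)
      rwa [conj_apply, LinearIsometryEquiv.norm_map, LinearIsometryEquiv.symm_apply_apply,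
        LinearIsometryEquiv.norm_map] at this

theorem conj_shiftE (h : IsShiftPair u v X Y) (i : Fin n) : h.conj (shiftE i) = X i := by
  ext1 x
  have := h.isom_shiftE i (h.unitary.symm x)
  exact this.trans (congrArg (X i) (h.unitary.apply_symm_apply x))

theorem conj_shiftF (h : IsShiftPair u v X Y) (j : Fin m) : h.conj (shiftF u j) = Y j := by
  ext1 x
  have := h.isom_shiftF j (h.unitary.symm x)
  exact this.trans (congrArg (Y j) (h.unitary.apply_symm_apply x))

theorem image_generators (h : IsShiftPair u v X Y) :
    h.conj '' (Set.range shiftE ∪ Set.range (shiftF u)) = Set.range X ∪ Set.range Y := by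
  rw [Set.image_union, ← Set.range_comp, ← Set.range_comp]
  congr 2
  · funext i; exact h.conj_shiftE i
  · funext j; exact h.conj_shiftF j

theorem map_polyAlg (h : IsShiftPair u v X Y) :
    (polyAlg u).map (h.conj : (Fock n m →L[ℂ] Fock n m) →ₐ[ℂ] _) = polyAlg v := by
  rw [polyAlg, AlgHom.map_adjoin, ← h.adjoin_eq]
  exact congrArg _ h.image_generators

theorem map_gradedPart (h : IsShiftPair u v X Y) (d : ℕ) :
    (gradedPart u d).map (h.conj : (Fock n m →L[ℂ] Fock n m) →ₐ[ℂ] _).toLinearMap =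
      gradedPart v d := by
  rw [gradedPart_eq_pow, gradedPart_eq_pow, Submodule.map_pow, genSpan, Submodule.map_span,
    ← h.span_eq]
  exact congrArg (fun s => Submodule.span ℂ s ^ d) h.image_generators

theorem image_closure_of_continuous {A : Type*} [TopologicalSpace A] (e : A ≃ A)
    (he : Continuous e) (he' : Continuous e.symm) (s : Set A) : e '' closure s = closure (e '' s) :=
  (Homeomorph.mk e he he').image_closure s

theorem map_normAlg (h : IsShiftPair u v X Y) :
    (normAlg u).map (h.conj : (Fock n m →L[ℂ] Fock n m) →ₐ[ℂ] _) = normAlg v := by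
  apply SetLike.coe_injective
  rw [normAlg, normAlg, Subalgebra.coe_map, Subalgebra.topologicalClosure_coe,
    Subalgebra.topologicalClosure_coe, ← h.map_polyAlg, Subalgebra.coe_map]
  exact image_closure_of_continuous h.conj.toEquiv h.isometry_conj.continuous
    (h.isometry_conj.right_inv h.conj.apply_symm_apply).continuous _

theorem continuous_conj (h : IsShiftPair u v X Y) :
    @Continuous _ _ (weakStar _) (weakStar _) h.conj := by
  let _ : TopologicalSpace (Fock n m →L[ℂ] Fock n m) := weakStar _
  refine continuous_to_weakStar fun x y hx hy => ?_
  have : (fun T => normalFunctional x y (h.conj T)) =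
      normalFunctional (fun k => h.unitary.symm (x k)) (fun k => h.unitary.symm (y k)) := by
    funext T
    simp only [normalFunctional, conj_apply]
    refine tsum_congr fun k => ?_
    rw [← h.unitary.inner_map_map (h.unitary.symm (x k)), h.unitary.apply_symm_apply]
  rw [this]
  exact continuous_normalFunctional (by simpa using hx) (by simpa using hy)

theorem continuous_conj_symm (h : IsShiftPair u v X Y) :
    @Continuous _ _ (weakStar _) (weakStar _) h.conj.symm := by
  let _ : TopologicalSpace (Fock n m →L[ℂ] Fock n m) := weakStar _
  refine continuous_to_weakStar fun x y hx hy => ?_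
  have : (fun T => normalFunctional x y (h.conj.symm T)) =
      normalFunctional (fun k => h.unitary (x k)) (fun k => h.unitary (y k)) := by
    funext T
    simp only [normalFunctional, conj_symm_apply]
    refine tsum_congr fun k => ?_
    rw [← h.unitary.inner_map_map, h.unitary.apply_symm_apply]
  rw [this]
  exact continuous_normalFunctional (by simpa using hx) (by simpa using hy)

theorem map_weakStarAlg (h : IsShiftPair u v X Y) :
    (weakStarAlg u).map (h.conj : (Fock n m →L[ℂ] Fock n m) →ₐ[ℂ] _) = weakStarAlg v := by
  apply SetLike.coe_injective
  let _ : TopologicalSpace (Fock n m →L[ℂ] Fock n m) := weakStar _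
  have hcoe : ∀ S : Subalgebra ℂ (Fock n m →L[ℂ] Fock n m),
    (weakStarClosure S : Set (Fock n m →L[ℂ] Fock n m)) = closure S := fun S => rfl
  rw [weakStarAlg, weakStarAlg, Subalgebra.coe_map, hcoe, hcoe, ← h.map_polyAlg,
    Subalgebra.coe_map]
  exact image_closure_of_continuous h.conj.toEquiv h.continuous_conj h.continuous_conj_symm _

/-- The isomorphism of subalgebras induced by conjugation. -/
def equivOfMapEq (h : IsShiftPair u v X Y) {S T : Subalgebra ℂ (Fock n m →L[ℂ] Fock n m)}
    (hST : S.map (h.conj : (Fock n m →L[ℂ] Fock n m) →ₐ[ℂ] _) = T) : S ≃ₐ[ℂ] T :=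
  (h.conj.subalgebraMap S).trans (Subalgebra.equivOfEq _ _ hST)

theorem coe_equivOfMapEq (h : IsShiftPair u v X Y)
    {S T : Subalgebra ℂ (Fock n m →L[ℂ] Fock n m)}
    (hST : S.map (h.conj : (Fock n m →L[ℂ] Fock n m) →ₐ[ℂ] _) = T) (a : S) :
    (h.equivOfMapEq hST a : Fock n m →L[ℂ] Fock n m) = h.conj a := rfl

theorem isometry_equivOfMapEq (h : IsShiftPair u v X Y)
    {S T : Subalgebra ℂ (Fock n m →L[ℂ] Fock n m)}
    (hST : S.map (h.conj : (Fock n m →L[ℂ] Fock n m) →ₐ[ℂ] _) = T) :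
    Isometry (h.equivOfMapEq hST) :=
  Isometry.of_dist_eq fun a b => h.isometry_conj.dist_eq a.1 b.1

theorem exists_graded (h : IsShiftPair u v X Y) :
    ∃ Ψ : normAlg u ≃ₐ[ℂ] normAlg v, Isometry Ψ ∧ IsGraded Ψ := by
  refine ⟨h.equivOfMapEq h.map_normAlg, h.isometry_equivOfMapEq _, fun d T => ?_⟩
  rw [coe_equivOfMapEq, ← h.map_gradedPart d]
  exact (Function.Injective.mem_set_image (s := (gradedPart u d : Set _)) h.conj.injective).symm

theorem exists_weakStar (h : IsShiftPair u v X Y) :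
    ∃ Γ : weakStarAlg u ≃ₐ[ℂ] weakStarAlg v, Isometry Γ ∧
      @Continuous _ _ (relWeakStar (weakStarAlg u)) (relWeakStar (weakStarAlg v)) Γ := by
  refine ⟨h.equivOfMapEq h.map_weakStarAlg, h.isometry_equivOfMapEq _, ?_⟩
  let _ : TopologicalSpace (Fock n m →L[ℂ] Fock n m) := weakStar _
  let _ : TopologicalSpace (weakStarAlg u) := relWeakStar _
  let _ : TopologicalSpace (weakStarAlg v) := relWeakStar _
  have h1 : Continuous (fun T : weakStarAlg u => h.conj T) :=
    Continuous.comp (g := h.conj) h.continuous_conj continuous_induced_dom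
  exact continuous_induced_rng.2 h1

end IsShiftPair

/-! ### Rotated shifts -/

/-- The family `∑ₖ a_{ik} Sₖ`. -/
def rotate {R : Type*} [AddCommMonoid R] [Module ℂ R] {k : ℕ} (A : Matrix (Fin k) (Fin k) ℂ)
    (S : Fin k → R) (i : Fin k) : R := ∑ r, A i r • S r

theorem rotate_mem {R : Type*} [AddCommMonoid R] [Module ℂ R] {k : ℕ}
    (A : Matrix (Fin k) (Fin k) ℂ) {S : Fin k → R} {M : Submodule ℂ R} (h : ∀ i, S i ∈ M)
    (i : Fin k) : rotate A S i ∈ M :=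
  M.sum_mem fun r _ => M.smul_mem _ (h r)

theorem rotate_rotate {R : Type*} [AddCommMonoid R] [Module ℂ R] {k : ℕ}
    (A B : Matrix (Fin k) (Fin k) ℂ) (S : Fin k → R) : rotate A (rotate B S) = rotate (A * B) S := by
  funext i
  simp only [rotate, Matrix.mul_apply, Finset.smul_sum, Finset.sum_smul, smul_smul]
  exact Finset.sum_comm

theorem rotate_one {R : Type*} [AddCommMonoid R] [Module ℂ R] {k : ℕ} (S : Fin k → R) :
    rotate 1 S = S := by
  funext i
  simp [rotate, Matrix.one_apply]

theorem span_range_rotate {R : Type*} [AddCommMonoid R] [Module ℂ R] {k : ℕ}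
    {A : Matrix (Fin k) (Fin k) ℂ} (hA : A ∈ Matrix.unitaryGroup (Fin k) ℂ) (S : Fin k → R) :
    Submodule.span ℂ (Set.range (rotate A S)) = Submodule.span ℂ (Set.range S) := by
  have key : ∀ (A : Matrix (Fin k) (Fin k) ℂ) (S : Fin k → R),
      Submodule.span ℂ (Set.range (rotate A S)) ≤ Submodule.span ℂ (Set.range S) := by
    intro A S
    refine Submodule.span_le.2 ?_
    rintro _ ⟨i, rfl⟩
    exact rotate_mem A (fun i => Submodule.subset_span (Set.mem_range_self i)) i
  refine le_antisymm (key A S) ?_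
  have := key (star A) (rotate A S)
  rwa [rotate_rotate, Matrix.mem_unitaryGroup_iff'.1 hA, rotate_one] at this

theorem inner_rotate {H : Type*} [NormedAddCommGroup H] [InnerProductSpace ℂ H] {k : ℕ}
    {S : Fin k → H →L[ℂ] H} (hS : ∀ i j x y, ⟪S i x, S j y⟫_ℂ = if i = j then ⟪x, y⟫_ℂ else 0)
    {A : Matrix (Fin k) (Fin k) ℂ} (hA : A ∈ Matrix.unitaryGroup (Fin k) ℂ) (i j : Fin k)
    (x y : H) : ⟪rotate A S i x, rotate A S j y⟫_ℂ = if i = j then ⟪x, y⟫_ℂ else 0 := by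
  have h := congrFun (congrFun (Matrix.mem_unitaryGroup_iff.1 hA) j) i
  simp only [Matrix.mul_apply, Matrix.star_apply, Matrix.one_apply] at h
  rw [rotate, rotate, sum_apply, sum_apply]
  simp only [smul_apply, sum_inner, inner_sum, inner_smul_left, inner_smul_right, hS, mul_ite,
    mul_zero, Finset.sum_ite_eq', Finset.mem_univ, if_true]
  simp only [← mul_assoc, ← Finset.sum_mul]
  have h' : ∑ r, A j r * (starRingEnd ℂ) (A i r) = if i = j then 1 else 0 := by
    rw [show (if i = j then (1 : ℂ) else 0) = if j = i then 1 else 0 by simp [eq_comm], ← h]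
    rfl
  rw [h']
  split_ifs <;> simp

/-- Both sides expand in the products `T l * S k`: the left one with coefficient matrix `(A ⊗ₖ B) *
v`, the right one with `u * (A ⊗ₖ B)`. -/
theorem rotate_mul_rotate {R : Type*} [Ring R] [Algebra ℂ R]
    {u v : Matrix (Fin n × Fin m) (Fin n × Fin m) ℂ} {S : Fin n → R} {T : Fin m → R}
    (h : ∀ i j, S i * T j = ∑ k, ∑ l, v (i, j) (k, l) • (T l * S k))
    {A : Matrix (Fin n) (Fin n) ℂ} {B : Matrix (Fin m) (Fin m) ℂ}
    (huv : (A ⊗ₖ B) * v = u * (A ⊗ₖ B)) (i : Fin n) (j : Fin m) :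
    rotate A S i * rotate B T j = ∑ k, ∑ l, u (i, j) (k, l) • (rotate B T l * rotate A S k) := by
  have h1 : rotate A S i * rotate B T j =
      ∑ b : Fin n × Fin m, ((A ⊗ₖ B) * v) (i, j) b • (T b.2 * S b.1) := by
    have : rotate A S i * rotate B T j = ∑ a : Fin n × Fin m, ∑ b : Fin n × Fin m,
        ((A ⊗ₖ B) (i, j) a * v a b) • (T b.2 * S b.1) := by
      rw [rotate, rotate, Finset.sum_mul_sum]
      simp only [Fintype.sum_prod_type, Matrix.kronecker_apply, smul_mul_smul_comm, h,
        Finset.smul_sum, smul_smul]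
    rw [this, Finset.sum_comm]
    simp only [Matrix.mul_apply, Finset.sum_smul]
  have h2 : ∑ k, ∑ l, u (i, j) (k, l) • (rotate B T l * rotate A S k) =
      ∑ b : Fin n × Fin m, (u * (A ⊗ₖ B)) (i, j) b • (T b.2 * S b.1) := by
    have : ∀ k l, rotate B T l * rotate A S k =
        ∑ b : Fin n × Fin m, (A ⊗ₖ B) (k, l) b • (T b.2 * S b.1) := by
      intro k l
      rw [rotate, rotate, Finset.sum_mul_sum, Finset.sum_comm]
      simp only [Fintype.sum_prod_type, Matrix.kronecker_apply, smul_mul_smul_comm, mul_comm]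
    rw [← Fintype.sum_prod_type' (f := fun k l => u (i, j) (k, l) • (rotate B T l * rotate A S k))]
    simp only [this, Finset.smul_sum, smul_smul]
    rw [Finset.sum_comm]
    simp only [Matrix.mul_apply, Finset.sum_smul]
  rw [h1, h2, huv]

theorem isShiftPair_of_productUnitaryEquivalent {u v : Matrix.unitaryGroup (Fin n × Fin m) ℂ}
    (h : ProductUnitaryEquivalent u.1 v.1) : ∃ X Y, IsShiftPair u v X Y := by
  obtain ⟨A, hA, B, hB, hAB⟩ := h
  refine ⟨rotate A shiftE, rotate B (shiftF v), inner_rotate inner_shiftE hA,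
    inner_rotate (inner_shiftF v) hB, rotate_mul_rotate (shiftE_mul_shiftF v) hAB, ?_, ?_,
    Submodule.span ℂ (Set.range fun q => basisVec [] q), Submodule.subset_span ⟨[], rfl⟩, ?_, ?_⟩
  · rw [Submodule.span_union, span_range_rotate hA, span_range_rotate hB, ← Submodule.span_union,
      genSpan]
  · intro j x
    rw [rotate, sum_apply]
    simp [inner_vac_shiftF]
  · intro j x hx
    rw [rotate, sum_apply]
    refine Submodule.sum_mem _ fun l _ => Submodule.smul_mem _ _ ?_
    induction hx using Submodule.span_induction with
    | mem x hx =>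
      obtain ⟨q, rfl⟩ := hx
      exact Submodule.subset_span ⟨l :: q, (shiftF_basisVec_nil v l q).symm⟩
    | zero => simp
    | add _ _ _ _ h1 h2 => rw [map_add]; exact add_mem h1 h2
    | smul c _ _ h1 => rw [map_smul]; exact Submodule.smul_mem _ _ h1
  · intro x hx i y
    induction hx using Submodule.span_induction with
    | mem x hx =>
      obtain ⟨q, rfl⟩ := hx
      rw [rotate, sum_apply]
      simp [inner_basisVec_nil_shiftE]
    | zero => simp
    | add _ _ _ _ h1 h2 => rw [inner_add_left, h1, h2, add_zero]
    | smul c _ _ h1 => rw [inner_smul_left, h1, mul_zero]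

theorem isShiftPair_of_exchange {u v : Matrix.unitaryGroup (Fin n × Fin n) ℂ}
    (h : ProductUnitaryEquivalent u.1 (exchange rfl v.1)) : ∃ X Y, IsShiftPair u v X Y := by
  obtain ⟨A, hA, B, hB, hAB⟩ := h
  -- With the roles of `E` and `F` interchanged, the relation of `v` for `f ⊗ e` becomes a relation
  -- of the standard form with matrix `ṽ`. Accordingly the invariant space below is spanned by the
  -- pure `e`-words.
  have hrel : ∀ i j, shiftF v i * shiftE j =
      ∑ k, ∑ l, exchange rfl v.1 (i, j) (k, l) • (shiftE l * shiftF v k) := by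
    intro i j
    rw [shiftF_mul_shiftE, Finset.sum_comm]
    rfl
  refine ⟨rotate A (shiftF v), rotate B shiftE, inner_rotate (inner_shiftF v) hA,
    inner_rotate inner_shiftE hB, rotate_mul_rotate hrel hAB, ?_, ?_,
    Submodule.span ℂ (Set.range fun p => basisVec p []), Submodule.subset_span ⟨[], rfl⟩, ?_, ?_⟩
  · rw [Submodule.span_union, span_range_rotate hA, span_range_rotate hB, ← Submodule.span_union,
      genSpan, Set.union_comm]
  · intro j x
    rw [rotate, sum_apply]
    simp [inner_vac_shiftE]
  · intro j x hx
    rw [rotate, sum_apply]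
    refine Submodule.sum_mem _ fun l _ => Submodule.smul_mem _ _ ?_
    induction hx using Submodule.span_induction with
    | mem x hx =>
      obtain ⟨q, rfl⟩ := hx
      exact Submodule.subset_span ⟨l :: q, (shiftE_basisVec l q []).symm⟩
    | zero => simp
    | add _ _ _ _ h1 h2 => rw [map_add]; exact add_mem h1 h2
    | smul c _ _ h1 => rw [map_smul]; exact Submodule.smul_mem _ _ h1
  · intro x hx i y
    induction hx using Submodule.span_induction with
    | mem x hx =>
      obtain ⟨q, rfl⟩ := hx
      rw [rotate, sum_apply]
      simp [inner_basisVec_nil_shiftF]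
    | zero => simp
    | add _ _ _ _ h1 h2 => rw [inner_add_left, h1, h2, add_zero]
    | smul c _ _ h1 => rw [inner_smul_left, h1, mul_zero]

theorem exists_isShiftPair {u v : Matrix.unitaryGroup (Fin n × Fin m) ℂ}
    (h : ProductUnitaryEquivalent u.1 v.1 ∨
      ∃ h : n = m, ProductUnitaryEquivalent u.1 (exchange h v.1)) : ∃ X Y, IsShiftPair u v X Y := by
  rcases h with h | ⟨rfl, h⟩
  · exact isShiftPair_of_productUnitaryEquivalent h
  · exact isShiftPair_of_exchange h

/-! ### Weakly continuous functionals on the algebras -/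

/-- The functional `T ↦ ℓ (T x)`. -/
def coeff (ℓ : Fock n m →L[ℂ] ℂ) (x : Fock n m) : (Fock n m →L[ℂ] Fock n m) →ₗ[ℂ] ℂ where
  toFun T := ℓ (T x)
  map_add' S T := by simp
  map_smul' c T := by simp

@[simp]
theorem coeff_apply (ℓ : Fock n m →L[ℂ] ℂ) (x : Fock n m) (T : Fock n m →L[ℂ] Fock n m) :
    coeff ℓ x T = ℓ (T x) := rfl

variable (n m) in
/-- The functionals that are continuous for the weak operator topology. -/
def coeffSpan : Submodule ℂ ((Fock n m →L[ℂ] Fock n m) →ₗ[ℂ] ℂ) :=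
  Submodule.span ℂ {F | ∃ ℓ x, F = coeff ℓ x}

theorem coeff_mem (ℓ : Fock n m →L[ℂ] ℂ) (x : Fock n m) : coeff ℓ x ∈ coeffSpan n m :=
  Submodule.subset_span ⟨ℓ, x, rfl⟩

/-- `S` contains the algebra generated by the shifts and is contained in its closure for the weak
operator topology. -/
structure IsApprox (u : Matrix.unitaryGroup (Fin n × Fin m) ℂ)
    (S : Subalgebra ℂ (Fock n m →L[ℂ] Fock n m)) : Prop where
  le : polyAlg u ≤ S
  ext : ∀ F ∈ coeffSpan n m, (∀ T ∈ polyAlg u, F T = 0) → ∀ T ∈ S, F T = 0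

namespace IsApprox

variable {u : Matrix.unitaryGroup (Fin n × Fin m) ℂ}
  {S : Subalgebra ℂ (Fock n m →L[ℂ] Fock n m)}

/-- The shift `L_{e_i}` as an element of `S`. -/
def genE (h : IsApprox u S) (i : Fin n) : S :=
  ⟨shiftE i, h.le (IsShiftPair.shiftE_mem_polyAlg u i)⟩

/-- The shift `L_{f_j}` as an element of `S`. -/
def genF (h : IsApprox u S) (j : Fin m) : S :=
  ⟨shiftF u j, h.le (IsShiftPair.shiftF_mem_polyAlg u j)⟩

/-- For a fixed vector `x` the identity is linear in `T` and says that a functional from `coeffSpan`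
vanishes, so it passes from `polyAlg u` to `S`. As `x` is an arbitrary vector, multiplicativity on
`S` follows without continuity in the second factor. -/
theorem pointFunctional_mul (h : IsApprox u S) {z : EuclideanSpace ℂ (Fin n)}
    {w : EuclideanSpace ℂ (Fin m)} (hz : ‖z‖ < 1) (hw : ‖w‖ < 1) (hf : FixedTensor u.1 z w)
    {T : Fock n m →L[ℂ] Fock n m} (hT : T ∈ S) (x : Fock n m) :
    pointFunctional u z w (T x) =
      pointFunctional u z w (T (vac n m)) * pointFunctional u z w x := by
  have := h.ext (coeff (pointFunctional u z w) x -
    pointFunctional u z w x • coeff (pointFunctional u z w) (vac n m))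
    (sub_mem (coeff_mem _ _) (Submodule.smul_mem _ _ (coeff_mem _ _)))
    (fun T hT => by
      simp only [LinearMap.sub_apply, LinearMap.smul_apply, coeff_apply, smul_eq_mul]
      rw [UnitaryRelation.pointFunctional_mul u hz hw hf hT, mul_comm, sub_self]) T hT
  simp only [LinearMap.sub_apply, LinearMap.smul_apply, coeff_apply, smul_eq_mul] at this
  rw [sub_eq_zero.1 this, mul_comm]

theorem exists_character (h : IsApprox u S) {z : EuclideanSpace ℂ (Fin n)}
    {w : EuclideanSpace ℂ (Fin m)} (hz : ‖z‖ < 1) (hw : ‖w‖ < 1) (hf : FixedTensor u.1 z w) :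
    ∃ χ : S →ₐ[ℂ] ℂ, ∀ T : S, χ T = pointFunctional u z w (T.1 (vac n m)) :=
  ⟨AlgHom.ofLinearMap ((coeff (pointFunctional u z w) (vac n m)).comp S.val.toLinearMap)
    (pointFunctional_vac u hz hw)
    (fun A B => h.pointFunctional_mul hz hw hf A.2 (B.1 (vac n m))), fun _ => rfl⟩

theorem map_mul_eq_sum {R : Type*} [Ring R] [Algebra ℂ R] (χ : R →ₐ[ℂ] ℂ) {X : Fin n → R}
    {Y : Fin m → R} {c : Fin n × Fin m → ℂ} {i : Fin n} {j : Fin m}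
    (h : X i * Y j = ∑ k, ∑ l, c (k, l) • (Y l * X k)) :
    χ (X i) * χ (Y j) = ∑ k, ∑ l, c (k, l) * (χ (X k) * χ (Y l)) := by
  rw [← map_mul, h]
  simp only [map_mul, map_sum, map_smul, smul_eq_mul, mul_comm]

theorem genE_mul_genF (h : IsApprox u S) (i : Fin n) (j : Fin m) :
    h.genE i * h.genF j = ∑ k, ∑ l, u.1 (i, j) (k, l) • (h.genF l * h.genE k) := by
  apply Subtype.ext
  have := shiftE_mul_shiftF u i j
  simpa [genE, genF] using this

theorem fixedTensor_character (h : IsApprox u S) (χ : S →ₐ[ℂ] ℂ) :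
    FixedTensor u.1 (WithLp.toLp 2 fun i => χ (h.genE i)) (WithLp.toLp 2 fun j => χ (h.genF j)) :=
  fun i j => (map_mul_eq_sum χ (h.genE_mul_genF i j)).symm

/-- The constant disappears on applying the bound to powers of `T`: a ratio above `1` would have
unbounded powers. Completeness of `S` plays no role. -/
theorem norm_character_le {S : Subalgebra ℂ (Fock n m →L[ℂ] Fock n m)} (χ : S →ₐ[ℂ] ℂ) {C : ℝ}
    (hC : ∀ T, ‖χ T‖ ≤ C * ‖T‖) (T : S) : ‖χ T‖ ≤ ‖T‖ := by
  by_contra hlt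
  rw [not_le] at hlt
  have hpow : ∀ k : ℕ, ‖χ T‖ ^ (k + 1) ≤ C * ‖T‖ ^ (k + 1) := by
    intro k
    have hC0 : 0 ≤ C := by
      have := hC 1
      rw [map_one, norm_one] at this
      by_contra hneg
      nlinarith [norm_nonneg (1 : S)]
    rw [← norm_pow, ← map_pow]
    exact (hC _).trans (mul_le_mul_of_nonneg_left (norm_pow_le' T k.succ_pos) hC0)
  rcases (norm_nonneg T).eq_or_lt with h0 | h0
  · have := hpow 0
    rw [← h0] at this hlt
    simp at this
    rw [this] at hlt
    simp at hlt
  · obtain ⟨k, hk⟩ := pow_unbounded_of_one_lt C ((one_lt_div h0).2 hlt)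
    have h1 := hpow k
    have h2 : (‖χ T‖ / ‖T‖) ^ (k + 1) ≤ C := by
      rw [div_pow, div_le_iff₀ (by positivity)]
      exact h1
    have h3 : (‖χ T‖ / ‖T‖) ^ k ≤ (‖χ T‖ / ‖T‖) ^ (k + 1) :=
      pow_le_pow_right₀ ((one_lt_div h0).2 hlt).le k.le_succ
    linarith

/-- Test the character on `∑ conj(cᵢ) Aᵢ`, where `c` is its coordinate vector: the norm is at most
`‖c‖` and the value is `‖c‖²`. -/
theorem norm_coordinates_le {k : ℕ} {A : Fin k → Fock n m →L[ℂ] Fock n m}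
    (hA : ∀ i j x y, ⟪A i x, A j y⟫_ℂ = if i = j then ⟪x, y⟫_ℂ else 0) (hAS : ∀ i, A i ∈ S)
    (χ : S →ₐ[ℂ] ℂ) (hχ : ∀ T, ‖χ T‖ ≤ ‖T‖) :
    ‖(WithLp.toLp 2 fun i => χ ⟨A i, hAS i⟩ : EuclideanSpace ℂ (Fin k))‖ ≤ 1 := by
  set c : EuclideanSpace ℂ (Fin k) := WithLp.toLp 2 fun i => χ ⟨A i, hAS i⟩ with hc
  set d : EuclideanSpace ℂ (Fin k) := WithLp.toLp 2 fun i => star (c i)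
  have hd : ‖d‖ = ‖c‖ := by simp [EuclideanSpace.norm_eq, d]
  have h1 := hχ (∑ i, d i • ⟨A i, hAS i⟩)
  have h2 : ‖(∑ i, d i • (⟨A i, hAS i⟩ : S))‖ ≤ ‖c‖ := by
    rw [← hd]
    refine le_trans (le_of_eq ?_) (norm_sum_smul_le hA d)
    change ‖((∑ i, d i • (⟨A i, hAS i⟩ : S) : S) : Fock n m →L[ℂ] Fock n m)‖ = _
    simp
  have h3 : χ (∑ i, d i • (⟨A i, hAS i⟩ : S)) = ((‖c‖ ^ 2 : ℝ) : ℂ) := by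
    rw [map_sum, EuclideanSpace.norm_sq_eq]
    push_cast
    refine Finset.sum_congr rfl fun i _ => ?_
    rw [← AlgHom.toLinearMap_apply, χ.toLinearMap.map_smul, smul_eq_mul, ← Complex.conj_mul']
    rfl
  rw [h3, Complex.norm_real, Real.norm_of_nonneg (by positivity)] at h1
  nlinarith [norm_nonneg c]

end IsApprox

theorem FixedTensor.sub_left {u : Matrix (Fin n × Fin m) (Fin n × Fin m) ℂ}
    {x x' : EuclideanSpace ℂ (Fin n)} {y : EuclideanSpace ℂ (Fin m)} (h : FixedTensor u x y)
    (h' : FixedTensor u x' y) : FixedTensor u (x - x') y := by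
  have h1 := h.add_left (y := y) (x' := -x') (by
    have := h'.smul (-1) 1
    rwa [neg_one_smul, one_smul] at this)
  rwa [← sub_eq_add_neg] at h1

theorem FixedTensor.sub_right {u : Matrix (Fin n × Fin m) (Fin n × Fin m) ℂ}
    {x : EuclideanSpace ℂ (Fin n)} {y y' : EuclideanSpace ℂ (Fin m)} (h : FixedTensor u x y)
    (h' : FixedTensor u x y') : FixedTensor u x (y - y') := by
  have h1 := h.add_right (y' := -y') (by
    have := h'.smul 1 (-1)
    rwa [neg_one_smul, one_smul] at this)
  rwa [← sub_eq_add_neg] at h1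

theorem isClosed_fixedTensor (u : Matrix (Fin n × Fin m) (Fin n × Fin m) ℂ) :
    IsClosed {p : EuclideanSpace ℂ (Fin n) × EuclideanSpace ℂ (Fin m) | FixedTensor u p.1 p.2} := by
  simp only [FixedTensor, Set.ofPred_forall]
  refine isClosed_iInter fun i => isClosed_iInter fun j => isClosed_eq ?_ ?_ <;> fun_prop

theorem hasDerivAt_euclidean {k : ℕ} {γ : ℂ → EuclideanSpace ℂ (Fin k)}
    {x : EuclideanSpace ℂ (Fin k)} {t : ℂ} :
    HasDerivAt γ x t ↔ ∀ i, HasDerivAt (fun s => γ s i) (x i) t := by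
  refine ⟨fun h i => (EuclideanSpace.proj (𝕜 := ℂ) i).hasFDerivAt.comp_hasDerivAt t h,
    fun h => ?_⟩
  exact (EuclideanSpace.equiv (Fin k) ℂ).symm.hasFDerivAt.comp_hasDerivAt t (hasDerivAt_pi.2 h)

/-- A tangent vector of a curve of solutions, at a point where the linearized relations are void,
is a solution. -/
theorem fixedTensor_of_hasDerivAt {u : Matrix (Fin n × Fin m) (Fin n × Fin m) ℂ}
    {γ : ℂ → EuclideanSpace ℂ (Fin n)} {δ : ℂ → EuclideanSpace ℂ (Fin m)}
    {x : EuclideanSpace ℂ (Fin n)} {y : EuclideanSpace ℂ (Fin m)}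
    (hγ : HasDerivAt γ x 0) (hδ : HasDerivAt δ y 0)
    (hf : ∀ t ∈ Metric.ball (0 : ℂ) 1, FixedTensor u (γ t) (δ t))
    (hl : ∀ b, FixedTensor u (γ 0) b) (hr : ∀ a, FixedTensor u a (δ 0)) : FixedTensor u x y := by
  have h1 := (hasDerivAt_iff_tendsto_slope_zero.1 hγ).prodMk_nhds
    (hasDerivAt_iff_tendsto_slope_zero.1 hδ)
  have h2 : ∀ᶠ t in nhdsWithin (0 : ℂ) {0}ᶜ, t ∈ Metric.ball (0 : ℂ) 1 :=
    nhdsWithin_le_nhds (Metric.ball_mem_nhds 0 one_pos)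
  have h3 : ∀ t ∈ Metric.ball (0 : ℂ) 1,
      FixedTensor u (t⁻¹ • (γ (0 + t) - γ 0)) (t⁻¹ • (δ (0 + t) - δ 0)) := by
    intro t ht
    refine FixedTensor.smul ?_ _ _
    rw [zero_add]
    -- Expand `(γ t - γ 0) ⊗ (δ t - δ 0)` into four terms. The three that contain `γ 0` or `δ 0` are
    -- fixed by `hl` and `hr`, so the quadratic term can be rescaled by `t⁻²` and survives in the
    -- limit.
    exact ((hf t ht).sub_right (hr _)).sub_left ((hl _).sub_right (hl _))
  have h4 : (x, y) ∈ {p : EuclideanSpace ℂ (Fin n) × EuclideanSpace ℂ (Fin m) |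
      FixedTensor u p.1 p.2} := (isClosed_fixedTensor u).mem_of_tendsto h1 (h2.mono h3)
  exact h4

theorem mobiusDeriv_zero {E : Type*} [NormedAddCommGroup E] [InnerProductSpace ℂ E] (x : E) :
    mobiusDeriv (0 : E) x = x := by
  simp [mobiusDeriv_apply, defect]

namespace IsApprox

variable {u : Matrix.unitaryGroup (Fin n × Fin m) ℂ}
  {S : Subalgebra ℂ (Fock n m →L[ℂ] Fock n m)}

/-- Bounds on the tangent vector of a curve of characters. -/
theorem tangent_bound (h : IsApprox u S) {L : ℂ → StrongDual ℂ (Fock n m)} (a : S → Fock n m)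
    (hχ : ∀ t ∈ Metric.ball (0 : ℂ) 1, ∃ χ : S →ₐ[ℂ] ℂ, (∃ C : ℝ, ∀ T, ‖χ T‖ ≤ C * ‖T‖) ∧
      ∀ T, χ T = L t (a T))
    (hL : ∀ t ∈ Metric.ball (0 : ℂ) 1, DifferentiableAt ℂ L t) {L' : StrongDual ℂ (Fock n m)}
    (hL' : HasDerivAt L L' 0) {z x : EuclideanSpace ℂ (Fin n)} {w y : EuclideanSpace ℂ (Fin m)}
    (hz : ∀ i, L 0 (a (h.genE i)) = z i) (hw : ∀ j, L 0 (a (h.genF j)) = w j)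
    (hx : ∀ i, L' (a (h.genE i)) = x i) (hy : ∀ j, L' (a (h.genF j)) = y j)
    (hz1 : ‖z‖ < 1) (hw1 : ‖w‖ < 1)
    (hl : ∀ b, FixedTensor u.1 z b) (hr : ∀ b, FixedTensor u.1 b w) :
    FixedTensor u.1 x y ∧ ‖mobiusDeriv z x‖ ≤ 1 ∧ ‖mobiusDeriv w y‖ ≤ 1 := by
  set γ : ℂ → EuclideanSpace ℂ (Fin n) := fun t => WithLp.toLp 2 fun i => L t (a (h.genE i))
  set δ : ℂ → EuclideanSpace ℂ (Fin m) := fun t => WithLp.toLp 2 fun j => L t (a (h.genF j))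
  have hγ0 : γ 0 = z := by ext i; exact hz i
  have hδ0 : δ 0 = w := by ext i; exact hw i
  have hγ : HasDerivAt γ x 0 := by
    rw [hasDerivAt_euclidean]
    intro i
    rw [← hx i]
    exact (ContinuousLinearMap.apply ℂ ℂ (a (h.genE i))).hasFDerivAt.comp_hasDerivAt 0 hL'
  have hδ : HasDerivAt δ y 0 := by
    rw [hasDerivAt_euclidean]
    intro i
    rw [← hy i]
    exact (ContinuousLinearMap.apply ℂ ℂ (a (h.genF i))).hasFDerivAt.comp_hasDerivAt 0 hL'
  have hγd : DifferentiableOn ℂ γ (Metric.ball 0 1) := by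
    rw [differentiableOn_piLp]
    exact fun i t ht => ((ContinuousLinearMap.apply ℂ ℂ
      (a (h.genE i))).differentiableAt.comp t (hL t ht)).differentiableWithinAt
  have hδd : DifferentiableOn ℂ δ (Metric.ball 0 1) := by
    rw [differentiableOn_piLp]
    exact fun i t ht => ((ContinuousLinearMap.apply ℂ ℂ
      (a (h.genF i))).differentiableAt.comp t (hL t ht)).differentiableWithinAt
  have key : ∀ t ∈ Metric.ball (0 : ℂ) 1, FixedTensor u.1 (γ t) (δ t) ∧ ‖γ t‖ ≤ 1 ∧ ‖δ t‖ ≤ 1 := by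
    intro t ht
    obtain ⟨χ, ⟨C, hC⟩, hT⟩ := hχ t ht
    have e1 : γ t = WithLp.toLp 2 fun i => χ (h.genE i) := by ext i; exact (hT _).symm
    have e2 : δ t = WithLp.toLp 2 fun i => χ (h.genF i) := by ext i; exact (hT _).symm
    rw [e1, e2]
    exact ⟨h.fixedTensor_character χ,
      norm_coordinates_le inner_shiftE (fun i => (h.genE i).2) χ (norm_character_le χ hC),
      norm_coordinates_le (inner_shiftF u) (fun i => (h.genF i).2) χ (norm_character_le χ hC)⟩
  refine ⟨fixedTensor_of_hasDerivAt hγ hδ (fun t ht => (key t ht).1) (hγ0 ▸ hl) (hδ0 ▸ hr),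
    norm_mobiusDeriv_le hz1 hγ0 hγd (fun t ht => (key t ht).2.1) hγ,
    norm_mobiusDeriv_le hw1 hδ0 hδd (fun t ht => (key t ht).2.2) hδ⟩

/-- A point derivation is determined by its values on the shifts. -/
theorem derivation_ext (h : IsApprox u S) {χ : S → ℂ} (hχ : χ 1 = 1) {D D' : S →ₗ[ℂ] ℂ}
    (hD : ∀ A B, D (A * B) = χ A * D B + D A * χ B)
    (hD' : ∀ A B, D' (A * B) = χ A * D' B + D' A * χ B)
    (hE : ∀ i, D (h.genE i) = D' (h.genE i)) (hF : ∀ j, D (h.genF j) = D' (h.genF j))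
    {T : Fock n m →L[ℂ] Fock n m} (hT : T ∈ polyAlg u) : D ⟨T, h.le hT⟩ = D' ⟨T, h.le hT⟩ := by
  have one : ∀ D : S →ₗ[ℂ] ℂ, (∀ A B, D (A * B) = χ A * D B + D A * χ B) → D 1 = 0 := by
    intro D hD
    have := hD 1 1
    rw [hχ, mul_one] at this
    linear_combination -this
  induction hT using Algebra.adjoin_induction with
  | mem T hT =>
    rcases hT with ⟨i, rfl⟩ | ⟨j, rfl⟩
    · exact hE i
    · exact hF j
  | algebraMap c =>
    have : (⟨algebraMap ℂ _ c, h.le (Subalgebra.algebraMap_mem _ c)⟩ : S) = c • 1 :=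
      Subtype.ext (Algebra.algebraMap_eq_smul_one c)
    rw [this, map_smul, map_smul, one D hD, one D' hD']
  | add A B hA hB h1 h2 =>
    have : (⟨A + B, h.le (add_mem hA hB)⟩ : S) = ⟨A, h.le hA⟩ + ⟨B, h.le hB⟩ := rfl
    rw [this, map_add, map_add, h1, h2]
  | mul A B hA hB h1 h2 =>
    have : (⟨A * B, h.le (mul_mem hA hB)⟩ : S) = ⟨A, h.le hA⟩ * ⟨B, h.le hB⟩ := rfl
    rw [this, hD, hD', h1, h2]

theorem character_ext (h : IsApprox u S) {χ χ' : S →ₐ[ℂ] ℂ}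
    (hE : ∀ i, χ (h.genE i) = χ' (h.genE i)) (hF : ∀ j, χ (h.genF j) = χ' (h.genF j))
    {T : Fock n m →L[ℂ] Fock n m} (hT : T ∈ polyAlg u) : χ ⟨T, h.le hT⟩ = χ' ⟨T, h.le hT⟩ := by
  induction hT using Algebra.adjoin_induction with
  | mem T hT =>
    rcases hT with ⟨i, rfl⟩ | ⟨j, rfl⟩
    · exact hE i
    · exact hF j
  | algebraMap c => exact (χ.commutes c).trans (χ'.commutes c).symm
  | add A B hA hB h1 h2 =>
    have : (⟨A + B, h.le (add_mem hA hB)⟩ : S) = ⟨A, h.le hA⟩ + ⟨B, h.le hB⟩ := rfl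
    have e := χ.toLinearMap.map_add ⟨A, h.le hA⟩ ⟨B, h.le hB⟩
    have e' := χ'.toLinearMap.map_add ⟨A, h.le hA⟩ ⟨B, h.le hB⟩
    simp only [AlgHom.toLinearMap_apply] at e e'
    rw [this, e, e', h1, h2]
  | mul A B hA hB h1 h2 =>
    have : (⟨A * B, h.le (mul_mem hA hB)⟩ : S) = ⟨A, h.le hA⟩ * ⟨B, h.le hB⟩ := rfl
    rw [this, map_mul χ, map_mul χ', h1, h2]

/-- The derivative of a curve of point evaluations is a point derivation. -/
theorem exists_hasDerivAt (h : IsApprox u S) {γ : ℂ → EuclideanSpace ℂ (Fin n)}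
    {δ : ℂ → EuclideanSpace ℂ (Fin m)} {x : EuclideanSpace ℂ (Fin n)}
    {y : EuclideanSpace ℂ (Fin m)} (hγ : HasDerivAt γ x 0) (hδ : HasDerivAt δ y 0)
    (hγ1 : ∀ t ∈ Metric.ball (0 : ℂ) 1, ‖γ t‖ < 1) (hδ1 : ∀ t ∈ Metric.ball (0 : ℂ) 1, ‖δ t‖ < 1)
    (hf : ∀ t ∈ Metric.ball (0 : ℂ) 1, FixedTensor u.1 (γ t) (δ t)) :
    ∃ L' : StrongDual ℂ (Fock n m),
      HasDerivAt (fun t => pointFunctional u (γ t) (δ t)) L' 0 ∧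
      (∀ A B : S, L' ((A * B).1 (vac n m)) =
        pointFunctional u (γ 0) (δ 0) (A.1 (vac n m)) * L' (B.1 (vac n m)) +
          L' (A.1 (vac n m)) * pointFunctional u (γ 0) (δ 0) (B.1 (vac n m))) ∧
      (∀ i, L' (shiftE i (vac n m)) = x i) ∧ ∀ j, L' (shiftF u j (vac n m)) = y j := by
  have h0 : (0 : ℂ) ∈ Metric.ball (0 : ℂ) 1 := Metric.mem_ball_self one_pos
  have hball : ∀ᶠ t in nhds (0 : ℂ), t ∈ Metric.ball (0 : ℂ) 1 := Metric.ball_mem_nhds 0 one_pos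
  have hd := (differentiableAt_pointFunctional u hγ.differentiableAt hδ.differentiableAt (hγ1 0 h0)
    (hδ1 0 h0)).hasDerivAt
  have hd' : ∀ ξ, HasDerivAt (fun t => pointFunctional u (γ t) (δ t) ξ) _ 0 := fun ξ =>
    (ContinuousLinearMap.apply ℂ ℂ ξ).hasFDerivAt.comp_hasDerivAt 0 hd
  refine ⟨_, hd, fun A B => ?_, fun i => ?_, fun j => ?_⟩
  · have h1 := (hd' (A.1 (vac n m))).mul (hd' (B.1 (vac n m)))
    have h2 := (hd' ((A * B).1 (vac n m)))
    have h3 := h1.congr_of_eventuallyEq (f₁ := fun t =>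
        pointFunctional u (γ t) (δ t) ((A * B).1 (vac n m))) (by
      filter_upwards [hball] with t ht
      exact h.pointFunctional_mul (hγ1 t ht) (hδ1 t ht) (hf t ht) A.2 (B.1 (vac n m)))
    have h4 := h2.unique h3
    simp only [ContinuousLinearMap.apply_apply] at h4
    rw [h4]; ring
  · have h1 : HasDerivAt (fun t => γ t i) (x i) 0 := hasDerivAt_euclidean.1 hγ i
    refine (hd' (shiftE i (vac n m))).unique (h1.congr_of_eventuallyEq ?_)
    filter_upwards [hball] with t ht
    rw [pointFunctional_shiftE u (hγ1 t ht) (hδ1 t ht),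
      pointFunctional_vac u (hγ1 t ht) (hδ1 t ht), mul_one]
  · have h1 : HasDerivAt (fun t => δ t j) (y j) 0 := hasDerivAt_euclidean.1 hδ j
    refine (hd' (shiftF u j (vac n m))).unique (h1.congr_of_eventuallyEq ?_)
    filter_upwards [hball] with t ht
    rw [pointFunctional_shiftF u (hγ1 t ht) (hδ1 t ht) (hf t ht),
      pointFunctional_vac u (hγ1 t ht) (hδ1 t ht), mul_one]

end IsApprox

/-! ### Derivations at the vacuum -/

variable (n m) in
/-- The functional that belongs to the vacuum. -/
def vacFun : StrongDual ℂ (Fock n m) := innerSL ℂ (vac n m)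

/-- The coefficient functional of `e_i`. -/
def coordE (i : Fin n) : StrongDual ℂ (Fock n m) := innerSL ℂ (basisVec [i] [])

/-- The coefficient functional of `f_j`. -/
def coordF (j : Fin m) : StrongDual ℂ (Fock n m) := innerSL ℂ (basisVec [] [j])

theorem vacFun_vac : vacFun n m (vac n m) = 1 := inner_vac_vac

theorem vacFun_shiftE (i : Fin n) (x : Fock n m) : vacFun n m (shiftE i x) = 0 :=
  inner_vac_shiftE i x

theorem vacFun_shiftF (u : Matrix.unitaryGroup (Fin n × Fin m) ℂ) (j : Fin m) (x : Fock n m) :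
    vacFun n m (shiftF u j x) = 0 :=
  inner_vac_shiftF u j x

theorem coordE_vac (i : Fin n) : coordE i (vac n m) = 0 := by
  rw [coordE, innerSL_apply_apply, vac, inner_basisVec]
  simp

theorem coordF_vac (j : Fin m) : coordF j (vac n m) = 0 := by
  rw [coordF, innerSL_apply_apply, vac, inner_basisVec]
  simp

theorem coordE_shiftE (i k : Fin n) (x : Fock n m) :
    coordE i (shiftE k x) = if i = k then vacFun n m x else 0 := by
  rw [coordE, innerSL_apply_apply, ← shiftE_basisVec, inner_shiftE]
  rfl

theorem coordE_shiftF (u : Matrix.unitaryGroup (Fin n × Fin m) ℂ) (i : Fin n) (j : Fin m)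
    (x : Fock n m) : coordE i (shiftF u j x) = 0 :=
  inner_basisVec_nil_shiftF u j [i] x

theorem coordF_shiftE (j : Fin m) (i : Fin n) (x : Fock n m) : coordF j (shiftE i x) = 0 :=
  inner_basisVec_nil_shiftE i [j] x

theorem coordF_shiftF (u : Matrix.unitaryGroup (Fin n × Fin m) ℂ) (j l : Fin m) (x : Fock n m) :
    coordF j (shiftF u l x) = if j = l then vacFun n m x else 0 := by
  rw [coordF, innerSL_apply_apply, ← shiftF_basisVec_nil u, inner_shiftF]
  rfl

theorem pointFunctional_zero (u : Matrix.unitaryGroup (Fin n × Fin m) ℂ) :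
    pointFunctional u 0 0 = vacFun n m := by
  ext x
  simp [pointFunctional, annE, annF, vacFun]

/-- The derivation at the vacuum with the values `b` on the shifts. -/
def vacDer (b : EuclideanSpace ℂ (Fin n) × EuclideanSpace ℂ (Fin m)) : StrongDual ℂ (Fock n m) :=
  ∑ i, b.1 i • coordE i + ∑ j, b.2 j • coordF j

theorem vacDer_apply (b : EuclideanSpace ℂ (Fin n) × EuclideanSpace ℂ (Fin m)) (x : Fock n m) :
    vacDer b x = ∑ i, b.1 i * coordE i x + ∑ j, b.2 j * coordF j x := by
  simp [vacDer]

theorem vacDer_shiftE (b : EuclideanSpace ℂ (Fin n) × EuclideanSpace ℂ (Fin m)) (i : Fin n)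
    (x : Fock n m) : vacDer b (shiftE i x) = b.1 i * vacFun n m x := by
  simp [vacDer_apply, coordE_shiftE, coordF_shiftE]

theorem vacDer_shiftF (u : Matrix.unitaryGroup (Fin n × Fin m) ℂ)
    (b : EuclideanSpace ℂ (Fin n) × EuclideanSpace ℂ (Fin m)) (j : Fin m)
    (x : Fock n m) : vacDer b (shiftF u j x) = b.2 j * vacFun n m x := by
  simp [vacDer_apply, coordE_shiftF, coordF_shiftF]

theorem vacDer_vac (b : EuclideanSpace ℂ (Fin n) × EuclideanSpace ℂ (Fin m)) :
    vacDer b (vac n m) = 0 := by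
  simp [vacDer_apply, coordE_vac, coordF_vac]

/-! ### Functionals of second order, adapted to both orderings of the mixed products -/

/-- For coefficients `c` of `f_l ⊗ e_k`, the functional with coefficients `u c` of `e_i ⊗ f_j`. -/
def quadFun (u : Matrix.unitaryGroup (Fin n × Fin m) ℂ) (c : Fin n × Fin m → ℂ) :
    StrongDual ℂ (Fock n m) :=
  ∑ a : Fin n × Fin m, (u.1.mulVec c) a • innerSL ℂ (basisVec [a.1] [a.2])

/-- The bilinear form that belongs to `quadFun`. -/
def quadForm (u : Matrix.unitaryGroup (Fin n × Fin m) ℂ) (c : Fin n × Fin m → ℂ) (x : Fock n m) :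
    StrongDual ℂ (Fock n m) :=
  ∑ a : Fin n × Fin m, (((u.1.mulVec c) a * coordF a.2 x) • coordE a.1 +
    (c a * coordE a.1 x) • coordF a.2)

theorem quadForm_apply (u : Matrix.unitaryGroup (Fin n × Fin m) ℂ) (c : Fin n × Fin m → ℂ)
    (x y : Fock n m) : quadForm u c x y = ∑ a : Fin n × Fin m,
      ((u.1.mulVec c) a * (coordE a.1 y * coordF a.2 x) + c a * (coordF a.2 y * coordE a.1 x)) := by
  simp only [quadForm, sum_apply, add_apply, smul_apply, smul_eq_mul]
  exact Finset.sum_congr rfl fun a _ => by ring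

theorem quadFun_vac (u : Matrix.unitaryGroup (Fin n × Fin m) ℂ) (c : Fin n × Fin m → ℂ) :
    quadFun u c (vac n m) = 0 := by
  simp only [quadFun, sum_apply, smul_apply, innerSL_apply_apply]
  refine Finset.sum_eq_zero fun a _ => ?_
  rw [vac, inner_basisVec]
  simp

theorem quadFun_shiftE (u : Matrix.unitaryGroup (Fin n × Fin m) ℂ) (c : Fin n × Fin m → ℂ)
    (i : Fin n) (x : Fock n m) :
    quadFun u c (shiftE i x) = quadForm u c x (shiftE i (vac n m)) := by
  rw [quadForm_apply]
  simp only [quadFun, sum_apply, smul_apply, innerSL_apply_apply, smul_eq_mul]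
  refine Finset.sum_congr rfl fun a _ => ?_
  rw [← shiftE_basisVec, inner_shiftE, coordE_shiftE, coordF_shiftE, vacFun_vac]
  by_cases h : a.1 = i <;> simp [h, coordF]

/-- Rewriting `e_r ⊗ f_s` through `f_l ⊗ e_k` applies the adjoint of `u` to the coefficients `u c`,
which returns `c`. Thus the functional has coefficients `u c` on products `e f` and `c` on products
`f e`. -/
theorem quadFun_shiftF (u : Matrix.unitaryGroup (Fin n × Fin m) ℂ) (c : Fin n × Fin m → ℂ)
    (j : Fin m) (x : Fock n m) :
    quadFun u c (shiftF u j x) = quadForm u c x (shiftF u j (vac n m)) := by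
  have h1 : ∀ a : Fin n × Fin m, ⟪basisVec [a.1] [a.2], shiftF u j x⟫_ℂ =
      ∑ k, star (u.1 a (k, j)) * coordE k x := by
    rintro ⟨r, s⟩
    have e : basisVec [r] [s] = ∑ k, ∑ l, u.1 (r, s) (k, l) • shiftF u l (basisVec [k] []) := by
      have h2 := congrArg (fun T : Fock n m →L[ℂ] Fock n m => T (vac n m)) (shiftE_mul_shiftF u r s)
      simpa [vac, shiftF_basisVec_nil, shiftE_basisVec] using h2
    rw [e]
    simp only [sum_inner, inner_smul_left, inner_shiftF, mul_ite, mul_zero, Finset.sum_ite_eq',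
      Finset.mem_univ, if_true]
    rfl
  have hu := Matrix.mem_unitaryGroup_iff'.1 u.2
  have h2 : ∀ k, ∑ a : Fin n × Fin m, star (u.1 a (k, j)) * (u.1.mulVec c) a = c (k, j) := by
    intro k
    have : ((star u.1).mulVec (u.1.mulVec c)) (k, j) = c (k, j) := by
      rw [Matrix.mulVec_mulVec, hu, Matrix.one_mulVec]
    rw [← this]
    rfl
  rw [quadForm_apply]
  simp only [quadFun, sum_apply, smul_apply, innerSL_apply_apply, smul_eq_mul, h1, coordE_shiftF,
    coordF_shiftF, vacFun_vac, zero_mul, mul_zero, zero_add]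
  simp only [Fintype.sum_prod_type, ite_mul, one_mul, zero_mul, mul_ite, mul_zero,
    Finset.sum_ite_eq', Finset.mem_univ, if_true]
  rw [← Fintype.sum_prod_type' (f := fun r s => u.1.mulVec c (r, s) *
    ∑ k, star (u.1 (r, s) (k, j)) * coordE k x)]
  simp only [← h2, Finset.sum_mul, Finset.mul_sum]
  rw [Finset.sum_comm]
  exact Finset.sum_congr rfl fun k _ => Finset.sum_congr rfl fun a _ => by ring

namespace IsApprox

variable {u : Matrix.unitaryGroup (Fin n × Fin m) ℂ}
  {S : Subalgebra ℂ (Fock n m →L[ℂ] Fock n m)}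

theorem vacFun_mul (h : IsApprox u S) {T : Fock n m →L[ℂ] Fock n m} (hT : T ∈ S) (x : Fock n m) :
    vacFun n m (T x) = vacFun n m (T (vac n m)) * vacFun n m x := by
  have := h.pointFunctional_mul (z := 0) (w := 0) (by simp) (by simp)
    (fixedTensor_zero_left _ _) hT x
  rwa [pointFunctional_zero] at this

/-- The relations are quadratic and hence void to first order at the vacuum, so every pair `b` is
admitted, whether or not `b.1 ⊗ b.2` is fixed by `u`. -/
theorem vacDer_mul (h : IsApprox u S) (b : EuclideanSpace ℂ (Fin n) × EuclideanSpace ℂ (Fin m))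
    {T : Fock n m →L[ℂ] Fock n m} (hT : T ∈ S) (x : Fock n m) :
    vacDer b (T x) = vacFun n m (T (vac n m)) * vacDer b x + vacDer b (T (vac n m)) *
      vacFun n m x := by
  have key : ∀ T ∈ polyAlg u, ∀ x, vacDer b (T x) = vacFun n m (T (vac n m)) * vacDer b x +
      vacDer b (T (vac n m)) * vacFun n m x := by
    intro T hT
    induction hT using Algebra.adjoin_induction with
    | mem T hT =>
      intro x
      rcases hT with ⟨i, rfl⟩ | ⟨j, rfl⟩
      · rw [vacDer_shiftE, vacDer_shiftE, vacFun_shiftE, vacFun_vac]; ring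
      · rw [vacDer_shiftF, vacDer_shiftF, vacFun_shiftF, vacFun_vac]; ring
    | algebraMap c =>
      intro x
      simp [Algebra.algebraMap_eq_smul_one, vacFun_vac, vacDer_vac]
    | add A B _ _ h1 h2 =>
      intro x
      simp only [add_apply, map_add, h1 x, h2 x]; ring
    | mul A B hA hB h1 h2 =>
      intro x
      simp only [mul_apply_eq_comp]
      rw [h1 (B x), h2 x, h1 (B (vac n m)), h.vacFun_mul (h.le hB) x,
        h.vacFun_mul (h.le hA) (B (vac n m))]
      ring
  have := h.ext (coeff (vacDer b) x - vacDer b x • coeff (vacFun n m) (vac n m) -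
    vacFun n m x • coeff (vacDer b) (vac n m))
    (sub_mem (sub_mem (coeff_mem _ _) (Submodule.smul_mem _ _ (coeff_mem _ _)))
      (Submodule.smul_mem _ _ (coeff_mem _ _)))
    (fun T hT => by
      simp only [LinearMap.sub_apply, LinearMap.smul_apply, coeff_apply, smul_eq_mul]
      rw [key T hT x]; ring) T hT
  simp only [LinearMap.sub_apply, LinearMap.smul_apply, coeff_apply, smul_eq_mul] at this
  linear_combination this

theorem coordE_mul (h : IsApprox u S) (i : Fin n) {T : Fock n m →L[ℂ] Fock n m} (hT : T ∈ S)
    (x : Fock n m) : coordE i (T x) = vacFun n m (T (vac n m)) * coordE i x +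
      coordE i (T (vac n m)) * vacFun n m x := by
  have e : ∀ y : Fock n m, vacDer (EuclideanSpace.single i 1, 0) y = coordE i y := fun y => by
    simp [vacDer_apply, PiLp.single_apply]
  simpa only [e] using h.vacDer_mul (EuclideanSpace.single i 1, 0) hT x

theorem coordF_mul (h : IsApprox u S) (j : Fin m) {T : Fock n m →L[ℂ] Fock n m} (hT : T ∈ S)
    (x : Fock n m) : coordF j (T x) = vacFun n m (T (vac n m)) * coordF j x +
      coordF j (T (vac n m)) * vacFun n m x := by
  have e : ∀ y : Fock n m, vacDer (0, EuclideanSpace.single j 1) y = coordF j y := fun y => by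
    simp [vacDer_apply, PiLp.single_apply]
  simpa only [e] using h.vacDer_mul (0, EuclideanSpace.single j 1) hT x

theorem quadForm_mul_left (h : IsApprox u S) (c : Fin n × Fin m → ℂ)
    {T : Fock n m →L[ℂ] Fock n m} (hT : T ∈ S) (x y : Fock n m) :
    quadForm u c (T x) y = vacFun n m (T (vac n m)) * quadForm u c x y +
      vacFun n m x * quadForm u c (T (vac n m)) y := by
  simp only [quadForm_apply, Finset.mul_sum, ← Finset.sum_add_distrib]
  refine Finset.sum_congr rfl fun a _ => ?_
  rw [h.coordE_mul _ hT x, h.coordF_mul _ hT x]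
  ring

theorem quadForm_mul_right (h : IsApprox u S) (c : Fin n × Fin m → ℂ)
    {T : Fock n m →L[ℂ] Fock n m} (hT : T ∈ S) (x y : Fock n m) :
    quadForm u c x (T y) = vacFun n m (T (vac n m)) * quadForm u c x y +
      vacFun n m y * quadForm u c x (T (vac n m)) := by
  simp only [quadForm_apply, Finset.mul_sum, ← Finset.sum_add_distrib]
  refine Finset.sum_congr rfl fun a _ => ?_
  rw [h.coordE_mul _ hT y, h.coordF_mul _ hT y]
  ring

/-- A Leibniz rule of second order: the cross term `quadForm` pairs the degree one parts of the two
factors, in the order in which they are multiplied. -/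
theorem quadFun_mul (h : IsApprox u S) (c : Fin n × Fin m → ℂ)
    {T : Fock n m →L[ℂ] Fock n m} (hT : T ∈ S) (x : Fock n m) :
    quadFun u c (T x) = vacFun n m (T (vac n m)) * quadFun u c x +
      quadForm u c x (T (vac n m)) + quadFun u c (T (vac n m)) * vacFun n m x := by
  have hv : ∀ y, quadForm u c (vac n m) y = 0 := fun y => by
    simp [quadForm_apply, coordE_vac, coordF_vac]
  have hv' : ∀ y, quadForm u c y (vac n m) = 0 := fun y => by
    simp [quadForm_apply, coordE_vac, coordF_vac]
  have key : ∀ T ∈ polyAlg u, ∀ x, quadFun u c (T x) = vacFun n m (T (vac n m)) * quadFun u c x +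
      quadForm u c x (T (vac n m)) + quadFun u c (T (vac n m)) * vacFun n m x := by
    intro T hT
    induction hT using Algebra.adjoin_induction with
    | mem T hT =>
      intro x
      rcases hT with ⟨i, rfl⟩ | ⟨j, rfl⟩
      · rw [quadFun_shiftE, quadFun_shiftE, vacFun_shiftE, hv]; ring
      · rw [quadFun_shiftF, quadFun_shiftF, vacFun_shiftF, hv]; ring
    | algebraMap c =>
      intro x
      simp [Algebra.algebraMap_eq_smul_one, vacFun_vac, quadFun_vac, hv']
    | add A B _ _ h1 h2 =>
      intro x
      simp only [add_apply, map_add, h1 x, h2 x]; ring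
    | mul A B hA hB h1 h2 =>
      intro x
      simp only [mul_apply_eq_comp]
      rw [h1 (B x), h2 x, h1 (B (vac n m)), h.vacFun_mul (h.le hB) x,
        h.vacFun_mul (h.le hA) (B (vac n m)), h.quadForm_mul_left c (h.le hB),
        h.quadForm_mul_right c (h.le hA) x (B (vac n m))]
      ring
  have := h.ext (coeff (quadFun u c) x - quadFun u c x • coeff (vacFun n m) (vac n m) -
    coeff (quadForm u c x) (vac n m) - vacFun n m x • coeff (quadFun u c) (vac n m))
    (sub_mem (sub_mem (sub_mem (coeff_mem _ _) (Submodule.smul_mem _ _ (coeff_mem _ _)))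
      (coeff_mem _ _)) (Submodule.smul_mem _ _ (coeff_mem _ _)))
    (fun T hT => by
      simp only [LinearMap.sub_apply, LinearMap.smul_apply, coeff_apply, smul_eq_mul]
      rw [key T hT x]; ring) T hT
  simp only [LinearMap.sub_apply, LinearMap.smul_apply, coeff_apply, smul_eq_mul] at this
  linear_combination this

end IsApprox

/-! ### Linear maps that preserve the maximum of two norms -/

section MaxNorm

variable {E F : Type*} [NormedAddCommGroup E] [InnerProductSpace ℂ E] [NormedAddCommGroup F]
  [InnerProductSpace ℂ F]

/-- Strict convexity of the Hilbert norm, by the parallelogram law: a point of the sphere is not the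
midpoint of a nontrivial segment in the ball. -/
theorem eq_zero_of_norm_add_sub_le {x y : E} {r : ℝ} (hx : ‖x‖ = r) (h1 : ‖x + y‖ ≤ r)
    (h2 : ‖x - y‖ ≤ r) : y = 0 := by
  have h := parallelogram_law_with_norm ℂ x y
  have : ‖y‖ ^ 2 ≤ 0 := by
    rw [hx] at h
    nlinarith [norm_nonneg (x + y), norm_nonneg (x - y), norm_nonneg y]
  exact norm_eq_zero.1 (by nlinarith [norm_nonneg y])

/-- Two nonzero vectors that behave like the basis of `ℓ^∞(2)` lie in different summands. -/
theorem components_ne_zero_of_norm_smul_add {a b : E × F} {r s : ℝ} (hr : 0 < r) (hs : 0 < s)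
    (h : ∀ c d : ℂ, ‖c • a + d • b‖ = max (‖c‖ * r) (‖d‖ * s)) :
    (a + b).1 ≠ 0 ∧ (a + b).2 ≠ 0 := by
  set b' : E × F := ((r / s : ℝ) : ℂ) • b with hb'
  have hrs : 0 < r / s := div_pos hr hs
  have hna : ‖a‖ = r := by simpa [hr.le] using h 1 0
  have hnb : ‖b'‖ = r := by
    have := h 0 ((r / s : ℝ) : ℂ)
    rw [zero_smul, zero_add] at this
    rw [hb', this, Complex.norm_real, Real.norm_of_nonneg hrs.le, div_mul_cancel₀ _ hs.ne']
    simp [hr.le]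
  have hadd : ‖a + b'‖ = r := by
    have := h 1 ((r / s : ℝ) : ℂ)
    rw [one_smul] at this
    rw [hb', this, Complex.norm_real, Real.norm_of_nonneg hrs.le, div_mul_cancel₀ _ hs.ne']
    simp
  have hsub : ‖a - b'‖ = r := by
    have := h 1 (-((r / s : ℝ) : ℂ))
    rw [one_smul, neg_smul, ← sub_eq_add_neg] at this
    rw [hb', this, norm_neg, Complex.norm_real, Real.norm_of_nonneg hrs.le,
      div_mul_cancel₀ _ hs.ne']
    simp
  have hsub' : ‖b' - a‖ = r := by rw [norm_sub_rev, hsub]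
  have hadd' : ‖b' + a‖ = r := by rw [add_comm, hadd]
  -- After rescaling, `a`, `b'`, `a + b'` and `a - b'` all have norm `r`. A component of `a` of full
  -- norm `r` therefore forces the same component of `b'` to vanish, and conversely.
  have f1 : ‖a.1‖ = r → b'.1 = 0 := fun e => eq_zero_of_norm_add_sub_le e
    ((norm_fst_le (a + b')).trans hadd.le) ((norm_fst_le (a - b')).trans hsub.le)
  have f2 : ‖a.2‖ = r → b'.2 = 0 := fun e => eq_zero_of_norm_add_sub_le e
    ((norm_snd_le (a + b')).trans hadd.le) ((norm_snd_le (a - b')).trans hsub.le)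
  have g1 : ‖b'.1‖ = r → a.1 = 0 := fun e => eq_zero_of_norm_add_sub_le e
    ((norm_fst_le (b' + a)).trans hadd'.le) ((norm_fst_le (b' - a)).trans hsub'.le)
  have g2 : ‖b'.2‖ = r → a.2 = 0 := fun e => eq_zero_of_norm_add_sub_le e
    ((norm_snd_le (b' + a)).trans hadd'.le) ((norm_snd_le (b' - a)).trans hsub'.le)
  have hc : ((r / s : ℝ) : ℂ) ≠ 0 := Complex.ofReal_ne_zero.2 hrs.ne'
  have hb1 : b'.1 = 0 ↔ b.1 = 0 := by simp [hb', hr.ne', hs.ne']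
  have hb2 : b'.2 = 0 ↔ b.2 = 0 := by simp [hb', hr.ne', hs.ne']
  rw [Prod.norm_def] at hna hnb
  rcases max_choice ‖a.1‖ ‖a.2‖ with e | e <;> rw [e] at hna
  · have hb10 := f1 hna
    rw [hb10, norm_zero, max_eq_right (norm_nonneg _)] at hnb
    have ha2 := g2 hnb
    refine ⟨?_, ?_⟩
    · rw [Prod.fst_add, hb1.1 hb10, add_zero, ← norm_ne_zero_iff, hna]; exact hr.ne'
    · rw [Prod.snd_add, ha2, zero_add, Ne, ← hb2, ← norm_eq_zero, hnb]; exact hr.ne'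
  · have hb20 := f2 hna
    rw [hb20, norm_zero, max_eq_left (norm_nonneg _)] at hnb
    have ha1 := g1 hnb
    refine ⟨?_, ?_⟩
    · rw [Prod.fst_add, ha1, zero_add, Ne, ← hb1, ← norm_eq_zero, hnb]; exact hr.ne'
    · rw [Prod.snd_add, hb2.1 hb20, add_zero, ← norm_ne_zero_iff, hna]; exact hr.ne'

/-- A vector space is not the union of two proper subspaces, here the two kernels. -/
theorem eq_zero_or_eq_zero_of_forall {V A B : Type*} [AddCommGroup V] [Module ℂ V] [AddCommGroup A]
    [Module ℂ A] [AddCommGroup B] [Module ℂ B] (f : V →ₗ[ℂ] A) (g : V →ₗ[ℂ] B)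
    (h : ∀ x, f x = 0 ∨ g x = 0) : f = 0 ∨ g = 0 := by
  by_contra! hne
  obtain ⟨x, hx⟩ := DFunLike.exists_ne hne.1
  obtain ⟨y, hy⟩ := DFunLike.exists_ne hne.2
  have hgx := (h x).resolve_left hx
  have hfy := (h y).resolve_right hy
  rcases h (x + y) with e | e
  · rw [map_add, hfy, add_zero] at e; exact hx e
  · rw [map_add, hgx, zero_add] at e; exact hy e

end MaxNorm

/-! ### The tangent map of an isometric isomorphism -/

/-- An isometric isomorphism of weakly dense subalgebras which is weakly continuous in the sense
that functionals of vector form are determined by their values on the algebra of the shifts. -/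
structure IsIso {u v : Matrix.unitaryGroup (Fin n × Fin m) ℂ}
    {S S' : Subalgebra ℂ (Fock n m →L[ℂ] Fock n m)} (hS : IsApprox u S) (hS' : IsApprox v S')
    (Γ : S ≃ₐ[ℂ] S') : Prop where
  norm_map : ∀ T, ‖Γ T‖ = ‖T‖
  ext : ∀ ℓ ℓ' : StrongDual ℂ (Fock n m), (∀ (T) (hT : T ∈ polyAlg u),
    ℓ (T (vac n m)) = ℓ' ((Γ ⟨T, hS.le hT⟩).1 (vac n m))) →
      ∀ T : S, ℓ (T.1 (vac n m)) = ℓ' ((Γ T).1 (vac n m))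

/-- The functional `T ↦ ℓ (Γ(T) Ω)`. -/
def pullFun {S S' : Subalgebra ℂ (Fock n m →L[ℂ] Fock n m)} (Γ : S ≃ₐ[ℂ] S')
    (ℓ : StrongDual ℂ (Fock n m)) : S →ₗ[ℂ] ℂ :=
  (coeff ℓ (vac n m)).comp (S'.val.toLinearMap.comp Γ.toLinearMap)

theorem pullFun_apply {S S' : Subalgebra ℂ (Fock n m →L[ℂ] Fock n m)} (Γ : S ≃ₐ[ℂ] S')
    (ℓ : StrongDual ℂ (Fock n m)) (T : S) : pullFun Γ ℓ T = ℓ ((Γ T).1 (vac n m)) := rfl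

theorem coe_map_mul_apply {S S' : Subalgebra ℂ (Fock n m →L[ℂ] Fock n m)} (Γ : S ≃ₐ[ℂ] S')
    (A B : S) (x : Fock n m) : (Γ (A * B)).1 x = (Γ A).1 ((Γ B).1 x) := by
  rw [map_mul]
  rfl

namespace IsIso

variable {u v : Matrix.unitaryGroup (Fin n × Fin m) ℂ}
  {S S' : Subalgebra ℂ (Fock n m →L[ℂ] Fock n m)} {hS : IsApprox u S} {hS' : IsApprox v S'}
  {Γ : S ≃ₐ[ℂ] S'}

/-- The first component of the image of the origin. -/
def baseE (_ : IsIso hS hS' Γ) : EuclideanSpace ℂ (Fin n) :=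
  WithLp.toLp 2 fun i => pullFun Γ (vacFun n m) (hS.genE i)

/-- The second component of the image of the origin. -/
def baseF (_ : IsIso hS hS' Γ) : EuclideanSpace ℂ (Fin m) :=
  WithLp.toLp 2 fun j => pullFun Γ (vacFun n m) (hS.genF j)

theorem vacDer_add (a b : EuclideanSpace ℂ (Fin n) × EuclideanSpace ℂ (Fin m)) (x : Fock n m) :
    vacDer (a + b) x = vacDer a x + vacDer b x := by
  simp only [vacDer_apply, Prod.fst_add, Prod.snd_add, PiLp.add_apply, add_mul,
    Finset.sum_add_distrib]
  ring

theorem vacDer_smul (c : ℂ) (b : EuclideanSpace ℂ (Fin n) × EuclideanSpace ℂ (Fin m))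
    (x : Fock n m) : vacDer (c • b) x = c * vacDer b x := by
  simp only [vacDer_apply, Prod.smul_fst, Prod.smul_snd, PiLp.smul_apply, smul_eq_mul, mul_add,
    Finset.mul_sum, mul_assoc]

/-- The tangent map at the origin. -/
def tangent (_ : IsIso hS hS' Γ) : (EuclideanSpace ℂ (Fin n) × EuclideanSpace ℂ (Fin m)) →ₗ[ℂ]
    (EuclideanSpace ℂ (Fin n) × EuclideanSpace ℂ (Fin m)) where
  toFun b := (WithLp.toLp 2 fun i => pullFun Γ (vacDer b) (hS.genE i),
    WithLp.toLp 2 fun j => pullFun Γ (vacDer b) (hS.genF j))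
  map_add' a b := by
    ext i <;> simp [pullFun_apply, vacDer_add]
  map_smul' c b := by
    ext i <;> simp [pullFun_apply, vacDer_smul]

theorem tangent_fst (h : IsIso hS hS' Γ) (b) (i : Fin n) :
    (h.tangent b).1 i = pullFun Γ (vacDer b) (hS.genE i) := rfl

theorem tangent_snd (h : IsIso hS hS' Γ) (b) (j : Fin m) :
    (h.tangent b).2 j = pullFun Γ (vacDer b) (hS.genF j) := rfl

theorem pullFun_vacFun_one (_ : IsIso hS hS' Γ) : pullFun Γ (vacFun n m) 1 = 1 := by
  rw [pullFun_apply, map_one]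
  exact vacFun_vac

theorem pullFun_vacDer_mul (_ : IsIso hS hS' Γ) (b) (A B : S) : pullFun Γ (vacDer b) (A * B) =
    pullFun Γ (vacFun n m) A * pullFun Γ (vacDer b) B +
      pullFun Γ (vacDer b) A * pullFun Γ (vacFun n m) B := by
  simp only [pullFun_apply, coe_map_mul_apply]
  exact hS'.vacDer_mul b (Γ A).2 _

theorem pullFun_quadFun_mul (_ : IsIso hS hS' Γ) (c) (A B : S) :
    pullFun Γ (quadFun v c) (A * B) =
      pullFun Γ (vacFun n m) A * pullFun Γ (quadFun v c) B +
        quadForm v c ((Γ B).1 (vac n m)) ((Γ A).1 (vac n m)) +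
        pullFun Γ (quadFun v c) A * pullFun Γ (vacFun n m) B := by
  simp only [pullFun_apply, coe_map_mul_apply]
  exact hS'.quadFun_mul c (Γ A).2 _

/-- If the pulled back derivation vanishes on the shifts of `u`, it vanishes on `polyAlg u` and, by
`IsIso.ext`, on `S`. Since `Γ` is onto, `vacDer b` vanishes on the shifts of `v`, where its values
are the entries of `b`. -/
theorem tangent_injective (h : IsIso hS hS' Γ) : Function.Injective h.tangent := by
  rw [← LinearMap.ker_eq_bot, LinearMap.ker_eq_bot']
  intro b hb
  have h1 : ∀ i, pullFun Γ (vacDer b) (hS.genE i) = 0 := fun i => by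
    rw [← h.tangent_fst, hb]; rfl
  have h2 : ∀ j, pullFun Γ (vacDer b) (hS.genF j) = 0 := fun j => by
    rw [← h.tangent_snd, hb]; rfl
  have h3 := h.ext 0 (vacDer b) fun T hT => by
    have := hS.derivation_ext (D := 0) (D' := pullFun Γ (vacDer b)) h.pullFun_vacFun_one
      (by simp) (h.pullFun_vacDer_mul b) (fun i => (h1 i).symm) (fun j => (h2 j).symm) hT
    exact this
  have h4 : ∀ A : S', vacDer b (A.1 (vac n m)) = 0 := fun A => by
    have := h3 (Γ.symm A)
    rw [Γ.apply_symm_apply] at this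
    exact this.symm
  refine Prod.ext ?_ ?_
  · ext i
    have := h4 (hS'.genE i)
    rwa [show (hS'.genE i).1 = shiftE i from rfl, vacDer_shiftE, vacFun_vac, mul_one] at this
  · ext j
    have := h4 (hS'.genF j)
    rwa [show (hS'.genF j).1 = shiftF v j from rfl, vacDer_shiftF, vacFun_vac, mul_one] at this

theorem tangent_surjective (h : IsIso hS hS' Γ) : Function.Surjective h.tangent :=
  LinearMap.surjective_of_injective h.tangent_injective

/-- The relation, evaluated by a functional. -/
theorem map_genE_mul_genF (hS : IsApprox u S) (D : S →ₗ[ℂ] ℂ) (i : Fin n) (j : Fin m) :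
    D (hS.genE i * hS.genF j) = ∑ k, ∑ l, u.1 (i, j) (k, l) * D (hS.genF l * hS.genE k) := by
  rw [hS.genE_mul_genF]
  simp only [map_sum, map_smul, smul_eq_mul]

/-- Apply to the relation of `u` the derivation whose values on the shifts are `(x, y)`; one exists
for every pair because the tangent map is onto. -/
theorem linearized_relation (h : IsIso hS hS' Γ) (x : EuclideanSpace ℂ (Fin n))
    (y : EuclideanSpace ℂ (Fin m)) (i : Fin n) (j : Fin m) :
    ∑ k, ∑ l, u.1 (i, j) (k, l) * (h.baseE k * y l + x k * h.baseF l) =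
      h.baseE i * y j + x i * h.baseF j := by
  obtain ⟨b, hb⟩ := h.tangent_surjective (x, y)
  have hx : ∀ i, pullFun Γ (vacDer b) (hS.genE i) = x i := fun i => by
    rw [← h.tangent_fst, hb]
  have hy : ∀ j, pullFun Γ (vacDer b) (hS.genF j) = y j := fun j => by
    rw [← h.tangent_snd, hb]
  have := map_genE_mul_genF hS (pullFun Γ (vacDer b)) i j
  simp only [h.pullFun_vacDer_mul, hx, hy] at this
  refine Eq.trans ?_ this.symm
  refine Finset.sum_congr rfl fun k _ => Finset.sum_congr rfl fun l _ => ?_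
  simp only [baseE, baseF]
  ring

theorem fixedTensor_baseE (h : IsIso hS hS' Γ) (y : EuclideanSpace ℂ (Fin m)) :
    FixedTensor u.1 h.baseE y := fun i j => by
  simpa using h.linearized_relation 0 y i j

theorem fixedTensor_baseF (h : IsIso hS hS' Γ) (x : EuclideanSpace ℂ (Fin n)) :
    FixedTensor u.1 x h.baseF := fun i j => by
  simpa using h.linearized_relation x 0 i j

/-- If `‖z‖ ≥ 1`, the operator `T = ∑ conj(zᵢ) Aᵢ` has norm at most `‖z‖` while `Γ(T) Ω` has vacuum
coefficient `‖z‖²`. This leaves no room for other coefficients, so `vacDer b` kills `Γ(T) Ω`; but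
`b` was chosen to give `‖z‖²` there. -/
theorem norm_lt_one_of_tangent (h : IsIso hS hS' Γ) {k : ℕ} {A : Fin k → Fock n m →L[ℂ] Fock n m}
    (hA : ∀ i j x y, ⟪A i x, A j y⟫_ℂ = if i = j then ⟪x, y⟫_ℂ else 0) (hAS : ∀ i, A i ∈ S)
    {z : EuclideanSpace ℂ (Fin k)} (hz : ∀ i, pullFun Γ (vacFun n m) ⟨A i, hAS i⟩ = z i)
    {b} (hb : ∀ i, pullFun Γ (vacDer b) ⟨A i, hAS i⟩ = z i) : ‖z‖ < 1 := by
  by_contra hlt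
  rw [not_lt] at hlt
  set d : EuclideanSpace ℂ (Fin k) := WithLp.toLp 2 fun i => star (z i)
  have hd : ‖d‖ = ‖z‖ := by simp [EuclideanSpace.norm_eq, d]
  set T : S := ∑ i, d i • ⟨A i, hAS i⟩ with hT
  have hTn : ‖T‖ ≤ ‖z‖ := by
    rw [← hd]
    refine le_trans (le_of_eq ?_) (norm_sum_smul_le hA d)
    change ‖((∑ i, d i • (⟨A i, hAS i⟩ : S) : S) : Fock n m →L[ℂ] Fock n m)‖ = _
    simp
  have hsum : ∑ i, d i * z i = ((‖z‖ ^ 2 : ℝ) : ℂ) := by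
    rw [EuclideanSpace.norm_sq_eq]
    push_cast
    refine Finset.sum_congr rfl fun i _ => ?_
    rw [← Complex.conj_mul']
    rfl
  have h1 : pullFun Γ (vacFun n m) T = ((‖z‖ ^ 2 : ℝ) : ℂ) := by
    rw [hT, map_sum, ← hsum]
    exact Finset.sum_congr rfl fun i _ => by rw [map_smul, hz i, smul_eq_mul]
  have h2 : pullFun Γ (vacDer b) T = ((‖z‖ ^ 2 : ℝ) : ℂ) := by
    rw [hT, map_sum, ← hsum]
    exact Finset.sum_congr rfl fun i _ => by rw [map_smul, hb i, smul_eq_mul]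
  set ψ := (Γ T).1 (vac n m) with hψ
  have hψn : ‖ψ‖ ≤ ‖z‖ := by
    refine ((Γ T).1.le_opNorm _).trans ?_
    rw [norm_vac, mul_one]
    exact (h.norm_map T).le.trans hTn
  -- The square equals `‖ψ‖² - 2‖z‖³ + ‖z‖²`, which is at most `2‖z‖²(1 - ‖z‖)`.
  have h3 : ‖ψ - ((‖z‖ : ℝ) : ℂ) • vac n m‖ ^ 2 ≤ 0 := by
    rw [@norm_sub_sq ℂ, norm_smul, norm_vac, inner_smul_right, ← inner_conj_symm,
      show ⟪vac n m, ψ⟫_ℂ = ((‖z‖ ^ 2 : ℝ) : ℂ) from h1, Complex.conj_ofReal, ← Complex.ofReal_mul,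
      Complex.norm_real, norm_norm]
    simp only [RCLike.re_to_complex, Complex.ofReal_re, mul_one]
    nlinarith [norm_nonneg ψ, norm_nonneg z, mul_nonneg (sq_nonneg ‖z‖) (sub_nonneg.2 hlt),
      mul_self_le_mul_self (norm_nonneg ψ) hψn]
  have h4 : ψ = ((‖z‖ : ℝ) : ℂ) • vac n m := by
    rw [← sub_eq_zero, ← norm_eq_zero]
    nlinarith [norm_nonneg (ψ - ((‖z‖ : ℝ) : ℂ) • vac n m)]
  rw [pullFun_apply, ← hψ, h4, map_smul, vacDer_vac, smul_zero] at h2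
  have h5 : ‖z‖ ^ 2 = 0 := by exact_mod_cast h2.symm
  nlinarith

theorem norm_baseE_lt (h : IsIso hS hS' Γ) : ‖h.baseE‖ < 1 := by
  obtain ⟨b, hb⟩ := h.tangent_surjective (h.baseE, 0)
  refine h.norm_lt_one_of_tangent (A := shiftE) inner_shiftE (fun i => (hS.genE i).2) (b := b)
    (fun i => rfl) (fun i => ?_)
  exact (h.tangent_fst b i).symm.trans (by rw [hb])

theorem norm_baseF_lt (h : IsIso hS hS' Γ) : ‖h.baseF‖ < 1 := by
  obtain ⟨b, hb⟩ := h.tangent_surjective (0, h.baseF)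
  refine h.norm_lt_one_of_tangent (A := shiftF u) (inner_shiftF u) (fun i => (hS.genF i).2) (b := b)
    (fun i => rfl) (fun i => ?_)
  exact (h.tangent_snd b i).symm.trans (by rw [hb])

/-! ### Schwarz-Pick along curves of characters, in both directions -/

theorem exists_bound (L : StrongDual ℂ (Fock n m)) (T : Fock n m →L[ℂ] Fock n m) :
    ‖L (T (vac n m))‖ ≤ ‖L‖ * ‖T‖ := by
  refine (L.le_opNorm _).trans (mul_le_mul_of_nonneg_left ?_ (norm_nonneg _))
  have := T.le_opNorm (vac n m)
  rwa [norm_vac, mul_one] at this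

theorem norm_smul_lt {E : Type*} [NormedAddCommGroup E] [NormedSpace ℂ E] {x : E} (hx : ‖x‖ ≤ 1)
    {t : ℂ} (ht : t ∈ Metric.ball (0 : ℂ) 1) : ‖t • x‖ < 1 := by
  rw [mem_ball_zero_iff] at ht
  rw [norm_smul]
  nlinarith [norm_nonneg t, norm_nonneg x]

/-- The ray `t ↦ t b` consists of characters for `v`. Composed with `Γ` they form a holomorphic
curve of characters for `u` that starts at the base point with velocity `h.tangent b`, to which
`tangent_bound` applies. -/
theorem tangent_forward (h : IsIso hS hS' Γ) {b} (hb : FixedTensor v.1 b.1 b.2)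
    (hb1 : ‖b.1‖ ≤ 1) (hb2 : ‖b.2‖ ≤ 1) :
    FixedTensor u.1 (h.tangent b).1 (h.tangent b).2 ∧
      ‖mobiusDeriv h.baseE (h.tangent b).1‖ ≤ 1 ∧ ‖mobiusDeriv h.baseF (h.tangent b).2‖ ≤ 1 := by
  have hγ : HasDerivAt (fun t : ℂ => t • b.1) b.1 0 := by
    simpa using (hasDerivAt_id (0 : ℂ)).smul_const b.1
  have hδ : HasDerivAt (fun t : ℂ => t • b.2) b.2 0 := by
    simpa using (hasDerivAt_id (0 : ℂ)).smul_const b.2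
  have hγ1 : ∀ t ∈ Metric.ball (0 : ℂ) 1, ‖t • b.1‖ < 1 := fun t ht => norm_smul_lt hb1 ht
  have hδ1 : ∀ t ∈ Metric.ball (0 : ℂ) 1, ‖t • b.2‖ < 1 := fun t ht => norm_smul_lt hb2 ht
  obtain ⟨L', hL', hmul, hE, hF⟩ := hS'.exists_hasDerivAt hγ hδ hγ1 hδ1 (fun t _ => hb.smul t t)
  have h0 : pointFunctional v ((0 : ℂ) • b.1) ((0 : ℂ) • b.2) = vacFun n m := by
    rw [zero_smul, zero_smul, pointFunctional_zero]
  simp only [h0] at hmul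
  have hpoly : ∀ T ∈ polyAlg v, L' (T (vac n m)) = vacDer b (T (vac n m)) := fun T hT =>
    hS'.derivation_ext (χ := fun A => vacFun n m (A.1 (vac n m)))
      (D := (coeff L' (vac n m)).comp S'.val.toLinearMap)
      (D' := (coeff (vacDer b) (vac n m)).comp S'.val.toLinearMap) vacFun_vac hmul
      (fun A B => hS'.vacDer_mul b A.2 (B.1 (vac n m)))
      (fun i => (hE i).trans (by
        change _ = vacDer b (shiftE i (vac n m))
        rw [vacDer_shiftE, vacFun_vac, mul_one]))
      (fun j => (hF j).trans (by
        change _ = vacDer b (shiftF v j (vac n m))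
        rw [vacDer_shiftF, vacFun_vac, mul_one])) hT
  -- The derivative of the curve of evaluations and `vacDer b` are derivations at the vacuum with
  -- the same values on the shifts; the agreement extends to the closure.
  have hall : ∀ A : S', L' (A.1 (vac n m)) = vacDer b (A.1 (vac n m)) := fun A => by
    have := hS'.ext (coeff L' (vac n m) - coeff (vacDer b) (vac n m))
      (sub_mem (coeff_mem _ _) (coeff_mem _ _))
      (fun T hT => by simp [hpoly T hT]) A.1 A.2
    simpa [sub_eq_zero] using this
  refine hS.tangent_bound (L := fun t => pointFunctional v (t • b.1) (t • b.2))
    (fun T => (Γ T).1 (vac n m)) ?_ ?_ hL' ?_ ?_ (fun i => hall _) (fun j => hall _)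
    h.norm_baseE_lt h.norm_baseF_lt h.fixedTensor_baseE h.fixedTensor_baseF
  · intro t ht
    obtain ⟨χ, hχ⟩ := hS'.exists_character (hγ1 t ht) (hδ1 t ht) (hb.smul t t)
    refine ⟨χ.comp Γ.toAlgHom, ⟨‖pointFunctional v (t • b.1) (t • b.2)‖, fun T => ?_⟩,
      fun T => hχ (Γ T)⟩
    change ‖χ (Γ T)‖ ≤ _
    rw [hχ, ← h.norm_map T]
    exact exists_bound _ _
  · intro t ht
    exact differentiableAt_pointFunctional v (by fun_prop) (by fun_prop) (hγ1 t ht) (hδ1 t ht)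
  · intro i
    simp only [h0]
    rfl
  · intro j
    simp only [h0]
    rfl

/-- A straight ray from the base point need not stay in the ball as long as required, so the
extremal curve of `hasDerivAt_mobius_ray` is used in each factor and transported by the inverse of
`Γ`. There the base point is the origin, where `mobiusDeriv` is the identity. -/
theorem tangent_backward (h : IsIso hS hS' Γ) {b}
    (hb : FixedTensor u.1 (h.tangent b).1 (h.tangent b).2)
    (hb1 : ‖mobiusDeriv h.baseE (h.tangent b).1‖ ≤ 1)
    (hb2 : ‖mobiusDeriv h.baseF (h.tangent b).2‖ ≤ 1) :
    FixedTensor v.1 b.1 b.2 ∧ ‖b.1‖ ≤ 1 ∧ ‖b.2‖ ≤ 1 := by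
  set γ : ℂ → EuclideanSpace ℂ (Fin n) := fun t =>
    mobius h.baseE (-(t • mobiusDeriv h.baseE (h.tangent b).1)) with hγdef
  set δ : ℂ → EuclideanSpace ℂ (Fin m) := fun t =>
    mobius h.baseF (-(t • mobiusDeriv h.baseF (h.tangent b).2)) with hδdef
  have hγ : HasDerivAt γ (h.tangent b).1 0 := hasDerivAt_mobius_ray h.norm_baseE_lt _
  have hδ : HasDerivAt δ (h.tangent b).2 0 := hasDerivAt_mobius_ray h.norm_baseF_lt _
  have hγ1 : ∀ t ∈ Metric.ball (0 : ℂ) 1, ‖γ t‖ < 1 := fun t ht =>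
    norm_mobius_lt h.norm_baseE_lt (by rw [norm_neg]; exact norm_smul_lt hb1 ht)
  have hδ1 : ∀ t ∈ Metric.ball (0 : ℂ) 1, ‖δ t‖ < 1 := fun t ht =>
    norm_mobius_lt h.norm_baseF_lt (by rw [norm_neg]; exact norm_smul_lt hb2 ht)
  -- Each curve lies in the span of its tangent vector and its base vector. The product of the
  -- tangent parts is fixed by `hb`, and every term with a base vector is fixed by the linearized
  -- relations.
  have hf : ∀ t ∈ Metric.ball (0 : ℂ) 1, FixedTensor u.1 (γ t) (δ t) := by
    intro t _
    obtain ⟨a, a', e⟩ := exists_mobius_eq h.baseE (h.tangent b).1 t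
    obtain ⟨c, c', e'⟩ := exists_mobius_eq h.baseF (h.tangent b).2 t
    rw [hγdef, hδdef]
    simp only [e, e']
    have hl : ∀ y, FixedTensor u.1 (a' • h.baseE) y := fun y => by
      have := (h.fixedTensor_baseE y).smul a' 1
      rwa [one_smul] at this
    have hr : ∀ x, FixedTensor u.1 x (c' • h.baseF) := fun x => by
      have := (h.fixedTensor_baseF x).smul 1 c'
      rwa [one_smul] at this
    exact ((hb.smul a c).add_right (hr _)).add_left (hl _)
  have hγ0 : γ 0 = h.baseE := by simp [hγdef, mobius_zero]
  have hδ0 : δ 0 = h.baseF := by simp [hδdef, mobius_zero]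
  obtain ⟨L', hL', hmul, hE, hF⟩ := hS.exists_hasDerivAt hγ hδ hγ1 hδ1 hf
  have hball : (0 : ℂ) ∈ Metric.ball (0 : ℂ) 1 := Metric.mem_ball_self one_pos
  -- Evaluation at the base point and the pullback of the vacuum are characters with the same values
  -- on the shifts.
  have h0 : ∀ A : S, pointFunctional u (γ 0) (δ 0) (A.1 (vac n m)) =
      vacFun n m ((Γ A).1 (vac n m)) := by
    refine h.ext _ _ fun T hT => ?_
    obtain ⟨χ, hχ⟩ := hS.exists_character (hγ1 0 hball) (hδ1 0 hball) (hf 0 hball)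
    obtain ⟨χ', hχ'⟩ := hS'.exists_character (z := 0) (w := 0) (by simp) (by simp)
      (fixedTensor_zero_left _ _)
    have hv := pointFunctional_vac u (hγ1 0 hball) (hδ1 0 hball)
    have := hS.character_ext (χ := χ) (χ' := χ'.comp Γ.toAlgHom) (fun i => ?_) (fun j => ?_) hT
    · rw [hχ] at this
      refine this.trans ((hχ' _).trans ?_)
      rw [pointFunctional_zero]
      rfl
    · rw [hχ]
      refine Eq.trans ?_ (hχ' (Γ (hS.genE i))).symm
      rw [pointFunctional_zero]
      change pointFunctional u (γ 0) (δ 0) (shiftE i (vac n m)) = _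
      rw [pointFunctional_shiftE u (hγ1 0 hball) (hδ1 0 hball), hv, mul_one, hγ0]
      rfl
    · rw [hχ]
      refine Eq.trans ?_ (hχ' (Γ (hS.genF j))).symm
      rw [pointFunctional_zero]
      change pointFunctional u (γ 0) (δ 0) (shiftF u j (vac n m)) = _
      rw [pointFunctional_shiftF u (hγ1 0 hball) (hδ1 0 hball) (hf 0 hball), hv, mul_one, hδ0]
      rfl
  simp only [h0] at hmul
  have hall : ∀ A : S, L' (A.1 (vac n m)) = vacDer b ((Γ A).1 (vac n m)) :=
    h.ext _ _ fun T hT =>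
      hS.derivation_ext (χ := pullFun Γ (vacFun n m))
        (D := (coeff L' (vac n m)).comp S.val.toLinearMap)
        (D' := pullFun Γ (vacDer b)) h.pullFun_vacFun_one hmul (h.pullFun_vacDer_mul b)
        (fun i => hE i) (fun j => hF j) hT
  have hsymm : ∀ A : S', L' ((Γ.symm A).1 (vac n m)) = vacDer b (A.1 (vac n m)) := fun A => by
    rw [hall, Γ.apply_symm_apply]
  have h0' : ∀ A : S', pointFunctional u (γ 0) (δ 0) ((Γ.symm A).1 (vac n m)) =
      vacFun n m (A.1 (vac n m)) := fun A => by
    rw [h0, Γ.apply_symm_apply]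
  have key := hS'.tangent_bound (L := fun t => pointFunctional u (γ t) (δ t))
    (fun T => (Γ.symm T).1 (vac n m)) ?_ ?_ hL' (z := 0) (w := 0) (x := b.1) (y := b.2)
    (fun i => (h0' _).trans (vacFun_shiftE i _)) (fun j => (h0' _).trans (vacFun_shiftF v j _))
    (fun i => (hsymm _).trans ((vacDer_shiftE b i _).trans (by rw [vacFun_vac, mul_one])))
    (fun j => (hsymm _).trans ((vacDer_shiftF v b j _).trans (by rw [vacFun_vac, mul_one])))
    (by simp) (by simp) (fixedTensor_zero_left _) (fixedTensor_zero_right _)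
  · rwa [mobiusDeriv_zero, mobiusDeriv_zero] at key
  · intro t ht
    obtain ⟨χ, hχ⟩ := hS.exists_character (hγ1 t ht) (hδ1 t ht) (hf t ht)
    refine ⟨χ.comp Γ.symm.toAlgHom, ⟨‖pointFunctional u (γ t) (δ t)‖, fun T => ?_⟩,
      fun T => hχ (Γ.symm T)⟩
    change ‖χ (Γ.symm T)‖ ≤ _
    have hn : ‖Γ.symm T‖ = ‖T‖ := by rw [← h.norm_map (Γ.symm T), Γ.apply_symm_apply]
    rw [hχ, ← hn]
    exact exists_bound _ _
  · intro t ht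
    refine differentiableAt_pointFunctional u ?_ ?_ (hγ1 t ht) (hδ1 t ht)
    · exact differentiableAt_mobius h.norm_baseE_lt
        (by rw [norm_neg]; exact (norm_smul_lt hb1 ht).le) (by fun_prop)
    · exact differentiableAt_mobius h.norm_baseF_lt
        (by rw [norm_neg]; exact (norm_smul_lt hb2 ht).le) (by fun_prop)

end IsIso

/-! ### Matrices of linear maps between Euclidean spaces -/

/-- The matrix of a linear map in the standard bases. -/
def stdMatrix {k l : ℕ} (f : EuclideanSpace ℂ (Fin k) →ₗ[ℂ] EuclideanSpace ℂ (Fin l)) :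
    Matrix (Fin l) (Fin k) ℂ :=
  Matrix.of fun i r => f (EuclideanSpace.single r 1) i

theorem stdMatrix_apply {k l : ℕ} (f : EuclideanSpace ℂ (Fin k) →ₗ[ℂ] EuclideanSpace ℂ (Fin l))
    (i : Fin l) (r : Fin k) : stdMatrix f i r = f (EuclideanSpace.single r 1) i := rfl

theorem apply_eq_sum_stdMatrix {k l : ℕ}
    (f : EuclideanSpace ℂ (Fin k) →ₗ[ℂ] EuclideanSpace ℂ (Fin l)) (x : EuclideanSpace ℂ (Fin k))
    (i : Fin l) : f x i = ∑ r, stdMatrix f i r * x r := by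
  have hx : x = ∑ r, x r • EuclideanSpace.single r (1 : ℂ) := by
    ext s
    simp [Pi.single_apply]
  conv_lhs => rw [hx]
  rw [map_sum]
  simp [stdMatrix_apply, mul_comm]

theorem stdMatrix_comp {k l r : ℕ} (g : EuclideanSpace ℂ (Fin l) →ₗ[ℂ] EuclideanSpace ℂ (Fin r))
    (f : EuclideanSpace ℂ (Fin k) →ₗ[ℂ] EuclideanSpace ℂ (Fin l)) :
    stdMatrix (g ∘ₗ f) = stdMatrix g * stdMatrix f := by
  ext i s
  rw [stdMatrix_apply, LinearMap.comp_apply, apply_eq_sum_stdMatrix, Matrix.mul_apply]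
  rfl

theorem stdMatrix_mem_unitaryGroup {k : ℕ}
    {f : EuclideanSpace ℂ (Fin k) →ₗ[ℂ] EuclideanSpace ℂ (Fin k)} (hf : ∀ x, ‖f x‖ = ‖x‖) :
    stdMatrix f ∈ Matrix.unitaryGroup (Fin k) ℂ := by
  rw [Matrix.mem_unitaryGroup_iff']
  ext r s
  have h := (LinearIsometry.mk f hf).inner_map_map (EuclideanSpace.single r (1 : ℂ))
    (EuclideanSpace.single s 1)
  simp only [Matrix.mul_apply, Matrix.star_apply, stdMatrix_apply, Matrix.one_apply]
  rw [EuclideanSpace.inner_single_left] at h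
  simp only [LinearIsometry.coe_mk, map_one, one_mul, PiLp.single_apply] at h
  rw [← h, PiLp.inner_apply]
  simp [mul_comm]

theorem stdMatrix_mobiusDeriv {k : ℕ} (z : EuclideanSpace ℂ (Fin k)) :
    stdMatrix (mobiusDeriv z) = (defect z : ℂ)⁻¹ • (1 +
      ((defect z : ℂ) * (1 + defect z))⁻¹ • Matrix.of fun i r => z i * star (z r)) := by
  ext i r
  simp [stdMatrix_apply, mobiusDeriv_apply, EuclideanSpace.inner_single_right, PiLp.single_apply,
    Matrix.one_apply]
  split_ifs <;> ring

/-- A Hermitian matrix whose columns are fixed by a unitary commutes with it. -/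
theorem mul_comm_of_mul_eq_self {ι : Type*} [Fintype ι] [DecidableEq ι]
    (u : Matrix.unitaryGroup ι ℂ) {K : Matrix ι ι ℂ} (hK : star K = K) (h : u.1 * K = K) :
    K * u.1 = u.1 * K := by
  have h1 : star u.1 * K = K := by
    conv_lhs => rw [← h]
    rw [← mul_assoc, Matrix.mem_unitaryGroup_iff'.1 u.2, one_mul]
  have h2 := congrArg star h1
  rw [star_mul, star_star, hK] at h2
  rw [h, h2]

/-- The matrix of `mobiusDeriv z` is a combination of `1` and `z z*`, and the columns of `z z* ⊗ 1`
are multiples of vectors `z ⊗ f_s`, which `u` fixes. -/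
theorem kronecker_one_comm {u : Matrix.unitaryGroup (Fin n × Fin m) ℂ}
    {z : EuclideanSpace ℂ (Fin n)} (hz : ∀ y, FixedTensor u.1 z y) :
    (stdMatrix (mobiusDeriv z) ⊗ₖ (1 : Matrix (Fin m) (Fin m) ℂ)) * u.1 =
      u.1 * (stdMatrix (mobiusDeriv z) ⊗ₖ (1 : Matrix (Fin m) (Fin m) ℂ)) := by
  set K : Matrix (Fin n × Fin m) (Fin n × Fin m) ℂ :=
    (Matrix.of fun i r => z i * star (z r)) ⊗ₖ (1 : Matrix (Fin m) (Fin m) ℂ) with hKdef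
  have hK : star K = K := by
    ext ⟨i, j⟩ ⟨r, s⟩
    simp only [hKdef, Matrix.star_apply, Matrix.kronecker_apply, Matrix.of_apply, Matrix.one_apply]
    by_cases h : s = j
    · simp [h, mul_comm]
    · simp [h, Ne.symm h]
  have huK : u.1 * K = K := by
    ext ⟨i, j⟩ ⟨r, s⟩
    have := hz (EuclideanSpace.single s 1) i j
    simp only [hKdef, Matrix.mul_apply, Matrix.kronecker_apply, Matrix.of_apply, Matrix.one_apply,
      Fintype.sum_prod_type]
    simp only [PiLp.single_apply] at this
    rw [mul_right_comm, ← this, Finset.sum_mul]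
    refine Finset.sum_congr rfl fun k _ => ?_
    rw [Finset.sum_mul]
    exact Finset.sum_congr rfl fun l _ => by ring
  have := mul_comm_of_mul_eq_self u hK huK
  rw [stdMatrix_mobiusDeriv, Matrix.smul_kronecker, Matrix.add_kronecker, Matrix.smul_kronecker,
    Matrix.one_kronecker_one, ← hKdef]
  simp only [Matrix.smul_mul, Matrix.mul_smul, Matrix.add_mul, Matrix.mul_add, Matrix.one_mul,
    Matrix.mul_one, this]

theorem one_kronecker_comm {u : Matrix.unitaryGroup (Fin n × Fin m) ℂ}
    {w : EuclideanSpace ℂ (Fin m)} (hw : ∀ x, FixedTensor u.1 x w) :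
    ((1 : Matrix (Fin n) (Fin n) ℂ) ⊗ₖ stdMatrix (mobiusDeriv w)) * u.1 =
      u.1 * ((1 : Matrix (Fin n) (Fin n) ℂ) ⊗ₖ stdMatrix (mobiusDeriv w)) := by
  set K : Matrix (Fin n × Fin m) (Fin n × Fin m) ℂ :=
    (1 : Matrix (Fin n) (Fin n) ℂ) ⊗ₖ (Matrix.of fun i r => w i * star (w r)) with hKdef
  have hK : star K = K := by
    ext ⟨i, j⟩ ⟨r, s⟩
    simp only [hKdef, Matrix.star_apply, Matrix.kronecker_apply, Matrix.of_apply, Matrix.one_apply]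
    by_cases h : r = i
    · simp [h, mul_comm]
    · simp [h, Ne.symm h]
  have huK : u.1 * K = K := by
    ext ⟨i, j⟩ ⟨r, s⟩
    have := hw (EuclideanSpace.single r 1) i j
    simp only [hKdef, Matrix.mul_apply, Matrix.kronecker_apply, Matrix.of_apply, Matrix.one_apply,
      Fintype.sum_prod_type]
    simp only [PiLp.single_apply] at this
    rw [← mul_assoc, ← this, Finset.sum_mul]
    refine Finset.sum_congr rfl fun k _ => ?_
    rw [Finset.sum_mul]
    exact Finset.sum_congr rfl fun l _ => by ring
  have := mul_comm_of_mul_eq_self u hK huK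
  rw [stdMatrix_mobiusDeriv, Matrix.kronecker_smul, Matrix.kronecker_add, Matrix.kronecker_smul,
    Matrix.one_kronecker_one, ← hKdef]
  simp only [Matrix.smul_mul, Matrix.mul_smul, Matrix.add_mul, Matrix.mul_add, Matrix.one_mul,
    Matrix.mul_one, this]

theorem kronecker_mobiusDeriv_comm {u : Matrix.unitaryGroup (Fin n × Fin m) ℂ}
    {z : EuclideanSpace ℂ (Fin n)} {w : EuclideanSpace ℂ (Fin m)}
    (hz : ∀ y, FixedTensor u.1 z y) (hw : ∀ x, FixedTensor u.1 x w) :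
    (stdMatrix (mobiusDeriv z) ⊗ₖ stdMatrix (mobiusDeriv w)) * u.1 =
      u.1 * (stdMatrix (mobiusDeriv z) ⊗ₖ stdMatrix (mobiusDeriv w)) := by
  have e : stdMatrix (mobiusDeriv z) ⊗ₖ stdMatrix (mobiusDeriv w) =
      (stdMatrix (mobiusDeriv z) ⊗ₖ (1 : Matrix (Fin m) (Fin m) ℂ)) *
        ((1 : Matrix (Fin n) (Fin n) ℂ) ⊗ₖ stdMatrix (mobiusDeriv w)) := by
    rw [← Matrix.mul_kronecker_mul, mul_one, one_mul]
  rw [e, mul_assoc, one_kronecker_comm hw, ← mul_assoc, kronecker_one_comm hz, mul_assoc]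

theorem matrix_eq_of_mulVec {ι κ : Type*} [Fintype κ] [DecidableEq κ] {A B : Matrix ι κ ℂ}
    (h : ∀ c, A.mulVec c = B.mulVec c) : A = B :=
  Matrix.toLin'.injective (LinearMap.ext h)

/-! ### From isomorphisms to product unitary equivalence -/

namespace IsIso

variable {u v : Matrix.unitaryGroup (Fin n × Fin m) ℂ}
  {S S' : Subalgebra ℂ (Fock n m →L[ℂ] Fock n m)} {hS : IsApprox u S} {hS' : IsApprox v S'}
  {Γ : S ≃ₐ[ℂ] S'}

/-- The tangent map, normalized by the invariant metric. -/
def normalized (h : IsIso hS hS' Γ) : (EuclideanSpace ℂ (Fin n) × EuclideanSpace ℂ (Fin m)) →ₗ[ℂ]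
    (EuclideanSpace ℂ (Fin n) × EuclideanSpace ℂ (Fin m)) :=
  (mobiusDeriv h.baseE).prodMap (mobiusDeriv h.baseF) ∘ₗ h.tangent

theorem normalized_apply (h : IsIso hS hS' Γ) (b) : h.normalized b =
    (mobiusDeriv h.baseE (h.tangent b).1, mobiusDeriv h.baseF (h.tangent b).2) := rfl

theorem normalized_eq_zero (h : IsIso hS hS' Γ) {b} (hb : h.normalized b = 0) : b = 0 := by
  rw [normalized_apply, Prod.mk_eq_zero] at hb
  apply h.tangent_injective
  rw [map_zero]
  refine Prod.ext (mobiusDeriv_injective h.norm_baseE_lt ?_)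
    (mobiusDeriv_injective h.norm_baseF_lt ?_)
  · rw [hb.1, Prod.fst_zero, map_zero]
  · rw [hb.2, Prod.snd_zero, map_zero]

theorem FixedTensor.of_smul {u : Matrix (Fin n × Fin m) (Fin n × Fin m) ℂ} {c : ℂ} (hc : c ≠ 0)
    {x : EuclideanSpace ℂ (Fin n)} {y : EuclideanSpace ℂ (Fin m)}
    (h : FixedTensor u (c • x) (c • y)) : FixedTensor u x y := by
  have := h.smul c⁻¹ c⁻¹
  rwa [inv_smul_smul₀ hc, inv_smul_smul₀ hc] at this

/-- The homogeneous form of `tangent_forward`, obtained by scaling `b` to norm one; the norm on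
pairs is the maximum of the two norms. -/
theorem forward (h : IsIso hS hS' Γ) {b} (hb : FixedTensor v.1 b.1 b.2) :
    FixedTensor u.1 (h.tangent b).1 (h.tangent b).2 ∧ ‖h.normalized b‖ ≤ ‖b‖ := by
  rcases eq_or_ne b 0 with rfl | hb0
  · simp only [map_zero]
    exact ⟨fixedTensor_zero_left _ _, le_rfl⟩
  have hr : 0 < ‖b‖ := norm_pos_iff.2 hb0
  have hc : ((‖b‖⁻¹ : ℝ) : ℂ) ≠ 0 := Complex.ofReal_ne_zero.2 (inv_pos.2 hr).ne'
  have hn : ‖((‖b‖⁻¹ : ℝ) : ℂ) • b‖ ≤ 1 := by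
    rw [norm_smul, Complex.norm_real, norm_inv, norm_norm, inv_mul_cancel₀ hr.ne']
  have key := h.tangent_forward (b := ((‖b‖⁻¹ : ℝ) : ℂ) • b) (hb.smul _ _)
    ((norm_fst_le _).trans hn) ((norm_snd_le _).trans hn)
  have hle : ‖h.normalized (((‖b‖⁻¹ : ℝ) : ℂ) • b)‖ ≤ 1 := by
    rw [normalized_apply, Prod.norm_def]
    exact max_le key.2.1 key.2.2
  rw [map_smul, norm_smul, Complex.norm_real, norm_inv, norm_norm, inv_mul_le_iff₀ hr,
    mul_one] at hle
  refine ⟨?_, hle⟩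
  have := key.1
  rw [map_smul] at this
  exact FixedTensor.of_smul hc this

theorem backward (h : IsIso hS hS' Γ) {b}
    (hb : FixedTensor u.1 (h.tangent b).1 (h.tangent b).2) :
    FixedTensor v.1 b.1 b.2 ∧ ‖b‖ ≤ ‖h.normalized b‖ := by
  rcases eq_or_ne b 0 with rfl | hb0
  · simp only [map_zero]
    exact ⟨fixedTensor_zero_left _ _, le_rfl⟩
  have hr : 0 < ‖h.normalized b‖ := norm_pos_iff.2 fun e => hb0 (h.normalized_eq_zero e)
  set r := ‖h.normalized b‖ with hrdef
  have hc : ((r⁻¹ : ℝ) : ℂ) ≠ 0 := Complex.ofReal_ne_zero.2 (inv_pos.2 hr).ne'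
  have hn : ‖h.normalized (((r⁻¹ : ℝ) : ℂ) • b)‖ ≤ 1 := by
    rw [map_smul, norm_smul, Complex.norm_real, norm_inv, ← hrdef, Real.norm_of_nonneg hr.le,
      inv_mul_cancel₀ hr.ne']
  have key := h.tangent_backward (b := ((r⁻¹ : ℝ) : ℂ) • b)
    (by rw [map_smul]; exact hb.smul _ _) ((norm_fst_le _).trans hn) ((norm_snd_le _).trans hn)
  have hle : ‖((r⁻¹ : ℝ) : ℂ) • b‖ ≤ 1 := by
    rw [Prod.norm_def]
    exact max_le key.2.1 key.2.2
  rw [norm_smul, Complex.norm_real, norm_inv, Real.norm_of_nonneg hr.le, inv_mul_le_iff₀ hr,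
    mul_one] at hle
  exact ⟨FixedTensor.of_smul hc key.1, hle⟩

theorem norm_eq_of_fixedTensor (h : IsIso hS hS' Γ) {b}
    (hb : FixedTensor u.1 (h.tangent b).1 (h.tangent b).2) : ‖b‖ = ‖h.normalized b‖ :=
  le_antisymm (h.backward hb).2 (h.forward (h.backward hb).1).2

/-- With `p ⊗ q` also every `s p ⊗ t q` is fixed, so the norm is preserved on the whole plane of
pairs `(s p, t q)`. Its preimage is thus a copy of `ℓ^∞(2)`, whose two generators must lie in
different summands. -/
theorem components_ne_zero (h : IsIso hS hS' Γ) {b}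
    (hb : FixedTensor u.1 (h.tangent b).1 (h.tangent b).2) (h1 : (h.tangent b).1 ≠ 0)
    (h2 : (h.tangent b).2 ≠ 0) : b.1 ≠ 0 ∧ b.2 ≠ 0 := by
  set p := (h.tangent b).1
  set q := (h.tangent b).2
  obtain ⟨a, ha⟩ := h.tangent_surjective (p, 0)
  obtain ⟨d, hd⟩ := h.tangent_surjective (0, q)
  have hab : b = a + d := by
    apply h.tangent_injective
    rw [map_add, ha, hd, Prod.mk_add_mk, add_zero, zero_add]
  have hp : 0 < ‖mobiusDeriv h.baseE p‖ :=
    norm_pos_iff.2 fun e => h1 (mobiusDeriv_injective h.norm_baseE_lt (e.trans (map_zero _).symm))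
  have hq : 0 < ‖mobiusDeriv h.baseF q‖ :=
    norm_pos_iff.2 fun e => h2 (mobiusDeriv_injective h.norm_baseF_lt (e.trans (map_zero _).symm))
  rw [hab]
  refine components_ne_zero_of_norm_smul_add hp hq fun s t => ?_
  have ht : h.tangent (s • a + t • d) = (s • p, t • q) := by
    rw [map_add, map_smul, map_smul, ha, hd]
    simp
  rw [h.norm_eq_of_fixedTensor (by rw [ht]; exact hb.smul s t), normalized_apply, ht,
    Prod.norm_def, map_smul, map_smul, norm_smul, norm_smul]

/-- In the second order Leibniz rule, the terms other than `quadForm` form the linearized relation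
at the base point, which holds for arbitrary vectors. They cancel, even though the base point need
not be the origin. -/
theorem quad_relation (h : IsIso hS hS' Γ) (c : Fin n × Fin m → ℂ) (i : Fin n) (j : Fin m) :
    quadForm v c ((Γ (hS.genF j)).1 (vac n m)) ((Γ (hS.genE i)).1 (vac n m)) =
      ∑ k, ∑ l, u.1 (i, j) (k, l) *
        quadForm v c ((Γ (hS.genE k)).1 (vac n m)) ((Γ (hS.genF l)).1 (vac n m)) := by
  have h1 := map_genE_mul_genF hS (pullFun Γ (quadFun v c)) i j
  have h2 := h.linearized_relation (WithLp.toLp 2 fun i => pullFun Γ (quadFun v c) (hS.genE i))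
    (WithLp.toLp 2 fun j => pullFun Γ (quadFun v c) (hS.genF j)) i j
  simp only [h.pullFun_quadFun_mul] at h1
  simp only [baseE, baseF] at h2
  have h3 : ∑ k, ∑ l, u.1 (i, j) (k, l) * (pullFun Γ (vacFun n m) (hS.genF l) *
      pullFun Γ (quadFun v c) (hS.genE k) +
        quadForm v c ((Γ (hS.genE k)).1 (vac n m)) ((Γ (hS.genF l)).1 (vac n m)) +
        pullFun Γ (quadFun v c) (hS.genF l) * pullFun Γ (vacFun n m) (hS.genE k)) =
      (∑ k, ∑ l, u.1 (i, j) (k, l) * (pullFun Γ (vacFun n m) (hS.genE k) *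
        pullFun Γ (quadFun v c) (hS.genF l) +
          pullFun Γ (quadFun v c) (hS.genE k) * pullFun Γ (vacFun n m) (hS.genF l))) +
      ∑ k, ∑ l, u.1 (i, j) (k, l) *
        quadForm v c ((Γ (hS.genE k)).1 (vac n m)) ((Γ (hS.genF l)).1 (vac n m)) := by
    simp only [← Finset.sum_add_distrib]
    exact Finset.sum_congr rfl fun k _ => Finset.sum_congr rfl fun l _ => by ring
  rw [h3, h2] at h1
  linear_combination h1

/-! ### The block structure of the tangent map -/

/-- The block of the tangent map from the `E`-part to itself. -/
def blockEE (h : IsIso hS hS' Γ) : EuclideanSpace ℂ (Fin n) →ₗ[ℂ] EuclideanSpace ℂ (Fin n) :=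
  LinearMap.fst ℂ _ _ ∘ₗ h.tangent ∘ₗ LinearMap.inl ℂ _ _

/-- The block of the tangent map from the `E`-part to the `F`-part. -/
def blockFE (h : IsIso hS hS' Γ) : EuclideanSpace ℂ (Fin n) →ₗ[ℂ] EuclideanSpace ℂ (Fin m) :=
  LinearMap.snd ℂ _ _ ∘ₗ h.tangent ∘ₗ LinearMap.inl ℂ _ _

/-- The block of the tangent map from the `F`-part to the `E`-part. -/
def blockEF (h : IsIso hS hS' Γ) : EuclideanSpace ℂ (Fin m) →ₗ[ℂ] EuclideanSpace ℂ (Fin n) :=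
  LinearMap.fst ℂ _ _ ∘ₗ h.tangent ∘ₗ LinearMap.inr ℂ _ _

/-- The block of the tangent map from the `F`-part to itself. -/
def blockFF (h : IsIso hS hS' Γ) : EuclideanSpace ℂ (Fin m) →ₗ[ℂ] EuclideanSpace ℂ (Fin m) :=
  LinearMap.snd ℂ _ _ ∘ₗ h.tangent ∘ₗ LinearMap.inr ℂ _ _

theorem tangent_inl (h : IsIso hS hS' Γ) (x : EuclideanSpace ℂ (Fin n)) :
    h.tangent (x, 0) = (h.blockEE x, h.blockFE x) := rfl

theorem tangent_inr (h : IsIso hS hS' Γ) (y : EuclideanSpace ℂ (Fin m)) :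
    h.tangent (0, y) = (h.blockEF y, h.blockFF y) := rfl

theorem vacDer_inl_single (r : Fin n) (x : Fock n m) :
    vacDer (EuclideanSpace.single r 1, 0) x = coordE r x := by
  simp [vacDer_apply, PiLp.single_apply]

theorem vacDer_inr_single (r : Fin m) (x : Fock n m) :
    vacDer (0, EuclideanSpace.single r 1) x = coordF r x := by
  simp [vacDer_apply, PiLp.single_apply]

theorem coordE_genE (h : IsIso hS hS' Γ) (r i : Fin n) :
    coordE r ((Γ (hS.genE i)).1 (vac n m)) = stdMatrix h.blockEE i r :=
  (vacDer_inl_single _ _).symm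

theorem coordE_genF (h : IsIso hS hS' Γ) (r : Fin n) (j : Fin m) :
    coordE r ((Γ (hS.genF j)).1 (vac n m)) = stdMatrix h.blockFE j r :=
  (vacDer_inl_single _ _).symm

theorem coordF_genE (h : IsIso hS hS' Γ) (t : Fin m) (i : Fin n) :
    coordF t ((Γ (hS.genE i)).1 (vac n m)) = stdMatrix h.blockEF i t :=
  (vacDer_inr_single _ _).symm

theorem coordF_genF (h : IsIso hS hS' Γ) (t j : Fin m) :
    coordF t ((Γ (hS.genF j)).1 (vac n m)) = stdMatrix h.blockFF j t :=
  (vacDer_inr_single _ _).symm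

theorem fixedTensor_tangent_inl (h : IsIso hS hS' Γ) (x : EuclideanSpace ℂ (Fin n)) :
    FixedTensor u.1 (h.tangent (x, 0)).1 (h.tangent (x, 0)).2 :=
  (h.forward (b := (x, 0)) (fixedTensor_zero_right v.1 x)).1

theorem fixedTensor_tangent_inr (h : IsIso hS hS' Γ) (y : EuclideanSpace ℂ (Fin m)) :
    FixedTensor u.1 (h.tangent (0, y)).1 (h.tangent (0, y)).2 :=
  (h.forward (b := (0, y)) (fixedTensor_zero_left v.1 y)).1

/-- The image of `(x, 0)` is a fixed tensor pair. If both its components were nonzero,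
`components_ne_zero` would make the second component of `(x, 0)` nonzero. -/
theorem blocks_inl (h : IsIso hS hS' Γ) : h.blockEE = 0 ∨ h.blockFE = 0 := by
  refine eq_zero_or_eq_zero_of_forall _ _ fun x => ?_
  by_contra! hne
  exact (h.components_ne_zero (h.fixedTensor_tangent_inl x) hne.1 hne.2).2 rfl

theorem blocks_inr (h : IsIso hS hS' Γ) : h.blockEF = 0 ∨ h.blockFF = 0 := by
  refine eq_zero_or_eq_zero_of_forall _ _ fun x => ?_
  by_contra! hne
  exact (h.components_ne_zero (h.fixedTensor_tangent_inr x) hne.1 hne.2).1 rfl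

theorem norm_inl (h : IsIso hS hS' Γ) (x : EuclideanSpace ℂ (Fin n)) :
    max ‖mobiusDeriv h.baseE (h.blockEE x)‖ ‖mobiusDeriv h.baseF (h.blockFE x)‖ = ‖x‖ := by
  have := h.norm_eq_of_fixedTensor (h.fixedTensor_tangent_inl x)
  rw [normalized_apply, tangent_inl, Prod.norm_def, Prod.norm_def] at this
  simpa using this.symm

theorem norm_inr (h : IsIso hS hS' Γ) (y : EuclideanSpace ℂ (Fin m)) :
    max ‖mobiusDeriv h.baseE (h.blockEF y)‖ ‖mobiusDeriv h.baseF (h.blockFF y)‖ = ‖y‖ := by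
  have := h.norm_eq_of_fixedTensor (h.fixedTensor_tangent_inr y)
  rw [normalized_apply, tangent_inr, Prod.norm_def, Prod.norm_def] at this
  simpa using this.symm

theorem productUnitaryEquivalent_of_diagonal (h : IsIso hS hS' Γ) (h1 : h.blockFE = 0)
    (h2 : h.blockEF = 0) : ProductUnitaryEquivalent u.1 v.1 := by
  have key : (stdMatrix h.blockEE ⊗ₖ stdMatrix h.blockFF) * v.1 =
      u.1 * (stdMatrix h.blockEE ⊗ₖ stdMatrix h.blockFF) := by
    refine matrix_eq_of_mulVec fun c => ?_
    rw [← Matrix.mulVec_mulVec, ← Matrix.mulVec_mulVec]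
    funext ⟨i, j⟩
    have e := h.quad_relation c i j
    simp only [quadForm_apply, h.coordE_genE, h.coordE_genF, h.coordF_genE, h.coordF_genF, h1, h2,
      show ∀ a b, stdMatrix (0 : EuclideanSpace ℂ (Fin n) →ₗ[ℂ] EuclideanSpace ℂ (Fin m)) a b = 0
        from fun _ _ => rfl,
      show ∀ a b, stdMatrix (0 : EuclideanSpace ℂ (Fin m) →ₗ[ℂ] EuclideanSpace ℂ (Fin n)) a b = 0
        from fun _ _ => rfl, mul_zero, add_zero, zero_add] at e
    rw [Matrix.mulVec, Matrix.mulVec, dotProduct, dotProduct, Fintype.sum_prod_type (f := fun a =>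
      u.1 (i, j) a * ((stdMatrix h.blockEE ⊗ₖ stdMatrix h.blockFF).mulVec c) a)]
    refine Eq.trans ?_ (e.trans ?_)
    · exact Finset.sum_congr rfl fun a _ => by rw [Matrix.kronecker_apply]; ring
    · refine Finset.sum_congr rfl fun k _ => Finset.sum_congr rfl fun l _ => ?_
      rw [Matrix.mulVec, dotProduct]
      congr 1
      exact Finset.sum_congr rfl fun a _ => by rw [Matrix.kronecker_apply]; ring
  -- The blocks preserve norms only after composition with the derivatives of the involutions; the
  -- intertwining identity survives because these factors commute with `u`.
  refine ⟨stdMatrix (mobiusDeriv h.baseE ∘ₗ h.blockEE), stdMatrix_mem_unitaryGroup fun x => ?_,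
    stdMatrix (mobiusDeriv h.baseF ∘ₗ h.blockFF), stdMatrix_mem_unitaryGroup fun y => ?_, ?_⟩
  · rw [← h.norm_inl x, h1]
    simp
  · rw [← h.norm_inr y, h2]
    simp
  · rw [stdMatrix_comp, stdMatrix_comp, Matrix.mul_kronecker_mul, mul_assoc, key, ← mul_assoc,
      kronecker_mobiusDeriv_comm h.fixedTensor_baseE h.fixedTensor_baseF, mul_assoc]

theorem exchange_mulVec (v : Matrix (Fin n × Fin n) (Fin n × Fin n) ℂ) (d : Fin n × Fin n → ℂ)
    (a : Fin n × Fin n) : (exchange rfl v).mulVec d a =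
      (star v).mulVec (fun b => d (b.2, b.1)) (a.2, a.1) := by
  rw [Matrix.mulVec, Matrix.mulVec, dotProduct, dotProduct,
    ← (Equiv.prodComm (Fin n) (Fin n)).sum_comp]
  rfl

theorem productUnitaryEquivalent_of_antidiagonal
    {u v : Matrix.unitaryGroup (Fin n × Fin n) ℂ}
    {S S' : Subalgebra ℂ (Fock n n →L[ℂ] Fock n n)} {hS : IsApprox u S} {hS' : IsApprox v S'}
    {Γ : S ≃ₐ[ℂ] S'} (h : IsIso hS hS' Γ) (h1 : h.blockEE = 0)
    (h2 : h.blockFF = 0) : ProductUnitaryEquivalent u.1 (exchange rfl v.1) := by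
  have key : (stdMatrix h.blockEF ⊗ₖ stdMatrix h.blockFE) * exchange rfl v.1 =
      u.1 * (stdMatrix h.blockEF ⊗ₖ stdMatrix h.blockFE) := by
    refine matrix_eq_of_mulVec fun d => ?_
    rw [← Matrix.mulVec_mulVec, ← Matrix.mulVec_mulVec]
    funext ⟨i, j⟩
    -- The coefficients are chosen so that `v` maps them to the flip of `d`. The two orderings in
    -- `quadForm` then carry `d` and `ṽ d`, up to the flip.
    have e := h.quad_relation ((star v.1).mulVec fun b => d (b.2, b.1)) i j
    have hv : v.1.mulVec ((star v.1).mulVec fun b => d (b.2, b.1)) = fun b => d (b.2, b.1) := by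
      rw [Matrix.mulVec_mulVec, Matrix.mem_unitaryGroup_iff.1 v.2, Matrix.one_mulVec]
    simp only [quadForm_apply, hv, h.coordE_genE, h.coordE_genF, h.coordF_genE, h.coordF_genF, h1,
      h2, show ∀ a b, stdMatrix (0 : EuclideanSpace ℂ (Fin n) →ₗ[ℂ] EuclideanSpace ℂ (Fin n)) a b = 0
        from fun _ _ => rfl, mul_zero, add_zero, zero_add] at e
    rw [Matrix.mulVec, Matrix.mulVec, dotProduct, dotProduct, Fintype.sum_prod_type (f := fun a =>
      u.1 (i, j) a * ((stdMatrix h.blockEF ⊗ₖ stdMatrix h.blockFE).mulVec d) a)]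
    refine Eq.trans ?_ (e.trans ?_)
    · rw [← (Equiv.prodComm (Fin n) (Fin n)).sum_comp]
      refine Finset.sum_congr rfl fun a _ => ?_
      rw [Matrix.kronecker_apply, exchange_mulVec]
      simp only [Equiv.prodComm_apply, Prod.fst_swap, Prod.snd_swap]
      ring
    · refine Finset.sum_congr rfl fun k _ => Finset.sum_congr rfl fun l _ => ?_
      rw [Matrix.mulVec, dotProduct]
      congr 1
      rw [← (Equiv.prodComm (Fin n) (Fin n)).sum_comp]
      refine Finset.sum_congr rfl fun a _ => ?_
      rw [Matrix.kronecker_apply]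
      simp only [Equiv.prodComm_apply, Prod.fst_swap, Prod.snd_swap, Prod.mk.eta]
      ring
  refine ⟨stdMatrix (mobiusDeriv h.baseE ∘ₗ h.blockEF), stdMatrix_mem_unitaryGroup fun x => ?_,
    stdMatrix (mobiusDeriv h.baseF ∘ₗ h.blockFE), stdMatrix_mem_unitaryGroup fun y => ?_, ?_⟩
  · rw [← h.norm_inr x, h2]
    simp
  · rw [← h.norm_inl y, h1]
    simp
  · rw [stdMatrix_comp, stdMatrix_comp, Matrix.mul_kronecker_mul, mul_assoc, key, ← mul_assoc,
      kronecker_mobiusDeriv_comm h.fixedTensor_baseE h.fixedTensor_baseF, mul_assoc]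

theorem productUnitaryEquivalent (h : IsIso hS hS' Γ) (hn : 0 < n) (hm : 0 < m) :
    ProductUnitaryEquivalent u.1 v.1 ∨
      ∃ h : n = m, ProductUnitaryEquivalent u.1 (exchange h v.1) := by
  have hsplit : ∀ x y, h.tangent (x, y) =
      (h.blockEE x + h.blockEF y, h.blockFE x + h.blockFF y) := by
    intro x y
    rw [← Prod.mk_add_mk, ← tangent_inl, ← tangent_inr, ← map_add, Prod.mk_add_mk, add_zero,
      zero_add]
  rcases h.blocks_inl with h1 | h1 <;> rcases h.blocks_inr with h2 | h2
  -- Both blocks into the `E`-part vanish here, which contradicts surjectivity as `n > 0`.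
  · obtain ⟨⟨x, y⟩, hxy⟩ := h.tangent_surjective (EuclideanSpace.single ⟨0, hn⟩ 1, 0)
    rw [hsplit, h1, h2] at hxy
    have := congrArg (fun p => p.1 (⟨0, hn⟩ : Fin n)) hxy
    simp at this
  -- In the antidiagonal case the two remaining blocks are injective, one in each direction, so the
  -- dimensions agree.
  · have hnm : n = m := by
      apply le_antisymm
      · have : Function.Injective h.blockFE := by
          intro x x' e
          have : h.tangent (x, 0) = h.tangent (x', 0) := by
            rw [tangent_inl, tangent_inl, h1, e]; rfl
          exact congrArg Prod.fst (h.tangent_injective this)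
        simpa using LinearMap.finrank_le_finrank_of_injective this
      · have : Function.Injective h.blockEF := by
          intro x x' e
          have : h.tangent (0, x) = h.tangent (0, x') := by
            rw [tangent_inr, tangent_inr, h2, e]; rfl
          exact congrArg Prod.snd (h.tangent_injective this)
        simpa using LinearMap.finrank_le_finrank_of_injective this
    subst hnm
    exact Or.inr ⟨rfl, h.productUnitaryEquivalent_of_antidiagonal h1 h2⟩
  · exact Or.inl (h.productUnitaryEquivalent_of_diagonal h1 h2)
  · obtain ⟨⟨x, y⟩, hxy⟩ := h.tangent_surjective (0, EuclideanSpace.single ⟨0, hm⟩ 1)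
    rw [hsplit, h1, h2] at hxy
    have := congrArg (fun p => p.2 (⟨0, hm⟩ : Fin m)) hxy
    simp at this

end IsIso

/-! ### The norm closed and the weak* closed algebras -/

theorem continuous_coeff_norm {F : (Fock n m →L[ℂ] Fock n m) →ₗ[ℂ] ℂ} (hF : F ∈ coeffSpan n m) :
    Continuous F := by
  induction hF using Submodule.span_induction with
  | mem F hF =>
    obtain ⟨ℓ, x, rfl⟩ := hF
    exact ℓ.continuous.comp (ContinuousLinearMap.apply ℂ (Fock n m) x).continuous
  | zero => exact continuous_const
  | add F G _ _ h1 h2 => exact h1.add h2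
  | smul c F _ h1 => exact h1.const_smul c

theorem continuous_coeff_weakStar {F : (Fock n m →L[ℂ] Fock n m) →ₗ[ℂ] ℂ}
    (hF : F ∈ coeffSpan n m) : @Continuous _ _ (weakStar _) _ F := by
  let _ : TopologicalSpace (Fock n m →L[ℂ] Fock n m) := weakStar _
  induction hF using Submodule.span_induction with
  | mem F hF =>
    obtain ⟨ℓ, x, rfl⟩ := hF
    -- A vector functional is a normal functional whose sequences have one nonzero term, with `ℓ`
    -- represented by its Riesz vector.
    have hs : ∀ y : Fock n m, Summable fun k : ℕ => ‖(Pi.single 0 y : ℕ → Fock n m) k‖ ^ 2 := by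
      intro y
      refine summable_of_ne_finset_zero (s := {0}) fun k hk => ?_
      rw [Pi.single_eq_of_ne (by simpa using hk)]
      simp
    have h := continuous_normalFunctional (hs ((InnerProductSpace.toDual ℂ (Fock n m)).symm ℓ))
      (hs x)
    refine h.congr fun T => ?_
    rw [normalFunctional, tsum_eq_single 0]
    · simp [InnerProductSpace.toDual_symm_apply]
    · intro k hk
      simp [Pi.single_eq_of_ne hk]
  | zero => exact continuous_const
  | add F G _ _ h1 h2 => exact h1.add h2
  | smul c F _ h1 => exact h1.const_smul c

theorem isApprox_normAlg (u : Matrix.unitaryGroup (Fin n × Fin m) ℂ) : IsApprox u (normAlg u) where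
  le := Subalgebra.le_topologicalClosure _
  ext F hF h T hT := by
    have hc : IsClosed {T | F T = 0} := isClosed_eq (continuous_coeff_norm hF) continuous_const
    exact closure_minimal (s := (polyAlg u : Set (Fock n m →L[ℂ] Fock n m))) h hc hT

theorem isApprox_weakStarAlg (u : Matrix.unitaryGroup (Fin n × Fin m) ℂ) :
    IsApprox u (weakStarAlg u) where
  le := by
    let _ : TopologicalSpace (Fock n m →L[ℂ] Fock n m) := weakStar _
    exact subset_closure (s := (polyAlg u : Set (Fock n m →L[ℂ] Fock n m)))
  ext F hF h T hT := by
    let _ : TopologicalSpace (Fock n m →L[ℂ] Fock n m) := weakStar _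
    have hc : IsClosed {T | F T = 0} := isClosed_eq (continuous_coeff_weakStar hF) continuous_const
    exact closure_minimal (s := (polyAlg u : Set (Fock n m →L[ℂ] Fock n m))) h hc hT

/-- Continuous functions on a subspace of the closure of `s` that agree on `s` are equal. -/
theorem eq_of_eqOn_of_subset_closure {A : Type*} [TopologicalSpace A] {s t : Set A}
    (hst : s ⊆ t) (hts : t ⊆ closure s) {f g : t → ℂ} (hf : Continuous f) (hg : Continuous g)
    (h : ∀ (a) (ha : a ∈ s), f ⟨a, hst ha⟩ = g ⟨a, hst ha⟩) : f = g := by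
  refine Continuous.ext_on (s := Subtype.val ⁻¹' s) ?_ hf hg fun a ha => h a.1 ha
  intro a
  rw [closure_subtype, Subtype.image_preimage_coe, Set.inter_eq_right.2 hst]
  exact hts a.2

theorem isIso_normAlg {u v : Matrix.unitaryGroup (Fin n × Fin m) ℂ}
    {Ψ : normAlg u ≃ₐ[ℂ] normAlg v} (hΨ : Isometry Ψ) :
    IsIso (isApprox_normAlg u) (isApprox_normAlg v) Ψ where
  norm_map T := hΨ.norm_map_of_map_zero (map_zero Ψ) T
  ext ℓ ℓ' h T := by
    have := eq_of_eqOn_of_subset_closure (s := (polyAlg u : Set (Fock n m →L[ℂ] Fock n m)))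
      (t := normAlg u) (isApprox_normAlg u).le (fun _ h => h)
      (f := fun T => ℓ (T.1 (vac n m))) (g := fun T => ℓ' ((Ψ T).1 (vac n m)))
      ((continuous_coeff_norm (coeff_mem ℓ (vac n m))).comp continuous_subtype_val)
      ((continuous_coeff_norm (coeff_mem ℓ' (vac n m))).comp
        (continuous_subtype_val.comp hΨ.continuous)) h
    exact congrFun this T

theorem isIso_weakStarAlg {u v : Matrix.unitaryGroup (Fin n × Fin m) ℂ}
    {Γ : weakStarAlg u ≃ₐ[ℂ] weakStarAlg v} (hΓ : Isometry Γ)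
    (hc : @Continuous _ _ (relWeakStar (weakStarAlg u)) (relWeakStar (weakStarAlg v)) Γ) :
    IsIso (isApprox_weakStarAlg u) (isApprox_weakStarAlg v) Γ where
  norm_map T := hΓ.norm_map_of_map_zero (map_zero Γ) T
  ext ℓ ℓ' h T := by
    let _ : TopologicalSpace (Fock n m →L[ℂ] Fock n m) := weakStar _
    have := eq_of_eqOn_of_subset_closure (s := (polyAlg u : Set (Fock n m →L[ℂ] Fock n m)))
      (t := weakStarAlg u) (isApprox_weakStarAlg u).le (fun _ h => h)
      (f := fun T => ℓ (T.1 (vac n m))) (g := fun T => ℓ' ((Γ T).1 (vac n m)))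
      ((continuous_coeff_weakStar (coeff_mem ℓ (vac n m))).comp continuous_subtype_val)
      ((continuous_coeff_weakStar (coeff_mem ℓ' (vac n m))).comp
        (continuous_subtype_val.comp hc)) h
    exact congrFun this T

/-- If one of the index sets is empty, there is nothing to prove. -/
theorem productUnitaryEquivalent_of_isEmpty [IsEmpty (Fin n × Fin m)]
    (u v : Matrix (Fin n × Fin m) (Fin n × Fin m) ℂ) : ProductUnitaryEquivalent u v :=
  ⟨1, one_mem _, 1, one_mem _, Subsingleton.elim _ _⟩

theorem productUnitaryEquivalent_of_isIso {u v : Matrix.unitaryGroup (Fin n × Fin m) ℂ}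
    {S S' : Subalgebra ℂ (Fock n m →L[ℂ] Fock n m)} {hS : IsApprox u S} {hS' : IsApprox v S'}
    {Γ : S ≃ₐ[ℂ] S'} (h : IsIso hS hS' Γ) : ProductUnitaryEquivalent u.1 v.1 ∨
      ∃ h : n = m, ProductUnitaryEquivalent u.1 (exchange h v.1) := by
  rcases isEmpty_or_nonempty (Fin n × Fin m) with he | ⟨⟨i, j⟩⟩
  · exact Or.inl (productUnitaryEquivalent_of_isEmpty _ _)
  · exact h.productUnitaryEquivalent i.pos j.pos

end UnitaryRelation
end

open UnitaryRelation in
theorem theorem5p9 {n m : ℕ} (u v : Matrix.unitaryGroup (Fin n × Fin m) ℂ) :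
    List.TFAE
      [∃ Ψ : normAlg u ≃ₐ[ℂ] normAlg v, Isometry Ψ,
       ∃ Ψ : normAlg u ≃ₐ[ℂ] normAlg v, Isometry Ψ ∧ IsGraded Ψ,
       ProductUnitaryEquivalent u.1 v.1 ∨
         ∃ h : n = m, ProductUnitaryEquivalent u.1 (exchange h v.1),
       ∃ Γ : weakStarAlg u ≃ₐ[ℂ] weakStarAlg v, Isometry Γ ∧
         @Continuous _ _ (relWeakStar (weakStarAlg u)) (relWeakStar (weakStarAlg v)) Γ] := by
  tfae_have 2 → 1 := fun ⟨Ψ, h, _⟩ => ⟨Ψ, h⟩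
  tfae_have 1 → 3 := fun ⟨_, h⟩ => productUnitaryEquivalent_of_isIso (isIso_normAlg h)
  tfae_have 4 → 3 := fun ⟨_, h, hc⟩ => productUnitaryEquivalent_of_isIso (isIso_weakStarAlg h hc)
  tfae_have 3 → 2 := fun h => (exists_isShiftPair h).elim fun _ ⟨_, hXY⟩ => hXY.exists_graded
  tfae_have 3 → 4 := fun h => (exists_isShiftPair h).elim fun _ ⟨_, hXY⟩ => hXY.exists_weakStar
  tfae_finish
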